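/- Let $\mathrm{HMAC}:\{0,1\}^*\times\{0,1\}^*\to\{0,1\}^*$ be a keyed function computable in polynomial time with $|\mathrm{HMAC}(k,x)|=|k|$, so that for keys $k\in\{0,1\}^\lambda$ it maps bit strings to $\{0,1\}^\lambda$. For a probabilistic polynomial-time (PPT) oracle algorithm $D$ put $$\mathrm{Adv}_D(\lambda)=\bigl|\Pr[D^{\mathrm{HMAC}(k,\cdot)}(1^\lambda)=1]-\Pr[D^{f(\cdot)}(1^\lambda)=1]\bigr|,$$ where $k$ is uniform in $\{0,1\}^\lambda$ and $f:\{0,1\}^*\to\{0,1\}^\lambda$ is a random function. Assume that $\mathrm{HMAC}$ is indistinguishable from a random function, i.e. for every PPT $D$ there is a negligible $\alpha$ with $\mathrm{Adv}_D\le\alpha$. A token is a pair $r=(m,t)$ of a message $m=(p;c_1,\dots,c_n)$, $n\ge 0$, consisting of a root payload $p$ and commands $c_i$ (bit strings; all per-token fields such as expiration time and randomizer are regarded as part of the command), and a tag $t$. The user-tied RAF construction is $(Gen,UserIssue,ServiceIssue,Ver)$ with - $Gen(1^\lambda)$: a uniformly random $k\in\{0,1\}^\lambda$; - $Ver(k,(m,t))$: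 for $m=(p;c_1,\dots,c_n)$ compute $h_0=\mathrm{HMAC}(k,p)$ and $h_i=\mathrm{HMAC}(h_{i-1},\,p\|c_1\|\cdots\|c_i)$ for $1\le i\le n$; return $1$ if $h_n=t$, otherwise $0$; - $UserIssue(k,p,c)=\bigl((p;c),\ \mathrm{HMAC}(\mathrm{HMAC}(k,p),p\|c)\bigr)$; - $ServiceIssue(k,r,c)$, for $r=((p;c_1,\dots,c_n),t)$: if $Ver(k,r)=1$, the token $\bigl((p;c_1,\dots,c_n,c),\ \mathrm{HMAC}(t,p\|c_1\|\cdots\|c_n\|c)\bigr)$, otherwise nothing. Here $\|$ is concatenation of self-delimiting encodings of the fields. If $ServiceIssue(k,r',c)=r$ for some $c$, then $r'$ is the parent of $r$; ancestors are obtained by iterating this. In the game $ForgeUTT_{\mathcal A}(\lambda)$ a key $k\leftarrow Gen(1^\lambda)$ is chosen, and $\mathcal A$, on input $1^\lambda$ and with oracles $Ver(k,\cdot)$, $UserIssue(k,\cdot,\cdot)$, $ServiceIssue(k,\cdot,\cdot)$, outputs a token $r$. Let $\Phi$ be the set of all tokens that the oracles $UserIssue$ and $ServiceIssue$ have issued to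 $\mathcal A$. Then $\mathcal A$ wins (the game returns $1$) iff $Ver(k,r)=1$ and neither $r$ nor any of its ancestors is in $\Phi$. Then the following hold. 1. The construction is a user-tied RAF token: its four algorithms run in (probabilistic) polynomial time, $UserIssue(k,p,c)$ returns a token with message $(p;c)$, $ServiceIssue$ returns a token exactly for valid input tokens and extends their message by the given command, and the construction is correct: for every $k$ output by $Gen$, every token returned by $UserIssue(k,\cdot,\cdot)$ or $ServiceIssue(k,\cdot,\cdot)$ is accepted by $Ver(k,\cdot)$. 2. It is unforgeable under chosen-message attack: for every PPT adversary $\mathcal A$ there is a negligible function $\mathrm{negl}$ with $\Pr[ForgeUTT_{\mathcal A}(\lambda)=1]\le\mathrm{negl}(\lambda)$ for all $\lambda$. 3. Quantitatively, for every PPT adversary $\mathcal A$ there are a PPT distinguisher $D$ and a polynomial $q$ such that for all $\lambda$ $$\Pr[ForgeUTT_{\mathcal A}(\lambda)=1]\le q(\lambda)\,\bigl(\mathrm{Adv}_D(\lambda)+2^{-\lambda}\bigr).$$ -/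

import Mathlib

/-! ## Probabilistic oracle programs with a step count

Data are binary trees.  Programs are while-programs over registers holding such trees, with
coin tosses and oracle calls.  Evaluating an expression costs the total size of all values
that are read or built, so that no value can be larger than the time spent on it. -/

namespace RAF

/-- Binary trees, the values handled by programs. -/
inductive Data : Type
  | nil : Data
  | pair : Data → Data → Data
  deriving DecidableEq

namespace Data

/-- The number of nodes of a tree. -/
def size : Data → ℕ
  | nil => 1
  | pair a b => 1 + a.size + b.size

/-- First component; `nil` has no components and is mapped to itself. -/
def fst : Data → Data
  | nil => nil
  | pair a _ => a

/-- Second component; `nil` has no components and is mapped to itself. -/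
def snd : Data → Data
  | nil => nil
  | pair _ b => b

def ofBool : Bool → Data
  | false => nil
  | true => pair nil nil

def toBool : Data → Bool
  | nil => false
  | pair _ _ => true

def ofList : List Data → Data
  | [] => nil
  | a :: l => pair a (ofList l)

def toList : Data → List Data
  | nil => []
  | pair a b => a :: b.toList

/-- A bit string as a tree. -/
def ofBits (l : List Bool) : Data := ofList (l.map ofBool)

/-- The bit string represented by a tree; every tree is read as some bit string. -/
def toBits (d : Data) : List Bool := d.toList.map toBool

end Data

/-- Contents of the registers. -/
abbrev Store : Type := ℕ → Data

/-- Expressions over registers. `eq` yields the bit telling whether two values are equal. -/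
inductive Expr : Type
  | var : ℕ → Expr
  | nil : Expr
  | pair : Expr → Expr → Expr
  | fst : Expr → Expr
  | snd : Expr → Expr
  | eq : Expr → Expr → Expr

namespace Expr

def eval (s : Store) : Expr → Data
  | var x => s x
  | nil => Data.nil
  | pair e f => Data.pair (e.eval s) (f.eval s)
  | fst e => (e.eval s).fst
  | snd e => (e.eval s).snd
  | eq e f => Data.ofBool (decide (e.eval s = f.eval s))

/-- Cost of evaluating an expression: the sizes of the values of all its subexpressions. -/
def cost (s : Store) : Expr → ℕ
  | var x => (s x).size
  | nil => 1
  | pair e f => (Data.pair (e.eval s) (f.eval s)).size + e.cost s + f.cost s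
  | fst e => (e.eval s).fst.size + e.cost s
  | snd e => (e.eval s).snd.size + e.cost s
  | eq e f => 1 + e.cost s + f.cost s

end Expr

/-- Programs.
* `assign x e`: write the value of `e` into register `x`;
* `ite e c d`: run `c` if the value of `e` is not `nil`, otherwise `d`;
* `loop e c`: repeat `c` as long as the value of `e` is not `nil`;
* `flip x`: write the result of a fair coin toss into register `x`;
* `call i e x`: ask oracle number `i` the value of `e`, write its answer into register `x`. -/
inductive Prog : Type
  | assign : ℕ → Expr → Prog
  | seq : Prog → Prog → Prog
  | ite : Expr → Prog → Prog → Prog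
  | loop : Expr → Prog → Prog
  | flip : ℕ → Prog
  | call : ℕ → Expr → ℕ → Prog

/-- Programs without coin tosses and oracle calls. -/
def Prog.Deterministic : Prog → Prop
  | .assign _ _ => True
  | .seq c d => c.Deterministic ∧ d.Deterministic
  | .ite _ c d => c.Deterministic ∧ d.Deterministic
  | .loop _ c => c.Deterministic
  | .flip _ => False
  | .call _ _ _ => False

/-- A configuration: the programs still to be executed, the registers, the time used so far. -/
structure Config : Type where
  todo : List Prog
  store : Store
  time : ℕ

namespace Config

/-- One step. The coin `b` is used only if the next instruction is a coin toss, the answer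
`ans` only if it is an oracle call. A configuration with nothing left to do stays unchanged.
Every other step costs at least one unit of time. -/
def next (b : Bool) (ans : List Bool) : Config → Config
  | ⟨[], s, t⟩ => ⟨[], s, t⟩
  | ⟨.assign x e :: K, s, t⟩ => ⟨K, Function.update s x (e.eval s), t + 1 + e.cost s⟩
  | ⟨.seq c d :: K, s, t⟩ => ⟨c :: d :: K, s, t + 1⟩
  | ⟨.ite e c d :: K, s, t⟩ =>
      ⟨(if e.eval s = Data.nil then d else c) :: K, s, t + 1 + e.cost s⟩
  | ⟨.loop e c :: K, s, t⟩ =>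
      ⟨if e.eval s = Data.nil then K else c :: .loop e c :: K, s, t + 1 + e.cost s⟩
  | ⟨.flip x :: K, s, t⟩ => ⟨K, Function.update s x (Data.ofBool b), t + 1⟩
  | ⟨.call _ e x :: K, s, t⟩ =>
      ⟨K, Function.update s x (Data.ofBits ans), t + 1 + e.cost s + (Data.ofBits ans).size⟩

/-- The configuration after `n` steps, for given coins and oracle answers. -/
def exec (coin : ℕ → Bool) (ans : ℕ → List Bool) (c : Config) : ℕ → Config
  | 0 => c
  | n + 1 => (exec coin ans c n).next (coin n) (ans n)

/-- Initial configuration: the input is in register `0`, all other registers are `nil`. -/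
def init (c : Prog) (input : Data) : Config :=
  ⟨[c], Function.update (fun _ => Data.nil) 0 input, 0⟩

/-- The program has stopped, having used time at most `T`. -/
def HaltedWithin (c : Config) (T : ℕ) : Prop := c.todo = [] ∧ c.time ≤ T

end Config

/-- A family of oracles, numbered by `ℕ`, possibly probabilistic and with internal state `σ`. -/
abbrev Oracle (σ : Type) : Type := ℕ → Data → σ → PMF (List Bool × σ)

/-- One step of a probabilistic execution with an oracle. -/
noncomputable def stepWith {σ : Type} (O : Oracle σ) (cs : Config × σ) : PMF (Config × σ) :=
  match cs.1.todo with
  | .flip _ :: _ => (PMF.uniformOfFintype Bool).map fun b => (cs.1.next b [], cs.2)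
  | .call i e _ :: _ =>
      (O i (e.eval cs.1.store) cs.2).map fun r => (cs.1.next false r.1, r.2)
  | _ => PMF.pure (cs.1.next false [], cs.2)

/-- The distribution of the configuration and the oracle state after `n` steps. -/
noncomputable def runWith {σ : Type} (O : Oracle σ) (cs : Config × σ) : ℕ → PMF (Config × σ)
  | 0 => PMF.pure cs
  | n + 1 => (runWith O cs n).bind (stepWith O)

/-- A probabilistic polynomial-time oracle algorithm: on input `1^l` it stops within `bound l`
steps, whatever the coins are and whatever the oracles answer, as long as the answers have at
most `l + 1` bits. -/
structure PPT : Type where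
  prog : Prog
  bound : Polynomial ℕ
  halts : ∀ (l : ℕ) (coin : ℕ → Bool) (ans : ℕ → List Bool), (∀ n, (ans n).length ≤ l + 1) →
    ((Config.init prog (Data.ofBits (List.replicate l true))).exec coin ans
      (bound.eval l)).HaltedWithin (bound.eval l)

/-- The joint distribution of the output of the algorithm on input `1^l`, found in register
`0`, and the final state of the oracles. -/
noncomputable def PPT.run {σ : Type} (A : PPT) (O : Oracle σ) (l : ℕ) (s : σ) : PMF (Data × σ) :=
  (runWith O (Config.init A.prog (Data.ofBits (List.replicate l true)), s)
    (A.bound.eval l)).map fun r => (r.1.store 0, r.2)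

/-- The function taking the input represented by `inp a` to the output represented by `out a`
is computed by a deterministic program in time polynomial in the size of its input. -/
def PolyTime {α : Type} (inp out : α → Data) : Prop :=
  ∃ c : Prog, c.Deterministic ∧ ∃ T : Polynomial ℕ, ∀ a : α,
    let final := (Config.init c (inp a)).exec (fun _ => false) (fun _ => [])
      (T.eval (inp a).size)
    final.HaltedWithin (T.eval (inp a).size) ∧ final.store 0 = out a

/-! ## Pseudorandomness -/

/-- `f` tends to zero faster than the inverse of every polynomial. -/
def Negligible (f : ℕ → ℝ) : Prop :=
  Asymptotics.SuperpolynomialDecay Filter.atTop (fun n : ℕ => (n : ℝ)) f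

/-- A uniformly distributed bit string of length `l`. -/
noncomputable def uniformBits (l : ℕ) : PMF (List Bool) :=
  (PMF.uniformOfFintype (Fin l → Bool)).map List.ofFn

/-- The oracle `F k`. -/
noncomputable def keyedOracle (F : List Bool → List Bool → List Bool) (k : List Bool) :
    Oracle Unit :=
  fun _ d s => PMF.pure (F k d.toBits, s)

/-- A random function from bit strings to `{0,1}^l`: a new query gets a fresh uniformly
distributed answer, a repeated query gets the earlier answer. The state is the table of the
values fixed so far. -/
noncomputable def randomOracle (l : ℕ) : Oracle (List Bool → Option (List Bool)) :=
  fun _ d tbl =>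
    match tbl d.toBits with
    | some y => PMF.pure (y, tbl)
    | none => (uniformBits l).map fun y => (y, Function.update tbl d.toBits (some y))

/-- The probability that `D` outputs `1` with oracle `F k`, for uniformly random `k`. -/
noncomputable def prKeyed (F : List Bool → List Bool → List Bool) (D : PPT) (l : ℕ) : ℝ :=
  (((uniformBits l).bind fun k =>
    (D.run (keyedOracle F k) l ()).map fun r => r.1.toBool) true).toReal

/-- The probability that `D` outputs `1` with a random function as its oracle. -/
noncomputable def prRandom (D : PPT) (l : ℕ) : ℝ :=
  (((D.run (randomOracle l) l (fun _ => none)).map fun r => r.1.toBool) true).toReal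

/-- The advantage of `D` in distinguishing `F` from a random function. -/
noncomputable def prfAdvantage (F : List Bool → List Bool → List Bool) (D : PPT) (l : ℕ) : ℝ :=
  |prKeyed F D l - prRandom D l|

/-- `F` is indistinguishable from a random function. -/
def IsPRF (F : List Bool → List Bool → List Bool) : Prop :=
  ∀ D : PPT, ∃ α : ℕ → ℝ, Negligible α ∧ ∀ l, prfAdvantage F D l ≤ α l

/-! ## User-tied tokens -/

/-- The message of a token: a root payload and the list of commands added so far. -/
structure Message : Type where
  root : List Bool
  cmds : List (List Bool)

/-- A token `(m, t)`. -/
structure Token : Type where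
  msg : Message
  tag : List Bool

def Message.toData (m : Message) : Data :=
  .pair (.ofBits m.root) (.ofList (m.cmds.map .ofBits))

def Message.ofData (d : Data) : Message := ⟨d.fst.toBits, d.snd.toList.map Data.toBits⟩

def Token.toData (r : Token) : Data := .pair r.msg.toData (.ofBits r.tag)

def Token.ofData (d : Data) : Token := ⟨Message.ofData d.fst, d.snd.toBits⟩

/-- The algorithms `(Gen, UserIssue, ServiceIssue, Ver)`; `none` means that nothing is
returned. -/
structure Scheme : Type where
  gen : ℕ → PMF (List Bool)
  userIssue : List Bool → List Bool → List Bool → Token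
  serviceIssue : List Bool → Token → List Bool → Option Token
  ver : List Bool → Token → Bool

namespace Scheme

/-- All four algorithms run in (probabilistic) polynomial time. -/
def IsEfficient (S : Scheme) : Prop :=
  (∃ G : PPT, ∀ l, (G.run (fun _ _ s => PMF.pure ([], s)) l ()).map (fun r => r.1.toBits)
      = S.gen l) ∧
  PolyTime (fun a : List Bool × List Bool × List Bool =>
      .pair (.ofBits a.1) (.pair (.ofBits a.2.1) (.ofBits a.2.2)))
    (fun a => (S.userIssue a.1 a.2.1 a.2.2).toData) ∧
  PolyTime (fun a : List Bool × Token × List Bool =>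
      .pair (.ofBits a.1) (.pair a.2.1.toData (.ofBits a.2.2)))
    (fun a => match S.serviceIssue a.1 a.2.1 a.2.2 with
      | none => .nil
      | some r => .pair .nil r.toData) ∧
  PolyTime (fun a : List Bool × Token => .pair (.ofBits a.1) a.2.toData)
    (fun a => .ofBool (S.ver a.1 a.2))

/-- `UserIssue` issues a token for the given payload and command; `ServiceIssue` extends
exactly the valid tokens, by the given command. -/
def IsWellFormed (S : Scheme) : Prop :=
  (∀ k p c, (S.userIssue k p c).msg = ⟨p, [c]⟩) ∧
  (∀ k r c, (S.serviceIssue k r c).isSome = S.ver k r) ∧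
  (∀ k r c r', S.serviceIssue k r c = some r' → r'.msg = ⟨r.msg.root, r.msg.cmds ++ [c]⟩)

/-- All issued tokens are valid. -/
def IsCorrect (S : Scheme) : Prop :=
  ∀ l, ∀ k ∈ (S.gen l).support,
    (∀ p c, S.ver k (S.userIssue k p c) = true) ∧
    (∀ r c r', S.serviceIssue k r c = some r' → S.ver k r' = true)

/-- A (correct) user-tied token. -/
def IsUserTiedToken (S : Scheme) : Prop :=
  S.IsEfficient ∧ S.IsWellFormed ∧ S.IsCorrect

/-- The token `r` is derived from its parent `r'` by adding a command. -/
def IsParent (S : Scheme) (k : List Bool) (r' r : Token) : Prop :=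
  ∃ c, S.serviceIssue k r' c = some r

/-- The oracles of the forging game: `0` is `Ver k`, `1` is `UserIssue k`, `2` is
`ServiceIssue k`. The state is the list of all tokens that have been issued. For an issued
token `(m, t)` the answer is `t`, since `m` is determined by the query; the answer is empty
if nothing is issued. -/
noncomputable def oracle (S : Scheme) (k : List Bool) : Oracle (List Token)
  | 0, d, Φ => PMF.pure ([S.ver k (Token.ofData d)], Φ)
  | 1, d, Φ =>
      let r := S.userIssue k d.fst.toBits d.snd.toBits
      PMF.pure (r.tag, r :: Φ)
  | 2, d, Φ =>
      match S.serviceIssue k (Token.ofData d.fst) d.snd.toBits with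
      | none => PMF.pure ([], Φ)
      | some r => PMF.pure (r.tag, r :: Φ)
  | _, _, Φ => PMF.pure ([], Φ)

/-- The winning condition: `r` is valid, and neither `r` nor any of its ancestors is in `Φ`. -/
def Wins (S : Scheme) (k : List Bool) (Φ : List Token) (r : Token) : Prop :=
  S.ver k r = true ∧ ∀ r', Relation.ReflTransGen (S.IsParent k) r' r → r' ∉ Φ

open scoped Classical in
/-- The game of forging a token. -/
noncomputable def forgeUTT (S : Scheme) (A : PPT) (l : ℕ) : PMF Bool :=
  (S.gen l).bind fun k =>
    (A.run (S.oracle k) l []).map fun x => decide (S.Wins k x.2 (Token.ofData x.1))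

/-- The probability that `A` wins the game. -/
noncomputable def forgeProb (S : Scheme) (A : PPT) (l : ℕ) : ℝ := (S.forgeUTT A l true).toReal

/-- Unforgeability under chosen-message attack. -/
def IsUnforgeable (S : Scheme) : Prop :=
  ∀ A : PPT, ∃ negl : ℕ → ℝ, Negligible negl ∧ ∀ l, S.forgeProb A l ≤ negl l

end Scheme

/-! ## The chained construction -/

/-- A self-delimiting form of a bit string. -/
def field (x : List Bool) : List Bool := x.flatMap (fun b => [true, b]) ++ [false]

/-- The concatenation `p ‖ c₁ ‖ ⋯ ‖ cᵢ` of self-delimiting fields. -/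
def encode (m : Message) : List Bool := (m.root :: m.cmds).flatMap field

/-- Continue the chain of tags: `h` is the tag of the message with root `p` and commands
`done`; every further tag is computed from the extended message, with the preceding tag as
the key. -/
def chainFrom (hmac : List Bool → List Bool → List Bool) (p : List Bool) (h : List Bool)
    (done : List (List Bool)) : List (List Bool) → List Bool
  | [] => h
  | c :: cs => chainFrom hmac p (hmac h (encode ⟨p, done ++ [c]⟩)) (done ++ [c]) cs

/-- The last tag `hₙ` of the chain `h₀ = hmac k p`,
`hᵢ = hmac hᵢ₋₁ (p ‖ c₁ ‖ ⋯ ‖ cᵢ)`. -/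
def chainTag (hmac : List Bool → List Bool → List Bool) (k : List Bool) (m : Message) :
    List Bool :=
  chainFrom hmac m.root (hmac k m.root) [] m.cmds

/-- Verification: recompute the chain of tags. -/
def raftVer (hmac : List Bool → List Bool → List Bool) (k : List Bool) (r : Token) : Bool :=
  decide (chainTag hmac k r.msg = r.tag)

/-- The user-tied construction. -/
noncomputable def raft (hmac : List Bool → List Bool → List Bool) : Scheme where
  gen := uniformBits
  userIssue k p c := ⟨⟨p, [c]⟩, hmac (hmac k p) (encode ⟨p, [c]⟩)⟩
  serviceIssue k r c :=
    if raftVer hmac k r = true then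
      let m : Message := ⟨r.msg.root, r.msg.cmds ++ [c]⟩
      some ⟨m, hmac r.tag (encode m)⟩
    else none
  ver := raftVer hmac

end RAF

/-! Security is a hybrid argument along the chain of keys that leads to the forged token.

Call a token covered if its root payload together with its first command has been issued to a user.
The tag of that user token is the key from which the rest of the chain can be recomputed, so covered
tokens can be verified and extended from a log of issued tags, without the root key. A valid covered
token has an issued ancestor, hence never wins. What matters is therefore the first query that
presents a valid token that is not covered, where the final output counts as one more query to
`Ver`. Until that query all uncovered tokens may be rejected unchecked.

The reduction guesses the number `i` of the query in which the root `p*` of the forgery first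
occurs, the number `j` of the query presenting the forgery, and a level `e ≤ N`, with `N`
polynomially bounded. The commands of the forgery are padded with never-issued commands to length
exactly `N`, so that the path of keys has the same length for all forgeries. The key at level `e` of
this path is the oracle, level `0` being the root key. If `e ≥ 1`, all other roots get independent
random keys; if `e ≥ 2`, the tags issued to users under `p*` are random strings. At the end the
oracle is asked for the next value on the path, the rest of the chain is computed from the answer,
and the result is compared with the chain continued from the forged tag over the padding.

For fixed `i` and `j` let `K e` and `R e` be the probabilities of acceptance with a randomly keyed
oracle and with a random function (`guessKeyed`, `guessRandom`). Three facts carry the proof. (1)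
The forging probability is at most the sum of `K 0` over all `i`, `j`: as long as there is no
forgery, all simulators still waiting answer like the real game, and at a forgery the one with the
right guesses accepts with certainty (`forgery_le_sum`, `forgeUTT_le`). (2) `R e = K (e + 1)`
exactly, for `e < N` (`guessRandom_eq_guessKeyed`). At level `0` the value of the random function at
`p*` is the next key (`game_root`). At later levels the last query has not been asked before, so its
answer is an independent uniform key (`game_path`). (3) `R N ≤ 2 ^ (-l)`: acceptance requires the
value of a random function at a new point to equal a string fixed beforehand (`guessRandom_le`).
With `e`, `i`, `j` uniform below `N + 1`, the differences `K e - R e` telescope, and `(N + 1) ^ 3`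
times the signed advantage is the sum of `K 0 - R N` over `i`, `j`. This is the quantitative claim
(`forgeProb_le`); unforgeability follows from pseudorandomness. Here `N + 1` is a power of two, so
that the guesses are uniform exactly.

The other task is to realize the reduction as a `PPT`. `PT` is a class of polynomial-time functions
closed under composition, pairing, case distinction and folds with bounded intermediate values; it
also gives the efficiency of the scheme. `RunsTo` relates a program to the decision tree of its
coins and oracle calls, and `Simulator.exists_ppt` compiles an algorithm and a simulator with
components in `PT` into a new algorithm with the intended tree. -/

namespace RAF

/-! ## Decision trees of programs -/

/-- Interactive computations that toss coins and ask oracles. -/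
inductive Tree (α : Type) : Type
  | ret : α → Tree α
  | flip : (Bool → Tree α) → Tree α
  | call : ℕ → Data → (List Bool → Tree α) → Tree α

namespace Tree

variable {α β σ : Type}

def bind : Tree α → (α → Tree β) → Tree β
  | ret a, g => g a
  | flip f, g => flip fun b => (f b).bind g
  | call i d f, g => call i d fun a => (f a).bind g

/-- The distribution of the result and the final oracle state. -/
noncomputable def interp (O : Oracle σ) : Tree α → σ → PMF (α × σ)
  | ret a, s => PMF.pure (a, s)
  | flip f, s => (PMF.uniformOfFintype Bool).bind fun b => (f b).interp O s
  | call i d f, s => (O i d s).bind fun r => (f r.1).interp O r.2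

theorem interp_bind (O : Oracle σ) (T : Tree α) (g : α → Tree β) (s : σ) :
    (T.bind g).interp O s = (T.interp O s).bind fun r => (g r.1).interp O r.2 := by
  induction T generalizing s with
  | ret a => simp [bind, interp]
  | flip f ih => simp [bind, interp, ih, PMF.bind_bind]
  | call i d f ih => simp [bind, interp, ih, PMF.bind_bind]

end Tree

namespace Config

/-- The next instruction neither tosses a coin nor calls an oracle. -/
def Silent (c : Config) : Prop :=
  match c.todo with
  | [] => False
  | .flip _ :: _ => False
  | .call _ _ _ :: _ => False
  | _ => True

/-- Since no instruction is free, a bound on the time is also a bound on the number of steps. Step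
counts below are obtained in this way. -/
theorem time_next_of_ne_nil (b : Bool) (a : List Bool) (c : Config) (h : c.todo ≠ []) :
    c.time + 1 ≤ (c.next b a).time := by
  obtain ⟨todo, s, t⟩ := c
  match todo, h with
  | .assign x e :: K, _ => simp only [next]; omega
  | .seq c d :: K, _ => simp only [next]; omega
  | .ite e c d :: K, _ => simp only [next]; omega
  | .loop e c :: K, _ => simp only [next]; omega
  | .flip x :: K, _ => simp only [next]; omega
  | .call i e x :: K, _ => simp only [next]; omega

theorem Silent.ne_nil {c : Config} (h : c.Silent) : c.todo ≠ [] := by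
  intro h0; simp [Silent, h0] at h

theorem Silent.next_eq {c : Config} (h : c.Silent) (b b' : Bool) (a a' : List Bool) :
    c.next b a = c.next b' a' := by
  obtain ⟨todo, s, t⟩ := c
  match todo, h with
  | .assign x e :: K, _ => rfl
  | .seq c d :: K, _ => rfl
  | .ite e c d :: K, _ => rfl
  | .loop e c :: K, _ => rfl

theorem Silent.stepWith_eq {σ : Type} {c : Config} (h : c.Silent) (O : Oracle σ) (s : σ) :
    stepWith O (c, s) = PMF.pure (c.next false [], s) := by
  obtain ⟨todo, st, t⟩ := c
  match todo, h with
  | .assign x e :: K, _ => rfl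
  | .seq c d :: K, _ => rfl
  | .ite e c d :: K, _ => rfl
  | .loop e c :: K, _ => rfl

theorem next_flip_eq {c : Config} {x : ℕ} {K : List Prog} (h : c.todo = .flip x :: K)
    (b : Bool) (a a' : List Bool) : c.next b a = c.next b a' := by
  obtain ⟨todo, s, t⟩ := c
  subst h; rfl

theorem next_call_eq {c : Config} {i x : ℕ} {e : Expr} {K : List Prog}
    (h : c.todo = .call i e x :: K) (b b' : Bool) (a : List Bool) :
    c.next b a = c.next b' a := by
  obtain ⟨todo, s, t⟩ := c
  subst h; rfl

theorem exec_succ' (coin : ℕ → Bool) (ans : ℕ → List Bool) (c : Config) (n : ℕ) :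
    c.exec coin ans (n + 1)
      = (c.next (coin 0) (ans 0)).exec (fun i => coin (i + 1)) (fun i => ans (i + 1)) n := by
  induction n with
  | zero => rfl
  | succ n ih => rw [exec, ih]; rfl

theorem exec_of_nil (coin : ℕ → Bool) (ans : ℕ → List Bool) (c : Config) (h : c.todo = [])
    (n : ℕ) : c.exec coin ans n = c := by
  induction n with
  | zero => rfl
  | succ n ih =>
    obtain ⟨todo, s, t⟩ := c
    subst h
    rw [exec, ih]; rfl

theorem exec_add (coin : ℕ → Bool) (ans : ℕ → List Bool) (c : Config) (n k : ℕ) :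
    c.exec coin ans (n + k)
      = (c.exec coin ans n).exec (fun i => coin (n + i)) (fun i => ans (n + i)) k := by
  induction k with
  | zero => rfl
  | succ k ih => rw [← Nat.add_assoc, exec, ih]; rfl

end Config

theorem runWith_succ' {σ : Type} (O : Oracle σ) (cs : Config × σ) (n : ℕ) :
    runWith O cs (n + 1) = (stepWith O cs).bind fun cs' => runWith O cs' n := by
  induction n with
  | zero => simp [runWith]
  | succ n ih => rw [runWith, ih, PMF.bind_bind]; rfl

theorem runWith_of_nil {σ : Type} (O : Oracle σ) (c : Config) (s : σ) (h : c.todo = [])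
    (n : ℕ) : runWith O (c, s) n = PMF.pure (c, s) := by
  induction n with
  | zero => rfl
  | succ n ih =>
    obtain ⟨todo, st, t⟩ := c
    subst h
    rw [runWith, ih, PMF.pure_bind]; rfl

/-- From configuration `c`, if all oracle answers have at most `m` bits, the execution unfolds
to the tree `T`; a configuration reached at a leaf is related by `R` to the label of the leaf. -/
inductive RunsTo (m : ℕ) {β : Type} (R : Config → β → Prop) : Config → Tree β → Prop
  | ret {c b} : R c b → RunsTo m R c (.ret b)
  | silent {c T} : c.Silent → RunsTo m R (c.next false []) T → RunsTo m R c T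
  | flip {c x K f} : c.todo = .flip x :: K → (∀ b, RunsTo m R (c.next b []) (f b)) →
      RunsTo m R c (.flip f)
  | call {c i e x K f} : c.todo = .call i e x :: K →
      (∀ a : List Bool, a.length ≤ m → RunsTo m R (c.next false a) (f a)) →
      RunsTo m R c (.call i (e.eval c.store) f)

namespace RunsTo

variable {m B : ℕ} {β γ σ : Type} {R : Config → β → Prop} {R' : Config → γ → Prop}
  {c : Config} {T : Tree β}

/-- A leaf only has to satisfy `R`; it need not be a halted configuration. Thus consecutive parts of
a program unfold to the `Tree.bind` of their trees, with `R` as the assertion in between. -/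
theorem bind (h : RunsTo m R c T) (g : β → Tree γ) (hg : ∀ c' b, R c' b → RunsTo m R' c' (g b)) :
    RunsTo m R' c (T.bind g) := by
  induction h with
  | ret hr => exact hg _ _ hr
  | silent hs _ ih => exact .silent hs ih
  | flip hc _ ih => exact .flip hc ih
  | call hc _ ih => exact .call hc ih

theorem mono {R' : Config → β → Prop} (h : RunsTo m R c T) (hg : ∀ c' b, R c' b → R' c' b) :
    RunsTo m R' c T := by
  induction h with
  | ret hr => exact .ret (hg _ _ hr)
  | silent hs _ ih => exact .silent hs ih
  | flip hc _ ih => exact .flip hc ih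
  | call hc _ ih => exact .call hc ih

/-- Time does not decrease along a branch. At an oracle call the empty answer, which is always short
enough, provides a branch to follow. -/
theorem time_le (h : RunsTo m R c T) (hR : ∀ c b, R c b → c.time ≤ B) : c.time ≤ B := by
  induction h with
  | ret hr => exact hR _ _ hr
  | @silent c T hs _ ih => have := c.time_next_of_ne_nil false [] hs.ne_nil; omega
  | @flip c x K f hc _ ih =>
    have := c.time_next_of_ne_nil false [] (by simp [hc])
    have := ih false
    omega
  | @call c i e x K f hc _ ih =>
    have := c.time_next_of_ne_nil false [] (by simp [hc])
    have := ih [] (by simp)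
    omega

theorem exists_exec (h : RunsTo m R c T) (coin : ℕ → Bool) (ans : ℕ → List Bool)
    (hans : ∀ n, (ans n).length ≤ m) :
    ∃ n b, c.time + n ≤ (c.exec coin ans n).time ∧ R (c.exec coin ans n) b := by
  induction h generalizing coin ans with
  | @ret c b hr => exact ⟨0, b, le_rfl, hr⟩
  | @silent c T hs _ ih =>
    obtain ⟨n, b, h1, h2⟩ := ih (fun i => coin (i + 1)) (fun i => ans (i + 1)) (fun n => hans _)
    have := c.time_next_of_ne_nil false [] hs.ne_nil
    refine ⟨n + 1, b, ?_, ?_⟩ <;> rw [Config.exec_succ', hs.next_eq (coin 0) false (ans 0) []]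
    · omega
    · exact h2
  | @flip c x K f hc _ ih =>
    obtain ⟨n, b, h1, h2⟩ :=
      ih (coin 0) (fun i => coin (i + 1)) (fun i => ans (i + 1)) (fun n => hans _)
    have := c.time_next_of_ne_nil (coin 0) [] (by simp [hc])
    refine ⟨n + 1, b, ?_, ?_⟩ <;>
      rw [Config.exec_succ', Config.next_flip_eq hc (coin 0) (ans 0) []]
    · omega
    · exact h2
  | @call c i e x K f hc _ ih =>
    obtain ⟨n, b, h1, h2⟩ :=
      ih (ans 0) (hans 0) (fun i => coin (i + 1)) (fun i => ans (i + 1)) (fun n => hans _)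
    have := c.time_next_of_ne_nil false (ans 0) (by simp [hc])
    refine ⟨n + 1, b, ?_, ?_⟩ <;>
      rw [Config.exec_succ', Config.next_call_eq hc (coin 0) false (ans 0)]
    · omega
    · exact h2

theorem exec_halts (h : RunsTo m R c T) (hR : ∀ c b, R c b → c.todo = [] ∧ c.time ≤ B)
    (coin : ℕ → Bool) (ans : ℕ → List Bool) (hans : ∀ n, (ans n).length ≤ m) :
    ∃ b, R (c.exec coin ans B) b := by
  obtain ⟨n, b, h1, h2⟩ := h.exists_exec coin ans hans
  obtain ⟨h3, h4⟩ := hR _ _ h2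
  obtain ⟨k, rfl⟩ : ∃ k, B = n + k := ⟨B - n, by omega⟩
  refine ⟨b, ?_⟩
  rwa [Config.exec_add, Config.exec_of_nil _ _ _ h3]

/-- A step of the run is either silent or consumes one node of the tree, so both sides make the same
draws. Because every step costs time, `hn` leaves enough steps to reach a leaf. The invariant `W`
guarantees short answers, the only ones described by the tree. -/
theorem map_runWith (h : RunsTo m R c T) {O : Oracle σ} {W : σ → Prop}
    (hW : ∀ i d s, W s → ∀ r ∈ (O i d s).support, r.1.length ≤ m ∧ W r.2)
    (g : Config → γ) (f : β → γ)
    (hR : ∀ c b, R c b → c.todo = [] ∧ c.time ≤ B ∧ g c = f b)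
    (s : σ) (hs : W s) (n : ℕ) (hn : B ≤ c.time + n) :
    (runWith O (c, s) n).map (fun r => (g r.1, r.2))
      = (T.interp O s).map (fun r => (f r.1, r.2)) := by
  induction h generalizing s n with
  | @ret c b hr =>
    obtain ⟨h1, h2, h3⟩ := hR _ _ hr
    rw [runWith_of_nil _ _ _ h1, Tree.interp, PMF.pure_map, PMF.pure_map, h3]
  | @silent c T hsil hrun ih =>
    have h1 := c.time_next_of_ne_nil false [] hsil.ne_nil
    have h2 := hrun.time_le (B := B) fun c b h => (hR c b h).2.1
    obtain ⟨n, rfl⟩ : ∃ k, n = k + 1 := ⟨n - 1, by omega⟩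
    rw [runWith_succ', hsil.stepWith_eq, PMF.pure_bind]
    exact ih s hs n (by omega)
  | @flip c x K f hc hrun ih =>
    have h1 := fun b => c.time_next_of_ne_nil b [] (by simp [hc])
    have h2 := fun b => (hrun b).time_le (B := B) fun c b h => (hR c b h).2.1
    obtain ⟨n, rfl⟩ : ∃ k, n = k + 1 := ⟨n - 1, by have := h1 false; have := h2 false; omega⟩
    have h3 : stepWith O (c, s)
        = (PMF.uniformOfFintype Bool).map fun b => (c.next b [], s) := by
      simp [stepWith, hc]
    rw [runWith_succ', h3, PMF.bind_map, Tree.interp, PMF.map_bind, PMF.map_bind]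
    congr 1
    funext b
    exact ih b s hs n (by have := h1 b; omega)
  | @call c i e x K f hc hrun ih =>
    have h1 := fun a => c.time_next_of_ne_nil false a (by simp [hc])
    have h2 := (hrun [] (by simp)).time_le (B := B) fun c b h => (hR c b h).2.1
    obtain ⟨n, rfl⟩ : ∃ k, n = k + 1 := ⟨n - 1, by have := h1 []; omega⟩
    have h3 : stepWith O (c, s)
        = (O i (e.eval c.store) s).map fun r => (c.next false r.1, r.2) := by
      simp [stepWith, hc]
    rw [runWith_succ', h3, PMF.bind_map, Tree.interp, PMF.map_bind, PMF.map_bind]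
    -- The subtrees are known to be correct only for answers in the support, hence the comparison
    -- term by term.
    refine PMF.ext fun z => ?_
    simp only [PMF.bind_apply]
    refine tsum_congr fun r => ?_
    by_cases hr : r ∈ (O i (e.eval c.store) s).support
    · obtain ⟨hr1, hr2⟩ := hW _ _ _ hs r hr
      rw [Function.comp, ih r.1 hr1 r.2 hr2 n (by have := h1 r.1; omega)]
    · rw [PMF.mem_support_iff, not_not] at hr
      simp [hr]

end RunsTo

/-- One silent step after another. -/
def Reach : Config → Config → Prop :=
  Relation.ReflTransGen fun c c' => c.Silent ∧ c' = c.next false []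

theorem Reach.runsTo {m : ℕ} {β : Type} {R : Config → β → Prop} {c c' : Config} {T : Tree β}
    (h : Reach c c') (hT : RunsTo m R c' T) : RunsTo m R c T := by
  induction h using Relation.ReflTransGen.head_induction_on with
  | refl => exact hT
  | head h _ ih => obtain ⟨h1, rfl⟩ := h; exact .silent h1 ih

/-! ### The tree of a terminating program -/

/-- The tree of the first `n` steps. -/
def Config.tree : ℕ → Config → Tree Config
  | 0, c => .ret c
  | n + 1, c =>
    match c.todo with
    | [] => .ret c
    | .flip _ :: _ => .flip fun b => (c.next b []).tree n
    | .call i e _ :: _ => .call i (e.eval c.store) fun a => (c.next false a).tree n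
    | _ => (c.next false []).tree n

def shiftTape {α : Type} (a : α) (f : ℕ → α) : ℕ → α
  | 0 => a
  | n + 1 => f n

/-- A branch is determined by finitely many coins and answers, and these extend to infinite tapes.
So a property of the runs on all tapes holds at every leaf; `shiftTape` prepends the choice made in
the first step. -/
theorem Config.runsTo_tree {m : ℕ} {P : Config → Prop} (n : ℕ) (c : Config)
    (hP : ∀ (coin : ℕ → Bool) (ans : ℕ → List Bool), (∀ n, (ans n).length ≤ m) →
      P (c.exec coin ans n)) :
    RunsTo m (fun c' b => c' = b ∧ P c') c (c.tree n) := by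
  induction n generalizing c with
  | zero => exact .ret ⟨rfl, hP (fun _ => false) (fun _ => []) (by simp)⟩
  | succ n ih =>
    have key : ∀ b a, a.length ≤ m → ∀ (coin : ℕ → Bool) (ans : ℕ → List Bool),
        (∀ n, (ans n).length ≤ m) → P ((c.next b a).exec coin ans n) := by
      intro b a ha coin ans hans
      have := hP (shiftTape b coin) (shiftTape a ans) (by rintro (_ | n) <;> simp [shiftTape, *])
      rw [Config.exec_succ'] at this
      exact this
    have hsil : ∀ h : c.Silent, RunsTo m (fun c' b => c' = b ∧ P c') c
        ((c.next false []).tree n) := fun h => .silent h (ih _ (key _ _ (by simp)))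
    obtain ⟨todo, s, t⟩ := c
    match todo with
    | [] =>
      refine .ret ⟨rfl, ?_⟩
      have := hP (fun _ => false) (fun _ => []) (by simp)
      rwa [Config.exec_of_nil _ _ _ rfl] at this
    | .flip x :: K => exact .flip rfl fun b => ih _ (key _ _ (by simp))
    | .call i e x :: K => exact .call rfl fun a ha => ih _ (key _ _ ha)
    | .assign x e :: K => exact hsil trivial
    | .seq c d :: K => exact hsil trivial
    | .ite e c d :: K => exact hsil trivial
    | .loop e c :: K => exact hsil trivial

/-! ### Sizes -/

namespace Data

theorem one_le_size (d : Data) : 1 ≤ d.size := by cases d <;> simp [size]; omega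

theorem size_ofBool (b : Bool) : (ofBool b).size ≤ 3 := by cases b <;> simp [ofBool, size]

theorem toBool_ofBool (b : Bool) : (ofBool b).toBool = b := by cases b <;> rfl

theorem toList_ofList (l : List Data) : (ofList l).toList = l := by
  induction l with
  | nil => rfl
  | cons a l ih => simp [ofList, toList, ih]

theorem ofList_toList (d : Data) : ofList d.toList = d := by
  induction d with
  | nil => rfl
  | pair a b _ ih => simp [ofList, toList, ih]

theorem toBits_ofBits (l : List Bool) : (ofBits l).toBits = l := by
  simp [toBits, ofBits, toList_ofList, Function.comp_def, toBool_ofBool]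

theorem length_toList_lt (d : Data) : d.toList.length < d.size := by
  induction d with
  | nil => simp [toList, size]
  | pair a b _ ih => simp [toList, size]; omega

theorem size_ofBits_le (l : List Bool) : (ofBits l).size ≤ 4 * l.length + 1 := by
  induction l with
  | nil => simp [ofBits, ofList, size]
  | cons a l ih =>
    have := size_ofBool a
    simp only [ofBits, ofList, List.map_cons, size, List.length_cons] at ih ⊢
    omega

theorem size_ofBits_ge (l : List Bool) : 2 * l.length + 1 ≤ (ofBits l).size := by
  induction l with
  | nil => simp [ofBits, ofList, size]
  | cons a l ih =>
    have := one_le_size (ofBool a)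
    simp only [ofBits, ofList, List.map_cons, size, List.length_cons] at ih ⊢
    omega

theorem size_fst_le (d : Data) : d.fst.size ≤ d.size := by
  cases d <;> simp [fst, size]; omega

theorem size_snd_le (d : Data) : d.snd.size ≤ d.size := by
  cases d <;> simp [snd, size]

end Data

/-- The cost includes the size of the final value. Only `eq` charges `1` for a value of size up to
`3`; its operands, costing at least `1` each, make up the difference. -/
theorem Expr.size_eval_le (e : Expr) (s : Store) : (e.eval s).size ≤ e.cost s := by
  have pos : ∀ e : Expr, 1 ≤ e.cost s := by
    intro e
    induction e with
    | var x => exact Data.one_le_size _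
    | nil => exact le_rfl
    | pair e f _ _ => simp only [cost]; omega
    | fst e _ => simp only [cost]; omega
    | snd e _ => simp only [cost]; omega
    | eq e f _ _ => simp only [cost]; omega
  cases e with
  | var x => exact le_rfl
  | nil => exact le_rfl
  | pair e f => simp only [cost, eval]; omega
  | fst e => simp only [cost, eval]; omega
  | snd e => simp only [cost, eval]; omega
  | eq e f =>
    have := Data.size_ofBool (decide (e.eval s = f.eval s))
    have := pos e
    have := pos f
    simp only [cost, eval]; omega

/-- No register holds more than `Z` and the time used so far. -/
def Config.Bounded (Z : ℕ) (c : Config) : Prop := ∀ r, (c.store r).size ≤ Z + c.time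

/-- Every value written has been paid for in time, except the result of a coin toss, whose size of
at most `3` is covered by `hZ`. -/
theorem Config.Bounded.next {Z : ℕ} {c : Config} (hZ : 3 ≤ Z) (h : c.Bounded Z) (b : Bool)
    (a : List Bool) : (c.next b a).Bounded Z := by
  obtain ⟨todo, s, t⟩ := c
  intro r
  have hr := h r
  simp only at hr
  match todo with
  | [] => exact hr
  | .assign x e :: K =>
    have := e.size_eval_le s
    simp only [Config.next, Function.update_apply]
    split_ifs <;> omega
  | .seq c d :: K => simp only [Config.next]; omega
  | .ite e c d :: K => simp only [Config.next]; omega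
  | .loop e c :: K => simp only [Config.next]; omega
  | .flip x :: K =>
    have := Data.size_ofBool b
    simp only [Config.next, Function.update_apply]
    split_ifs <;> omega
  | .call i e x :: K =>
    simp only [Config.next, Function.update_apply]
    split_ifs <;> omega


/-! ## Silent executions -/

/-- Started in store `s`, the program `c` ends in store `s'` after time `n`, without coin tosses
and oracle calls. -/
def Exec (c : Prog) (s s' : Store) (n : ℕ) : Prop :=
  ∀ K t, Reach ⟨c :: K, s, t⟩ ⟨K, s', t + n⟩

namespace Exec

variable {c d : Prog} {e : Expr} {s s₁ s₂ : Store} {n₁ n₂ : ℕ}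

theorem assign (x : ℕ) (e : Expr) (s : Store) :
    Exec (.assign x e) s (Function.update s x (e.eval s)) (1 + e.cost s) :=
  fun _ _ => .single ⟨trivial, by simp [Config.next, Nat.add_assoc]⟩

theorem seq (h₁ : Exec c s s₁ n₁) (h₂ : Exec d s₁ s₂ n₂) :
    Exec (.seq c d) s s₂ (1 + n₁ + n₂) := by
  intro K t
  refine .head ⟨trivial, rfl⟩ ?_
  refine Relation.ReflTransGen.trans (h₁ (d :: K) (t + 1)) ?_
  have := h₂ K (t + 1 + n₁)
  rwa [show t + 1 + n₁ + n₂ = t + (1 + n₁ + n₂) by omega] at this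

theorem ite_true (he : e.eval s ≠ .nil) (h₁ : Exec c s s₁ n₁) :
    Exec (.ite e c d) s s₁ (1 + e.cost s + n₁) := by
  intro K t
  refine .head ⟨trivial, rfl⟩ ?_
  have := h₁ K (t + 1 + e.cost s)
  simp only [Config.next, he, if_false]
  rwa [show t + 1 + e.cost s + n₁ = t + (1 + e.cost s + n₁) by omega] at this

theorem ite_false (he : e.eval s = .nil) (h₁ : Exec d s s₁ n₁) :
    Exec (.ite e c d) s s₁ (1 + e.cost s + n₁) := by
  intro K t
  refine .head ⟨trivial, rfl⟩ ?_
  have := h₁ K (t + 1 + e.cost s)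
  simp only [Config.next, he, if_true]
  rwa [show t + 1 + e.cost s + n₁ = t + (1 + e.cost s + n₁) by omega] at this

theorem loop_false (he : e.eval s = .nil) : Exec (.loop e c) s s (1 + e.cost s) := by
  intro K t
  refine .single ⟨trivial, ?_⟩
  simp [Config.next, he, Nat.add_assoc]

theorem loop_true (he : e.eval s ≠ .nil) (h₁ : Exec c s s₁ n₁) (h₂ : Exec (.loop e c) s₁ s₂ n₂) :
    Exec (.loop e c) s s₂ (1 + e.cost s + n₁ + n₂) := by
  intro K t
  refine .head ⟨trivial, rfl⟩ ?_
  have h1 := h₁ (.loop e c :: K) (t + 1 + e.cost s)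
  simp only [Config.next, he, if_false]
  refine Relation.ReflTransGen.trans h1 ?_
  have := h₂ K (t + 1 + e.cost s + n₁)
  rwa [show t + 1 + e.cost s + n₁ + n₂ = t + (1 + e.cost s + n₁ + n₂) by omega] at this

end Exec

/-! ## Encodings -/

/-- A representation of the elements of a type by trees. -/
class Enc (α : Type) where
  enc : α → Data

open Enc (enc)

instance : Enc Data := ⟨id⟩
instance : Enc Bool := ⟨Data.ofBool⟩
instance : Enc Unit := ⟨fun _ => .nil⟩
instance {α β : Type} [Enc α] [Enc β] : Enc (α × β) := ⟨fun x => .pair (enc x.1) (enc x.2)⟩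
instance {α : Type} [Enc α] : Enc (List α) := ⟨fun l => .ofList (l.map enc)⟩
instance {α : Type} [Enc α] : Enc (Option α) :=
  ⟨fun | none => .nil | some a => .pair .nil (enc a)⟩
instance : Enc ℕ := ⟨fun n => .ofList (List.replicate n .nil)⟩
instance {α : Type} [Enc α] {p : α → Prop} : Enc {a // p a} := ⟨fun a => enc a.1⟩

/-- The size of the representation. -/
def esize {α : Type} [Enc α] (a : α) : ℕ := (enc a).size

section esize

variable {α β : Type} [Enc α] [Enc β]

theorem size_enc (a : α) : (enc a).size = esize a := rfl

theorem one_le_esize (a : α) : 1 ≤ esize a := Data.one_le_size _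

theorem esize_pair (a : α) (b : β) : esize (a, b) = 1 + esize a + esize b := rfl

theorem esize_nil : esize ([] : List α) = 1 := rfl

theorem esize_cons (a : α) (l : List α) : esize (a :: l) = 1 + esize a + esize l := rfl

theorem esize_none : esize (none : Option α) = 1 := rfl

theorem esize_some (a : α) : esize (some a) = 2 + esize a := by
  simp [esize, enc, Data.size]

theorem esize_bool_le (b : Bool) : esize b ≤ 3 := Data.size_ofBool b

theorem enc_succ (n : ℕ) : enc (n + 1) = .pair .nil (enc n) := rfl

theorem esize_nat (n : ℕ) : esize n = 2 * n + 1 := by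
  induction n with
  | zero => rfl
  | succ n ih => rw [esize, enc_succ, Data.size, ← esize, ih]; simp [Data.size]; omega

theorem esize_bits_le (l : List Bool) : esize l ≤ 4 * l.length + 1 := Data.size_ofBits_le l

theorem esize_bits_ge (l : List Bool) : 2 * l.length + 1 ≤ esize l := Data.size_ofBits_ge l

theorem length_lt_esize (l : List α) : l.length < esize l := by
  induction l with
  | nil => simp [esize_nil]
  | cons a l ih => rw [esize_cons, List.length_cons]; omega

theorem esize_append (l l' : List α) : esize (l ++ l') + 1 = esize l + esize l' := by
  induction l with
  | nil => simp [esize_nil]; omega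
  | cons a l ih => rw [List.cons_append, esize_cons, esize_cons]; omega

theorem esize_le_of_mem {a : α} {l : List α} (h : a ∈ l) : esize a ≤ esize l := by
  induction l with
  | nil => simp at h
  | cons b l ih =>
    rw [esize_cons]
    rcases List.mem_cons.1 h with rfl | h
    · omega
    · have := ih h; omega

end esize

/-! ## Functions computable in polynomial time -/

theorem polyEval_mono (P : Polynomial ℕ) {a b : ℕ} (h : a ≤ b) : P.eval a ≤ P.eval b := by
  rw [Polynomial.eval_eq_sum, Polynomial.eval_eq_sum, Polynomial.sum, Polynomial.sum]
  gcongr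

/-- `f` is computed in polynomial time by programs that can be run in the registers from any
number `b` on: input and output are in register `b`, the registers below `b` are not touched,
the other registers may initially hold anything. -/
def PT {α β : Type} [Enc α] [Enc β] (f : α → β) : Prop :=
  ∃ (c : ℕ → Prog) (P : Polynomial ℕ), (∀ b, (c b).Deterministic) ∧ ∀ a,
    esize (f a) ≤ P.eval (esize a) ∧ ∀ b s, s b = enc a → ∃ s' n, Exec (c b) s s' n ∧
      s' b = enc (f a) ∧ (∀ r < b, s' r = s r) ∧ n ≤ P.eval (esize a)

/-- An expression with a given constant value. -/
def Expr.quote : Data → Expr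
  | .nil => .nil
  | .pair a b => .pair (quote a) (quote b)

theorem Expr.eval_quote (d : Data) (s : Store) : (Expr.quote d).eval s = d := by
  induction d with
  | nil => rfl
  | pair a b iha ihb => simp [quote, eval, iha, ihb]

theorem Expr.cost_quote (d : Data) (s s' : Store) :
    (Expr.quote d).cost s = (Expr.quote d).cost s' := by
  induction d with
  | nil => rfl
  | pair a b iha ihb => simp [quote, cost, iha, ihb, eval_quote]

namespace PT

variable {α β γ δ : Type} [Enc α] [Enc β] [Enc γ] [Enc δ]

/-- A function computed by one assignment. -/
theorem of_assign {f : α → β} (e : ℕ → Expr) (P : Polynomial ℕ)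
    (he : ∀ b s a, s b = enc a → (e b).eval s = enc (f a) ∧ (e b).cost s ≤ P.eval (esize a)) :
    PT f := by
  refine ⟨fun b => .assign b (e b), P + 1, fun _ => trivial, fun a => ⟨?_, fun b s hs => ?_⟩⟩
  · obtain ⟨h1, h2⟩ := he 0 (fun _ => enc a) a rfl
    have h3 := (e 0).size_eval_le (fun _ => enc a)
    rw [h1, ← esize] at h3
    simp only [Polynomial.eval_add, Polynomial.eval_one]
    omega
  · obtain ⟨h1, h2⟩ := he b s a hs
    refine ⟨_, _, Exec.assign _ _ _, by simp [h1], fun r hr => by simp [hr.ne], ?_⟩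
    simp only [Polynomial.eval_add, Polynomial.eval_one]
    omega

theorem of_enc {f : α → β} (h : ∀ a, enc (f a) = enc a) : PT f :=
  of_assign (fun b => .var b) .X fun b s a hs => by
    simp [Expr.eval, Expr.cost, hs, h, esize]

protected theorem id : PT (fun a : α => a) := of_enc fun _ => rfl

theorem fst : PT (Prod.fst : α × β → α) :=
  of_assign (fun b => .fst (.var b)) (2 * .X) fun b s a hs => by
    have : ((enc a).fst).size ≤ (enc a).size := Data.size_fst_le _
    refine ⟨by simp [Expr.eval, hs]; rfl, ?_⟩
    simp only [Expr.cost, Expr.eval, hs, Polynomial.eval_mul, Polynomial.eval_X,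
      Polynomial.eval_ofNat, esize]
    omega

theorem snd : PT (Prod.snd : α × β → β) :=
  of_assign (fun b => .snd (.var b)) (2 * .X) fun b s a hs => by
    have : ((enc a).snd).size ≤ (enc a).size := Data.size_snd_le _
    refine ⟨by simp [Expr.eval, hs]; rfl, ?_⟩
    simp only [Expr.cost, Expr.eval, hs, Polynomial.eval_mul, Polynomial.eval_X,
      Polynomial.eval_ofNat, esize]
    omega

theorem const (y : β) : PT (fun _ : α => y) :=
  of_assign (fun _ => .quote (enc y)) (.C ((Expr.quote (enc y)).cost fun _ => .nil))
    fun b s a _ => by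
      refine ⟨Expr.eval_quote _ _, ?_⟩
      rw [Polynomial.eval_C, Expr.cost_quote]

theorem some : PT (Option.some : α → Option α) :=
  of_assign (fun b => .pair .nil (.var b)) (2 * .X + 3) fun b s a hs => by
    refine ⟨by simp [Expr.eval, hs]; rfl, ?_⟩
    simp only [Expr.cost, Expr.eval, hs, Polynomial.eval_mul, Polynomial.eval_X,
      Polynomial.eval_ofNat, Polynomial.eval_add, esize, Data.size]
    omega

theorem tail : PT (List.tail : List α → List α) :=
  of_assign (fun b => .snd (.var b)) (2 * .X) fun b s a hs => by
    have : ((enc a).snd).size ≤ (enc a).size := Data.size_snd_le _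
    refine ⟨by cases a <;> simp [Expr.eval, hs] <;> rfl, ?_⟩
    simp only [Expr.cost, Expr.eval, hs, Polynomial.eval_mul, Polynomial.eval_X,
      Polynomial.eval_ofNat, esize]
    omega

theorem succ : PT Nat.succ :=
  of_assign (fun b => .pair .nil (.var b)) (2 * .X + 3) fun b s a hs => by
    refine ⟨by simp [Expr.eval, hs]; rfl, ?_⟩
    simp only [Expr.cost, Expr.eval, hs, Polynomial.eval_mul, Polynomial.eval_X,
      Polynomial.eval_ofNat, Polynomial.eval_add, esize, Data.size]
    omega

theorem decide_eq [DecidableEq α] (h : Function.Injective (enc : α → Data)) :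
    PT (fun x : α × α => decide (x.1 = x.2)) :=
  of_assign (fun b => .eq (.fst (.var b)) (.snd (.var b))) (4 * .X + 1) fun b s a hs => by
    have h1 : ((enc a).fst).size ≤ (enc a).size := Data.size_fst_le _
    have h2 : ((enc a).snd).size ≤ (enc a).size := Data.size_snd_le _
    constructor
    · simp only [Expr.eval, hs]
      change Data.ofBool (decide (enc a.1 = enc a.2)) = Data.ofBool _
      simp only [h.eq_iff]
    · simp only [Expr.cost, Expr.eval, hs, Polynomial.eval_mul, Polynomial.eval_X,
        Polynomial.eval_ofNat, Polynomial.eval_add, Polynomial.eval_one, esize]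
      omega

theorem comp {g : β → γ} {f : α → β} (hg : PT g) (hf : PT f) : PT (fun a => g (f a)) := by
  obtain ⟨cf, P, df, hf⟩ := hf
  obtain ⟨cg, Q, dg, hg⟩ := hg
  refine ⟨fun b => .seq (cf b) (cg b), 1 + P + Q.comp P, fun b => ⟨df b, dg b⟩, fun a => ?_⟩
  obtain ⟨f1, f2⟩ := hf a
  obtain ⟨g1, g2⟩ := hg (f a)
  have hQ := polyEval_mono Q f1
  simp only [Polynomial.eval_add, Polynomial.eval_one, Polynomial.eval_comp]
  refine ⟨by omega, fun b s hs => ?_⟩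
  obtain ⟨s1, n1, e1, v1, r1, t1⟩ := f2 b s hs
  obtain ⟨s2, n2, e2, v2, r2, t2⟩ := g2 b s1 v1
  exact ⟨s2, _, e1.seq e2, v2, fun r hr => by rw [r2 r hr, r1 r hr], by omega⟩

theorem pair {f : α → β} {g : α → γ} (hf : PT f) (hg : PT g) : PT (fun a => (f a, g a)) := by
  obtain ⟨cf, P, df, hf⟩ := hf
  obtain ⟨cg, Q, dg, hg⟩ := hg
  -- A program leaves the registers below its own untouched. So the input in `b` survives the first
  -- computation, and the first result in `b + 1` survives the second.
  refine ⟨fun b => .seq (.assign (b + 1) (.var b)) (.seq (cf (b + 1))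
      (.seq (.assign (b + 2) (.var b)) (.seq (cg (b + 2))
        (.assign b (.pair (.var (b + 1)) (.var (b + 2))))))),
    3 * P + 3 * Q + 2 * .X + 20, fun b => ⟨trivial, df _, trivial, dg _, trivial⟩, fun a => ?_⟩
  obtain ⟨f1, f2⟩ := hf a
  obtain ⟨g1, g2⟩ := hg a
  simp only [Polynomial.eval_add, Polynomial.eval_mul, Polynomial.eval_X, Polynomial.eval_ofNat]
  refine ⟨by rw [esize_pair]; omega, fun b s hs => ?_⟩
  obtain ⟨s1, n1, e1, v1, r1, t1⟩ :=
    f2 (b + 1) (Function.update s (b + 1) ((Expr.var b).eval s)) (by simp [Expr.eval, hs])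
  have hs1 : s1 b = enc a := by rw [r1 b (by omega), Function.update_of_ne (by omega), hs]
  obtain ⟨s2, n2, e2, v2, r2, t2⟩ :=
    g2 (b + 2) (Function.update s1 (b + 2) ((Expr.var b).eval s1)) (by simp [Expr.eval, hs1])
  have hs2 : s2 (b + 1) = enc (f a) := by
    rw [r2 _ (by omega), Function.update_of_ne (by omega), v1]
  refine ⟨_, _, .seq (.assign _ _ _) (.seq e1 (.seq (.assign _ _ _) (.seq e2 (.assign _ _ _)))),
    ?_, fun r hr => ?_, ?_⟩
  · simp [Expr.eval, v2, hs2]; rfl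
  · rw [Function.update_of_ne hr.ne, r2 _ (by omega), Function.update_of_ne (by omega),
      r1 _ (by omega), Function.update_of_ne (by omega)]
  · simp only [Expr.cost, Expr.eval, hs, hs1, hs2, v2, Data.size, size_enc] at *
    omega

/-- Case distinction on an optional value. -/
theorem option_elim {f : α → Option β} {g : α → γ} {h : α × β → γ} (hf : PT f) (hg : PT g)
    (hh : PT h) : PT (fun a => match f a with | none => g a | Option.some y => h (a, y)) := by
  obtain ⟨cf, P, df, hf⟩ := hf
  obtain ⟨cg, Q, dg, hg⟩ := hg
  obtain ⟨ch, R, dh, hh⟩ := hh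
  refine ⟨fun b => .seq (.assign (b + 1) (.var b)) (.seq (cf (b + 1))
      (.ite (.var (b + 1))
        (.seq (.assign b (.pair (.var b) (.snd (.var (b + 1))))) (ch b)) (cg b))),
    5 * P + Q + R.comp (1 + .X + P) + 5 * .X + 20,
    fun b => ⟨trivial, df _, ⟨trivial, dh _⟩, dg _⟩, fun a => ?_⟩
  obtain ⟨f1, f2⟩ := hf a
  obtain ⟨g1, g2⟩ := hg a
  simp only [Polynomial.eval_add, Polynomial.eval_mul, Polynomial.eval_X, Polynomial.eval_ofNat,
    Polynomial.eval_comp, Polynomial.eval_one]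
  cases hfa : f a with
  | none =>
    refine ⟨by simp only; omega, fun b s hs => ?_⟩
    obtain ⟨s1, n1, e1, v1, r1, t1⟩ :=
      f2 (b + 1) (Function.update s (b + 1) ((Expr.var b).eval s)) (by simp [Expr.eval, hs])
    have hs1 : s1 b = enc a := by rw [r1 b (by omega), Function.update_of_ne (by omega), hs]
    obtain ⟨s2, n2, e2, v2, r2, t2⟩ := g2 b s1 hs1
    refine ⟨_, _, .seq (.assign _ _ _) (.seq e1 (.ite_false ?_ e2)), v2, fun r hr => ?_, ?_⟩
    · rw [Expr.eval, v1, hfa]; rfl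
    · rw [r2 _ hr, r1 _ (by omega), Function.update_of_ne (by omega)]
    · simp only [Expr.cost, hs, v1, size_enc] at *
      omega
  | some y =>
    obtain ⟨h1, h2⟩ := hh (a, y)
    rw [hfa, esize_some] at f1
    have hR := polyEval_mono R (a := esize (a, y)) (b := 1 + esize a + P.eval (esize a))
      (by rw [esize_pair]; omega)
    refine ⟨by simp only; omega, fun b s hs => ?_⟩
    obtain ⟨s1, n1, e1, v1, r1, t1⟩ :=
      f2 (b + 1) (Function.update s (b + 1) ((Expr.var b).eval s)) (by simp [Expr.eval, hs])
    have hs1 : s1 b = enc a := by rw [r1 b (by omega), Function.update_of_ne (by omega), hs]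
    have v1' : s1 (b + 1) = .pair .nil (enc y) := by rw [v1, hfa]; rfl
    obtain ⟨s2, n2, e2, v2, r2, t2⟩ := h2 b (Function.update s1 b
      ((Expr.pair (.var b) (.snd (.var (b + 1)))).eval s1)) (by
        simp [Expr.eval, hs1, v1']; rfl)
    refine ⟨_, _, .seq (.assign _ _ _) (.seq e1 (.ite_true ?_ (.seq (.assign _ _ _) e2))), v2,
      fun r hr => ?_, ?_⟩
    · rw [Expr.eval, v1']; simp
    · rw [r2 _ hr, Function.update_of_ne hr.ne, r1 _ (by omega), Function.update_of_ne (by omega)]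
    · simp only [Expr.cost, Expr.eval, hs, hs1, v1', Data.snd, Data.size, size_enc] at *
      omega

theorem ite {p : α → Bool} {f g : α → β} (hp : PT p) (hf : PT f) (hg : PT g) :
    PT (fun a => if p a = true then f a else g a) := by
  have h : PT (fun a => if p a = true then Option.some () else none) := by
    obtain ⟨c, P, d, h⟩ := hp
    refine ⟨c, P, d, fun a => ?_⟩
    -- Booleans and elements of `Option Unit` have the same encodings, so the program for `p`
    -- already computes an option.
    have : enc (if p a = true then Option.some () else none) = enc (p a) := by
      cases p a <;> rfl
    simp only [esize, this]
    exact h a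
  convert h.option_elim hg (hf.comp fst) using 2 with a
  cases p a <;> rfl

theorem head? : PT (List.head? : List α → Option α) := by
  refine ⟨fun b => .ite (.var b) (.assign b (.pair .nil (.fst (.var b)))) (.assign b .nil),
    5 * .X + 20, fun b => ⟨trivial, trivial⟩, fun a => ?_⟩
  simp only [Polynomial.eval_add, Polynomial.eval_mul, Polynomial.eval_X, Polynomial.eval_ofNat]
  cases a with
  | nil =>
    refine ⟨by rw [List.head?_nil, esize_none]; omega, fun b s hs => ?_⟩
    refine ⟨_, _, .ite_false (by rw [Expr.eval, hs]; rfl) (.assign _ _ _),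
      by simp [Expr.eval]; rfl, fun r hr => by simp [hr.ne], ?_⟩
    simp only [Expr.cost, hs, esize]
    omega
  | cons x l =>
    refine ⟨by rw [List.head?_cons, esize_some, esize_cons]; omega, fun b s hs => ?_⟩
    have hs' : s b = .pair (enc x) (enc l) := hs
    refine ⟨_, _, .ite_true (by simp [Expr.eval, hs']) (.assign _ _ _),
      by simp [Expr.eval, hs']; rfl, fun r hr => by simp [hr.ne], ?_⟩
    rw [esize_cons]
    simp only [Expr.cost, Expr.eval, hs', Data.fst, Data.size, size_enc]
    omega

/-- Folding over a list, provided that the intermediate values have polynomial size. -/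
theorem foldl {f : γ → List α} {i : γ → β} {g : γ × β × α → β} (hf : PT f) (hi : PT i)
    (hg : PT g) (B : Polynomial ℕ)
    (hB : ∀ x l, l <+: f x → esize (l.foldl (fun b a => g (x, b, a)) (i x)) ≤ B.eval (esize x)) :
    PT (fun x => (f x).foldl (fun b a => g (x, b, a)) (i x)) := by
  obtain ⟨cf, F, df, hf⟩ := hf
  obtain ⟨ci, I, di, hi⟩ := hi
  obtain ⟨cg, G, dg, hg⟩ := hg
  let body : ℕ → Prog := fun b =>
    .seq (.assign (b + 3) (.pair (.var b) (.pair (.var (b + 2)) (.fst (.var (b + 1))))))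
      (.seq (cg (b + 3)) (.seq (.assign (b + 2) (.var (b + 3)))
        (.assign (b + 1) (.snd (.var (b + 1))))))
  -- the cost of one round
  let C : Polynomial ℕ := 20 * .X + 20 * B + 20 * F + G.comp (2 + .X + B + F) + 40
  -- Loop invariant: `l₁` has been consumed, `b + 1` holds the remaining list, `b + 2` the value of
  -- the fold over `l₁`, and `b` the parameter. One round takes time at most `C`, as `hB` bounds the
  -- accumulator.
  have loop : ∀ (b : ℕ) (x : γ) (l₂ l₁ : List α) (s : Store), f x = l₁ ++ l₂ → s b = enc x →
      s (b + 1) = enc l₂ → s (b + 2) = enc (l₁.foldl (fun b a => g (x, b, a)) (i x)) →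
      ∃ s' n, Exec (.loop (.var (b + 1)) (body b)) s s' n ∧
        s' (b + 2) = enc ((f x).foldl (fun b a => g (x, b, a)) (i x)) ∧
        (∀ r < b, s' r = s r) ∧ n ≤ (l₂.length + 1) * C.eval (esize x) := by
    intro b x l₂
    induction l₂ with
    | nil =>
      intro l₁ s h0 h1 h2 h3
      refine ⟨s, _, .loop_false (by rw [Expr.eval, h2]; rfl), ?_, fun _ _ => rfl, ?_⟩
      · rw [h3, h0, List.append_nil]
      · simp only [Expr.cost, h2, enc, List.map_nil, Data.ofList, Data.size, List.length_nil, C,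
          Polynomial.eval_add, Polynomial.eval_ofNat]
        omega
    | cons y l₂ ih =>
      intro l₁ s h0 h1 h2 h3
      have h2' : s (b + 1) = .pair (enc y) (enc l₂) := h2
      set acc := l₁.foldl (fun b a => g (x, b, a)) (i x) with hacc
      obtain ⟨g1, g2⟩ := hg (x, acc, y)
      obtain ⟨s1, n1, e1, v1, r1, t1⟩ := g2 (b + 3) (Function.update s (b + 3)
        ((Expr.pair (.var b) (.pair (.var (b + 2)) (.fst (.var (b + 1))))).eval s)) (by
          simp [Expr.eval, h1, h2', h3, Data.fst, hacc]; rfl)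
      have hy : ∀ r < b + 3, s1 r = s r := fun r hr => by
        rw [r1 r hr, Function.update_of_ne hr.ne]
      obtain ⟨s2, n2, e2, v2, r2, t2⟩ := ih (l₁ ++ [y])
        (Function.update (Function.update s1 (b + 2) ((Expr.var (b + 3)).eval s1)) (b + 1)
          ((Expr.snd (.var (b + 1))).eval
            (Function.update s1 (b + 2) ((Expr.var (b + 3)).eval s1))))
        (by rw [h0, List.append_assoc]; rfl)
        (by simp [hy, h1])
        (by simp [Expr.eval, hy, h2', Data.snd])
        (by simp [Expr.eval, v1, hacc])
      refine ⟨s2, _, .loop_true (by simp [Expr.eval, h2'])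
        (.seq (.assign _ _ _) (.seq e1 (.seq (.assign _ _ _) (.assign _ _ _)))) e2, v2,
        fun r hr => ?_, ?_⟩
      · rw [r2 r hr, Function.update_of_ne (by omega), Function.update_of_ne (by omega),
          hy r (by omega)]
      · have b1 := hB x l₁ ⟨y :: l₂, h0.symm⟩
        have b2 := hB x (l₁ ++ [y]) ⟨l₂, by rw [h0, List.append_assoc]; rfl⟩
        rw [List.foldl_append, List.foldl_cons, List.foldl_nil, ← hacc] at b2
        rw [← hacc] at b1
        have b3 : esize y + esize l₂ ≤ F.eval (esize x) := by
          have h5 := esize_append l₁ (y :: l₂)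
          rw [← h0, esize_cons] at h5
          have := (hf x).1
          have := one_le_esize l₁
          omega
        have b4 := polyEval_mono G (a := esize (x, acc, y))
          (b := 2 + esize x + B.eval (esize x) + F.eval (esize x)) (by
            rw [esize_pair, esize_pair]; omega)
        have b5 := one_le_esize l₂
        have hC : C.eval (esize x) = 20 * esize x + 20 * B.eval (esize x) + 20 * F.eval (esize x)
            + G.eval (2 + esize x + B.eval (esize x) + F.eval (esize x)) + 40 := by
          simp [C, Polynomial.eval_comp]
        simp only [Expr.cost, Expr.eval, h1, h2', h3, hy, v1, Data.fst, Data.snd, Data.size,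
          size_enc, List.length_cons, ne_eq,
          Nat.add_left_cancel_iff, not_false_eq_true, Function.update_of_ne,
          Nat.add_lt_add_iff_left, show ((1:ℕ) = 2) = False by simp, show (1:ℕ) < 3 by omega]
          at t1 t2 ⊢
        have hmul : (l₂.length + 1 + 1) * C.eval (esize x)
            = (l₂.length + 1) * C.eval (esize x) + C.eval (esize x) := by ring
        rw [hmul]
        omega
  refine ⟨fun b => .seq (.assign (b + 1) (.var b)) (.seq (cf (b + 1))
      (.seq (.assign (b + 2) (.var b)) (.seq (ci (b + 2))
        (.seq (.loop (.var (b + 1)) (body b)) (.assign b (.var (b + 2))))))),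
    B + F + I + 2 * .X + 20 + F * C + B, fun b => ?_, fun x => ?_⟩
  · exact ⟨trivial, df _, trivial, di _, ⟨trivial, dg _, trivial, trivial⟩, trivial⟩
  obtain ⟨f1, f2⟩ := hf x
  obtain ⟨i1, i2⟩ := hi x
  have b1 := hB x (f x) List.prefix_rfl
  simp only [Polynomial.eval_add, Polynomial.eval_mul, Polynomial.eval_X, Polynomial.eval_ofNat]
  refine ⟨by omega, fun b s hs => ?_⟩
  obtain ⟨s1, n1, e1, v1, r1, t1⟩ :=
    f2 (b + 1) (Function.update s (b + 1) ((Expr.var b).eval s)) (by simp [Expr.eval, hs])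
  have hs1 : s1 b = enc x := by rw [r1 b (by omega), Function.update_of_ne (by omega), hs]
  obtain ⟨s2, n2, e2, v2, r2, t2⟩ :=
    i2 (b + 2) (Function.update s1 (b + 2) ((Expr.var b).eval s1)) (by simp [Expr.eval, hs1])
  obtain ⟨s3, n3, e3, v3, r3, t3⟩ := loop b x (f x) [] s2 rfl
    (by rw [r2 _ (by omega), Function.update_of_ne (by omega), hs1])
    (by rw [r2 _ (by omega), Function.update_of_ne (by omega), v1]) v2
  refine ⟨_, _, .seq (.assign _ _ _) (.seq e1 (.seq (.assign _ _ _) (.seq e2 (.seq e3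
    (.assign _ _ _))))), ?_, fun r hr => ?_, ?_⟩
  · simp [Expr.eval, v3]
  · rw [Function.update_of_ne hr.ne, r3 r hr, r2 _ (by omega), Function.update_of_ne (by omega),
      r1 _ (by omega), Function.update_of_ne (by omega)]
  -- The size of a list exceeds its length, which pays for the last, failing test of the loop.
  · have h4 : ((f x).length + 1) * C.eval (esize x) ≤ F.eval (esize x) * C.eval (esize x) := by
      gcongr
      exact (length_lt_esize _).trans_le f1
    simp only [Expr.cost, hs, hs1, v3, size_enc] at *
    omega

/-- Folding over a list, provided that every step adds only polynomially many nodes. -/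
theorem foldl_of_add {f : γ → List α} {i : γ → β} {g : γ × β × α → β} (hf : PT f) (hi : PT i)
    (hg : PT g) (B : Polynomial ℕ)
    (hB : ∀ x b a, a ∈ f x → esize (g (x, b, a)) ≤ esize b + B.eval (esize x)) :
    PT (fun x => (f x).foldl (fun b a => g (x, b, a)) (i x)) := by
  obtain ⟨_, F, _, hF⟩ := id hf
  obtain ⟨_, I, _, hI⟩ := id hi
  refine foldl hf hi hg (I + F * B) fun x l hl => ?_
  have h1 : ∀ (l : List α) (b : β), (∀ a ∈ l, a ∈ f x) →
      esize (l.foldl (fun b a => g (x, b, a)) b) ≤ esize b + l.length * B.eval (esize x) := by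
    intro l
    induction l with
    | nil => simp
    | cons a l ih =>
      intro b h
      have h1 := ih (g (x, b, a)) fun a ha => h a (by simp [ha])
      have h2 := hB x b a (h a (by simp))
      simp only [List.foldl_cons, List.length_cons, add_mul, one_mul]
      omega
  have h2 : l.length * B.eval (esize x) ≤ F.eval (esize x) * B.eval (esize x) := by
    gcongr
    exact (hl.length_le.trans (length_lt_esize _).le).trans (hF x).1
  have h3 := h1 l (i x) fun a ha => hl.subset ha
  have h4 := (hI x).1
  simp only [Polynomial.eval_add, Polynomial.eval_mul]
  omega

end PT


/-! ## Encodings are injective -/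

theorem enc_injective_bool : Function.Injective (enc : Bool → Data) := by
  intro a b h
  cases a <;> cases b <;> first | rfl | cases h

theorem enc_injective_list {α : Type} [Enc α] (h : Function.Injective (enc : α → Data)) :
    Function.Injective (enc : List α → Data) := by
  intro a b hab
  have : (a.map enc) = b.map enc := by
    rw [← Data.toList_ofList (a.map enc), ← Data.toList_ofList (b.map enc)]
    exact congrArg _ hab
  exact List.map_injective_iff.2 h this

theorem enc_injective_nat : Function.Injective (enc : ℕ → Data) := by
  intro a b hab
  have := congrArg (List.length ∘ Data.toList) hab
  simpa [enc, Data.toList_ofList] using this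

theorem enc_injective_prod {α β : Type} [Enc α] [Enc β]
    (h : Function.Injective (enc : α → Data)) (h' : Function.Injective (enc : β → Data)) :
    Function.Injective (enc : α × β → Data) := by
  rintro ⟨a, b⟩ ⟨a', b'⟩ hab
  simp only [enc, Data.pair.injEq] at hab
  rw [h hab.1, h' hab.2]

theorem enc_injective_option {α : Type} [Enc α]
    (h : Function.Injective (enc : α → Data)) : Function.Injective (enc : Option α → Data) := by
  rintro (_ | a) (_ | b) hab
  · rfl
  · cases hab
  · cases hab
  · simp only [enc, Data.pair.injEq, true_and] at hab
    rw [h hab]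

theorem enc_injective_bits : Function.Injective (enc : List Bool → Data) :=
  enc_injective_list enc_injective_bool

/-! ### Polynomial-time operations on Booleans and lists -/

namespace PT

variable {α β γ δ : Type} [Enc α] [Enc β] [Enc γ] [Enc δ]

theorem congr {f g : α → β} (hf : PT f) (h : ∀ a, f a = g a) : PT g := by
  rwa [← funext h]

theorem comp₂ {h : α × β → γ} {f : δ → α} {g : δ → β} (hh : PT h) (hf : PT f) (hg : PT g) :
    PT (fun x => h (f x, g x)) :=
  hh.comp (hf.pair hg)

theorem eq [DecidableEq β] (hi : Function.Injective (enc : β → Data)) {f g : α → β}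
    (hf : PT f) (hg : PT g) : PT (fun x => decide (f x = g x)) :=
  (decide_eq hi).comp₂ hf hg

theorem and {f g : α → Bool} (hf : PT f) (hg : PT g) : PT (fun x => f x && g x) :=
  (hf.ite hg (const false)).congr fun x => by cases f x <;> simp

theorem not {f : α → Bool} (hf : PT f) : PT (fun x => !f x) :=
  (hf.ite (const false) (const true)).congr fun x => by cases f x <;> simp

theorem or {f g : α → Bool} (hf : PT f) (hg : PT g) : PT (fun x => f x || g x) :=
  (hf.ite (const true) hg).congr fun x => by cases f x <;> simp

theorem isSome : PT (Option.isSome : Option α → Bool) :=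
  (option_elim PT.id (const false) (const true)).congr fun x => by cases x <;> rfl

theorem getD {f : α → Option β} {g : α → β} (hf : PT f) (hg : PT g) :
    PT (fun x => (f x).getD (g x)) :=
  (option_elim hf hg snd).congr fun x => by cases f x <;> rfl

theorem cons {f : α → β} {g : α → List β} (hf : PT f) (hg : PT g) : PT (fun x => f x :: g x) :=
  (of_enc (f := fun x : β × List β => x.1 :: x.2) fun _ => rfl).comp₂ hf hg

theorem reverse : PT (List.reverse : List α → List α) := by
  refine (foldl_of_add (f := fun l : List α => l) (i := fun _ => ([] : List α))
    (g := fun y => y.2.2 :: y.2.1) PT.id (const _)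
    (cons (snd.comp snd) (fst.comp snd)) (.X + 1) ?_).congr fun l => ?_
  · intro x b a ha
    have := esize_le_of_mem ha
    simp only [esize_cons, Polynomial.eval_add, Polynomial.eval_X, Polynomial.eval_one]
    omega
  · simp

theorem append' : PT (fun x : List α × List α => x.1 ++ x.2) := by
  refine (foldl_of_add (f := fun x : List α × List α => x.1.reverse) (i := fun x => x.2)
    (g := fun y => y.2.2 :: y.2.1) (reverse.comp fst) snd
    (cons (snd.comp snd) (fst.comp snd)) (.X + 1) ?_).congr fun l => ?_
  · intro x b a ha
    have := esize_le_of_mem (List.mem_reverse.1 ha)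
    have : esize x = 1 + esize x.1 + esize x.2 := rfl
    simp only [esize_cons, Polynomial.eval_add, Polynomial.eval_X, Polynomial.eval_one]
    omega
  · simp

theorem append {f g : γ → List α} (hf : PT f) (hg : PT g) : PT (fun x => f x ++ g x) :=
  append'.comp₂ hf hg

theorem esize_le {f : α → β} (hf : PT f) : ∃ P : Polynomial ℕ, ∀ a, esize (f a) ≤ P.eval (esize a) :=
  let ⟨_, P, _, h⟩ := hf
  ⟨P, fun a => (h a).1⟩

/-- The size of `g (x, a)` for an element `a` of the list `f x`. -/
theorem esize_le_of_mem {f : γ → List α} {g : γ × α → β} (hf : PT f) (hg : PT g) :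
    ∃ P : Polynomial ℕ, ∀ x, ∀ a ∈ f x, esize (g (x, a)) ≤ P.eval (esize x) := by
  obtain ⟨P, hP⟩ := hf.esize_le
  obtain ⟨Q, hQ⟩ := hg.esize_le
  refine ⟨Q.comp (1 + .X + P), fun x a ha => (hQ _).trans ?_⟩
  rw [Polynomial.eval_comp]
  refine polyEval_mono _ ?_
  have := RAF.esize_le_of_mem ha
  have := hP x
  simp only [esize_pair, Polynomial.eval_add, Polynomial.eval_X, Polynomial.eval_one]
  omega

theorem map {f : γ → List α} {g : γ × α → β} (hf : PT f) (hg : PT g) :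
    PT (fun x => (f x).map fun a => g (x, a)) := by
  obtain ⟨P, hP⟩ := hf.esize_le_of_mem hg
  refine (reverse.comp (foldl_of_add (f := f) (i := fun _ => ([] : List β))
    (g := fun y => g (y.1, y.2.2) :: y.2.1) hf (const _)
    (cons (hg.comp₂ fst (snd.comp snd)) (fst.comp snd)) (P + 1) ?_)).congr fun x => ?_
  · intro x b a ha
    have := hP x a ha
    simp only [esize_cons, Polynomial.eval_add, Polynomial.eval_one]
    omega
  · simp

theorem flatMap {f : γ → List α} {g : γ × α → List β} (hf : PT f) (hg : PT g) :
    PT (fun x => (f x).flatMap fun a => g (x, a)) := by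
  obtain ⟨P, hP⟩ := hf.esize_le_of_mem hg
  refine (foldl_of_add (f := f) (i := fun _ => ([] : List β))
    (g := fun y => y.2.1 ++ g (y.1, y.2.2)) hf (const _)
    (append (fst.comp snd) (hg.comp₂ fst (snd.comp snd))) P ?_).congr fun x => ?_
  · intro x b a ha
    have := hP x a ha
    have := esize_append b (g (x, a))
    dsimp only
    omega
  · have : ∀ (l : List α) (b : List β),
        l.foldl (fun b a => b ++ g (x, a)) b = b ++ l.flatMap fun a => g (x, a) := by
      intro l
      induction l with
      | nil => simp
      | cons a l ih => intro b; simp [ih, List.flatMap_cons]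
    simpa using this (f x) []

theorem length : PT (List.length : List α → ℕ) := by
  refine (foldl_of_add (f := fun l : List α => l) (i := fun _ => 0)
    (g := fun y => y.2.1 + 1) PT.id (const _)
    (succ.comp (fst.comp snd)) 2 ?_).congr fun x => ?_
  · intro x b a ha
    simp only [esize_nat, Polynomial.eval_ofNat]
    omega
  · simp

theorem units : PT (fun n : ℕ => List.replicate n ()) :=
  of_enc fun n => by simp [enc]

theorem esize_tail_le (l : List α) : esize l.tail ≤ esize l := by
  cases l with
  | nil => exact le_rfl
  | cons a l => rw [List.tail_cons, esize_cons]; omega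

theorem drop {f : γ → ℕ} {g : γ → List α} (hf : PT f) (hg : PT g) :
    PT (fun x => (g x).drop (f x)) := by
  refine (foldl_of_add (f := fun x => List.replicate (f x) ()) (i := g)
    (g := fun y => y.2.1.tail) (units.comp hf) hg (tail.comp (fst.comp snd)) 0 ?_).congr
    fun x => ?_
  · intro x b a ha
    have := esize_tail_le b
    simpa using this
  · have : ∀ (n : ℕ) (l : List α),
        (List.replicate n ()).foldl (fun b _ => b.tail) l = l.drop n := by
      intro n
      induction n with
      | zero => simp
      | succ n ih => intro l; simp [List.replicate_succ, ih]
    exact this _ _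

theorem take {f : γ → ℕ} {g : γ → List α} (hf : PT f) (hg : PT g) :
    PT (fun x => (g x).take (f x)) := by
  -- The state consists of the reversed prefix and the remaining list. Moving an element from one to
  -- the other preserves the total size, so the growth bound is zero.
  let step : List α × List α → List α × List α := fun y =>
    match y.2.head? with | none => y | Option.some a => (a :: y.1, y.2.tail)
  have hstep : PT step :=
    option_elim (head?.comp snd) PT.id
      ((cons snd (fst.comp fst)).pair (tail.comp (snd.comp fst)))
  refine (reverse.comp (fst.comp (foldl_of_add (f := fun x => List.replicate (f x) ())
    (i := fun x => (([] : List α), g x)) (g := fun y => step y.2.1) (units.comp hf)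
    ((const _).pair hg) (hstep.comp (fst.comp snd)) 0 ?_))).congr fun x => ?_
  · rintro x ⟨b, _ | ⟨c, l⟩⟩ a ha
    · simp [step]
    · simp only [step, List.head?_cons, List.tail_cons, esize_pair, esize_cons]
      omega
  · have : ∀ (n : ℕ) (l acc : List α),
        ((List.replicate n ()).foldl (fun b _ => step b) (acc, l)).1.reverse
          = acc.reverse ++ l.take n := by
      intro n
      induction n with
      | zero => simp
      | succ n ih =>
        rintro (_ | ⟨a, l⟩) acc
        · simp only [List.replicate_succ, List.foldl_cons]
          exact (ih [] acc).trans (by simp)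
        · simp only [List.replicate_succ, List.foldl_cons]
          exact (ih l (a :: acc)).trans (by simp)
    simpa using this (f x) (g x) []

theorem replicate {f : γ → ℕ} {g : γ → α} (hf : PT f) (hg : PT g) :
    PT (fun x => List.replicate (f x) (g x)) :=
  (map (f := fun x => List.replicate (f x) ()) (g := fun y => g y.1) (units.comp hf)
    (hg.comp fst)).congr fun x => by simp

end PT

/-- The value of a key in an association list. -/
def look {α β : Type} [DecidableEq α] (a : α) : List (α × β) → Option β
  | [] => none
  | y :: l => if y.1 = a then some y.2 else look a l

theorem look_eq_some_mem {α β : Type} [DecidableEq α] {a : α} {b : β} {l : List (α × β)}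
    (h : look a l = some b) : (a, b) ∈ l := by
  induction l with
  | nil => simp [look] at h
  | cons y l ih =>
    rw [look] at h
    split_ifs at h with h1
    · cases h; subst h1; simp
    · exact List.mem_cons_of_mem _ (ih h)

theorem look_eq_none {α β : Type} [DecidableEq α] {a : α} {l : List (α × β)} :
    look a l = none ↔ ∀ y ∈ l, y.1 ≠ a := by
  induction l with
  | nil => simp [look]
  | cons y l ih =>
    rw [look]
    split_ifs with h1 <;> simp [h1, ih]

namespace PT

variable {α β γ δ : Type} [Enc α] [Enc β] [Enc γ] [Enc δ]

theorem look [DecidableEq α] (hi : Function.Injective (enc : α → Data)) {f : γ → α}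
    {g : γ → List (α × β)} (hf : PT f) (hg : PT g) : PT (fun x => look (f x) (g x)) := by
  obtain ⟨P, hP⟩ := hg.esize_le
  -- The list is read backwards and later matches overwrite earlier ones, so the first matching
  -- entry prevails.
  refine (foldl_of_add (f := fun x => (g x).reverse) (i := fun _ => (none : Option β))
    (g := fun y : γ × Option β × (α × β) =>
      if decide (y.2.2.1 = f y.1) = true then Option.some y.2.2.2 else y.2.1)
    (reverse.comp hg) (const _)
    (ite (eq hi (fst.comp (snd.comp snd)) (hf.comp fst))
      (PT.some.comp (snd.comp (snd.comp snd))) (fst.comp snd)) (P + 2) ?_).congr fun x => ?_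
  · intro x b a ha
    have h1 := RAF.esize_le_of_mem (List.mem_reverse.1 ha)
    have h2 : esize a = 1 + esize a.1 + esize a.2 := rfl
    have := hP x
    simp only [Polynomial.eval_add, Polynomial.eval_ofNat]
    split_ifs
    · rw [esize_some]; omega
    · omega
  · rw [List.foldl_reverse]
    generalize g x = l
    induction l with
    | nil => rfl
    | cons a l ih => rw [List.foldr_cons, ih]; simp [RAF.look]

/-! ## Bit strings and messages -/

theorem toList : PT Data.toList :=
  of_enc fun d => by
    change Data.ofList (d.toList.map id) = d
    rw [List.map_id, Data.ofList_toList]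

theorem toBool : PT Data.toBool :=
  (isSome.comp (head?.comp toList)).congr fun d => by cases d <;> rfl

theorem toBits : PT Data.toBits :=
  map (f := Data.toList) (g := fun y : Data × Data => y.2.toBool) toList (toBool.comp snd)

theorem dataFst : PT Data.fst :=
  of_assign (fun b => .fst (.var b)) (2 * .X) fun b s a hs => by
    have : ((enc a).fst).size ≤ (enc a).size := Data.size_fst_le _
    refine ⟨by simp [Expr.eval, hs]; rfl, ?_⟩
    simp only [Expr.cost, Expr.eval, hs, Polynomial.eval_mul, Polynomial.eval_X,
      Polynomial.eval_ofNat, esize]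
    omega

theorem dataSnd : PT Data.snd :=
  of_assign (fun b => .snd (.var b)) (2 * .X) fun b s a hs => by
    have : ((enc a).snd).size ≤ (enc a).size := Data.size_snd_le _
    refine ⟨by simp [Expr.eval, hs]; rfl, ?_⟩
    simp only [Expr.cost, Expr.eval, hs, Polynomial.eval_mul, Polynomial.eval_X,
      Polynomial.eval_ofNat, esize]
    omega

end PT

instance : Enc Message := ⟨Message.toData⟩
instance : Enc Token := ⟨Token.toData⟩

namespace PT

variable {α β γ δ : Type} [Enc α] [Enc β] [Enc γ] [Enc δ]

theorem root : PT Message.root :=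
  fst.comp (of_enc (f := fun m : Message => (m.root, m.cmds)) fun _ => rfl)

theorem cmds : PT Message.cmds :=
  snd.comp (of_enc (f := fun m : Message => (m.root, m.cmds)) fun _ => rfl)

theorem message {f : α → List Bool} {g : α → List (List Bool)} (hf : PT f) (hg : PT g) :
    PT (fun x => Message.mk (f x) (g x)) :=
  (of_enc (f := fun x : List Bool × List (List Bool) => Message.mk x.1 x.2) fun _ => rfl).comp₂
    hf hg

theorem msg : PT Token.msg :=
  fst.comp (of_enc (f := fun m : Token => (m.msg, m.tag)) fun _ => rfl)

theorem tag : PT Token.tag :=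
  snd.comp (of_enc (f := fun m : Token => (m.msg, m.tag)) fun _ => rfl)

theorem token {f : α → Message} {g : α → List Bool} (hf : PT f) (hg : PT g) :
    PT (fun x => Token.mk (f x) (g x)) :=
  (of_enc (f := fun x : Message × List Bool => Token.mk x.1 x.2) fun _ => rfl).comp₂ hf hg

theorem messageOfData : PT Message.ofData :=
  message (toBits.comp dataFst)
    (map (f := fun d : Data => d.snd.toList) (g := fun y => y.2.toBits) (toList.comp dataSnd)
      (toBits.comp snd))

theorem tokenOfData : PT Token.ofData :=
  token (messageOfData.comp dataFst) (toBits.comp dataSnd)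

theorem field : PT RAF.field :=
  append (flatMap (f := fun l : List Bool => l) (g := fun y => [true, y.2]) PT.id
    (cons (const _) (cons snd (const _)))) (const _)

theorem encode : PT RAF.encode :=
  flatMap (f := fun m : Message => m.root :: m.cmds) (g := fun y => RAF.field y.2)
    (cons root cmds) (field.comp snd)

/-- One step of the chain of tags. -/
def chainStep (hmac : List Bool → List Bool → List Bool) (p : List Bool)
    (x : List Bool × List (List Bool)) (c : List Bool) : List Bool × List (List Bool) :=
  (hmac x.1 (RAF.encode ⟨p, x.2 ++ [c]⟩), x.2 ++ [c])

theorem foldl_chainStep (hmac : List Bool → List Bool → List Bool) (p h : List Bool)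
    (d cs : List (List Bool)) :
    cs.foldl (chainStep hmac p) (h, d) = (chainFrom hmac p h d cs, d ++ cs) := by
  induction cs generalizing h d with
  | nil => simp [chainFrom]
  | cons c cs ih => simp [chainStep, ih, chainFrom]

end PT

/-- This keeps iterated `hmac` polynomial: the tags do not grow along the chain. -/
theorem length_chainFrom {hmac : List Bool → List Bool → List Bool}
    (hl : ∀ k m, (hmac k m).length = k.length) (p h : List Bool) (d cs : List (List Bool)) :
    (chainFrom hmac p h d cs).length = h.length := by
  induction cs generalizing h d with
  | nil => rfl
  | cons c cs ih => rw [chainFrom, ih, hl]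

namespace PT

variable {α : Type} [Enc α]

theorem chainFrom {hmac : List Bool → List Bool → List Bool}
    (hl : ∀ k m, (hmac k m).length = k.length)
    (hm : PT fun x : List Bool × List Bool => hmac x.1 x.2)
    {p h : α → List Bool} {d cs : α → List (List Bool)}
    (hp : PT p) (hh : PT h) (hd : PT d) (hcs : PT cs) :
    PT (fun x => chainFrom hmac (p x) (h x) (d x) (cs x)) := by
  obtain ⟨Q, hQ⟩ := hh.esize_le
  obtain ⟨R, hR⟩ := hd.esize_le
  obtain ⟨S, hS⟩ := hcs.esize_le
  refine (fst.comp (foldl (f := cs) (i := fun x => (h x, d x))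
    (g := fun y : α × (List Bool × List (List Bool)) × List Bool =>
      chainStep hmac (p y.1) y.2.1 y.2.2) hcs (hh.pair hd)
    (pair (hm.comp₂ (fst.comp (fst.comp snd)) (encode.comp (message (hp.comp fst)
        (append (snd.comp (fst.comp snd)) (cons (snd.comp snd) (const _))))))
      (append (snd.comp (fst.comp snd)) (cons (snd.comp snd) (const _))))
    -- A bit takes between two and four nodes, so a tag as long as `h x` has at most about twice its
    -- size; hence the factor `2`. The other component of the accumulator is `d x` followed by a
    -- prefix of `cs x`.
    (2 * Q + R + S + 1) ?_)).congr fun x => ?_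
  · intro x l hl'
    have h1 : l.foldl (fun b a => chainStep hmac (p x) b a) (h x, d x) = _ :=
      foldl_chainStep hmac (p x) (h x) (d x) l
    simp only [h1, esize_pair]
    have h2 := esize_append (d x) l
    have h3 := esize_bits_le (RAF.chainFrom hmac (p x) (h x) (d x) l)
    have h4 := esize_bits_ge (h x)
    rw [length_chainFrom hl] at h3
    obtain ⟨l', hl'⟩ := hl'
    have h5 := esize_append l l'
    have h6 := one_le_esize l'
    rw [hl'] at h5
    have := hQ x
    have := hR x
    have := hS x
    simp only [Polynomial.eval_add, Polynomial.eval_mul, Polynomial.eval_ofNat,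
      Polynomial.eval_one]
    omega
  · change (List.foldl (chainStep hmac (p x)) (h x, d x) (cs x)).1 = _
    rw [foldl_chainStep]

end PT


/-! ## Moving programs to other registers -/

/-- The expression with register `r` renamed to `b + r`. -/
def Expr.shift (b : ℕ) : Expr → Expr
  | var x => var (b + x)
  | nil => nil
  | pair e f => pair (e.shift b) (f.shift b)
  | fst e => fst (e.shift b)
  | snd e => snd (e.shift b)
  | eq e f => eq (e.shift b) (f.shift b)

/-- All registers of the expression are below this number. -/
def Expr.width : Expr → ℕ
  | var x => x + 1
  | nil => 0
  | pair e f => max e.width f.width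
  | fst e => e.width
  | snd e => e.width
  | eq e f => max e.width f.width

/-- All registers of the program are below this number. -/
def Prog.width : Prog → ℕ
  | assign x e => max (x + 1) e.width
  | seq c d => max c.width d.width
  | ite e c d => max e.width (max c.width d.width)
  | loop e c => max e.width c.width
  | flip x => x + 1
  | call _ e x => max (x + 1) e.width

/-- The program with register `r` renamed to `b + r`, and `h i e x` in place of every oracle
call `call i e x`. -/
def Prog.translate (b : ℕ) (h : ℕ → Expr → ℕ → Prog) : Prog → Prog
  | assign x e => assign (b + x) (e.shift b)
  | seq c d => seq (c.translate b h) (d.translate b h)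
  | ite e c d => ite (e.shift b) (c.translate b h) (d.translate b h)
  | loop e c => loop (e.shift b) (c.translate b h)
  | flip x => flip (b + x)
  | call i e x => h i (e.shift b) (b + x)

/-- The registers of `s'` from `b` on contain the same as the first `w` registers of `s`. -/
def Agree (b w : ℕ) (s s' : Store) : Prop := ∀ r < w, s' (b + r) = s r

theorem Agree.update {b w : ℕ} {s s' : Store} (h : Agree b w s s') (x : ℕ) (d : Data) :
    Agree b w (Function.update s x d) (Function.update s' (b + x) d) := by
  intro r hr
  by_cases hx : r = x
  · simp [hx]
  · rw [Function.update_of_ne hx, Function.update_of_ne (by omega), h r hr]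

theorem Expr.eval_cost_shift {b w : ℕ} {s s' : Store} (h : Agree b w s s') (e : Expr)
    (he : e.width ≤ w) : (e.shift b).eval s' = e.eval s ∧ (e.shift b).cost s' = e.cost s := by
  induction e with
  | var x => simp only [shift, eval, cost]; rw [h x he]; exact ⟨rfl, rfl⟩
  | nil => exact ⟨rfl, rfl⟩
  | pair e f ihe ihf =>
    obtain ⟨h1, h2⟩ := ihe ((le_max_left _ _).trans he)
    obtain ⟨h3, h4⟩ := ihf ((le_max_right _ _).trans he)
    simp [shift, eval, cost, h1, h2, h3, h4]
  | fst e ihe =>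
    obtain ⟨h1, h2⟩ := ihe he
    simp [shift, eval, cost, h1, h2]
  | snd e ihe =>
    obtain ⟨h1, h2⟩ := ihe he
    simp [shift, eval, cost, h1, h2]
  | eq e f ihe ihf =>
    obtain ⟨h1, h2⟩ := ihe ((le_max_left _ _).trans he)
    obtain ⟨h3, h4⟩ := ihf ((le_max_right _ _).trans he)
    simp [shift, eval, cost, h1, h2, h3, h4]

/-- The next instruction is not an oracle call. -/
def Config.NotCall (c : Config) : Prop := ∀ i e x K, c.todo ≠ .call i e x :: K

theorem Config.Silent.notCall {c : Config} (h : c.Silent) : c.NotCall := by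
  intro i e x K h0
  simp [Config.Silent, h0] at h

theorem Config.silent_translate {b : ℕ} {h : ℕ → Expr → ℕ → Prog} {c : Config} (hc : c.Silent)
    (L : List Prog) (s' : Store) (t' : ℕ) :
    Config.Silent ⟨c.todo.map (Prog.translate b h) ++ L, s', t'⟩ := by
  obtain ⟨todo, s, t⟩ := c
  match todo, hc with
  | .assign x e :: K, _ => trivial
  | .seq c d :: K, _ => trivial
  | .ite e c d :: K, _ => trivial
  | .loop e c :: K, _ => trivial

theorem Config.width_next {w : ℕ} {c : Config} (hw : ∀ P ∈ c.todo, P.width ≤ w) (bit : Bool)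
    (a : List Bool) : ∀ P ∈ (c.next bit a).todo, P.width ≤ w := by
  obtain ⟨todo, s, t⟩ := c
  match todo with
  | [] => exact hw
  | .assign x e :: K => exact fun P hP => hw P (List.mem_cons_of_mem _ hP)
  | .flip x :: K => exact fun P hP => hw P (List.mem_cons_of_mem _ hP)
  | .call i e x :: K => exact fun P hP => hw P (List.mem_cons_of_mem _ hP)
  | .seq c d :: K =>
    simp only [List.mem_cons, forall_eq_or_imp, Prog.width, Config.next] at hw ⊢
    exact ⟨(le_max_left _ _).trans hw.1, (le_max_right _ _).trans hw.1, hw.2⟩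
  | .ite e c d :: K =>
    simp only [List.mem_cons, forall_eq_or_imp, Prog.width, Config.next, max_le_iff] at hw ⊢
    split_ifs
    · exact ⟨hw.1.2.2, hw.2⟩
    · exact ⟨hw.1.2.1, hw.2⟩
  | .loop e c :: K =>
    simp only [List.mem_cons, forall_eq_or_imp, Prog.width, Config.next, max_le_iff] at hw ⊢
    split_ifs
    · exact hw.2
    · simp only [List.mem_cons, forall_eq_or_imp, Prog.width, max_le_iff]
      exact ⟨hw.1.2, hw.1, hw.2⟩

/-- A step of a program is also a step of the translated program. -/
theorem Config.next_translate {b w : ℕ} {h : ℕ → Expr → ℕ → Prog} {c : Config} {s' : Store}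
    (hne : c.todo ≠ []) (hc : c.NotCall) (hw : ∀ P ∈ c.todo, P.width ≤ w)
    (ha : Agree b w c.store s') (bit : Bool) :
    ∃ s'' d, (∀ L t', Config.next bit [] ⟨c.todo.map (Prog.translate b h) ++ L, s', t'⟩
        = ⟨(c.next bit []).todo.map (Prog.translate b h) ++ L, s'', t' + d⟩) ∧
      c.time + d = (c.next bit []).time ∧ Agree b w (c.next bit []).store s'' ∧
      ∀ r, r < b ∨ b + w ≤ r → s'' r = s' r := by
  obtain ⟨todo, s, t⟩ := c
  match todo, hne, hc with
  | .assign x e :: K, _, _ =>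
    have hP := hw _ List.mem_cons_self
    simp only [Prog.width, max_le_iff] at hP
    obtain ⟨h1, h2⟩ := e.eval_cost_shift ha hP.2
    refine ⟨Function.update s' (b + x) ((e.shift b).eval s'), 1 + e.cost s, fun L t' => ?_, ?_, ?_, fun r hr => ?_⟩
    · simp only [List.map_cons, Prog.translate, List.cons_append, Config.next, h2,
        Nat.add_assoc]
    · simp only [Config.next]; omega
    · simp only [Config.next, h1]; exact ha.update _ _
    · rw [Function.update_of_ne (by omega)]
  | .seq c d :: K, _, _ =>
    refine ⟨_, 1, fun L t' => rfl, rfl, ?_, fun r hr => rfl⟩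
    · exact ha
  | .ite e c d :: K, _, _ =>
    have hP := hw _ List.mem_cons_self
    simp only [Prog.width, max_le_iff] at hP
    obtain ⟨h1, h2⟩ := e.eval_cost_shift ha hP.1
    refine ⟨s', 1 + e.cost s, fun L t' => ?_, ?_, ?_, fun r hr => rfl⟩
    · simp only [List.map_cons, Prog.translate, List.cons_append, Config.next, h1, h2,
        Nat.add_assoc]
      split_ifs <;> rfl
    · simp only [Config.next]; omega
    · exact ha
  | .loop e c :: K, _, _ =>
    have hP := hw _ List.mem_cons_self
    simp only [Prog.width, max_le_iff] at hP
    obtain ⟨h1, h2⟩ := e.eval_cost_shift ha hP.1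
    refine ⟨s', 1 + e.cost s, fun L t' => ?_, ?_, ?_, fun r hr => rfl⟩
    · simp only [List.map_cons, Prog.translate, List.cons_append, Config.next, h1, h2,
        Nat.add_assoc]
      split_ifs <;> rfl
    · simp only [Config.next]; omega
    · exact ha
  | .flip x :: K, _, _ =>
    have hP := hw _ List.mem_cons_self
    simp only [Prog.width] at hP
    refine ⟨_, 1, fun L t' => rfl, rfl, ?_, fun r hr => ?_⟩
    · exact ha.update _ _
    · rw [Function.update_of_ne (by omega)]
  | .call i e x :: K, _, hc => exact absurd rfl (hc i e x K)

theorem Config.silent_of_deterministic {c : Config} (hne : c.todo ≠ [])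
    (hd : ∀ P ∈ c.todo, P.Deterministic) : c.Silent := by
  obtain ⟨todo, s, t⟩ := c
  match todo, hne with
  | .assign x e :: K, _ => trivial
  | .seq c d :: K, _ => trivial
  | .ite e c d :: K, _ => trivial
  | .loop e c :: K, _ => trivial
  | .flip x :: K, _ => exact hd _ List.mem_cons_self
  | .call i e x :: K, _ => exact hd _ List.mem_cons_self

theorem Config.deterministic_next {c : Config} (hw : ∀ P ∈ c.todo, P.Deterministic)
    (bit : Bool) (a : List Bool) : ∀ P ∈ (c.next bit a).todo, P.Deterministic := by
  obtain ⟨todo, s, t⟩ := c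
  match todo with
  | [] => exact hw
  | .assign x e :: K => exact fun P hP => hw P (List.mem_cons_of_mem _ hP)
  | .flip x :: K => exact fun P hP => hw P (List.mem_cons_of_mem _ hP)
  | .call i e x :: K => exact fun P hP => hw P (List.mem_cons_of_mem _ hP)
  | .seq c d :: K =>
    simp only [List.mem_cons, forall_eq_or_imp, Prog.Deterministic, Config.next] at hw ⊢
    exact ⟨hw.1.1, hw.1.2, hw.2⟩
  | .ite e c d :: K =>
    simp only [List.mem_cons, forall_eq_or_imp, Prog.Deterministic, Config.next] at hw ⊢
    split_ifs
    · exact ⟨hw.1.2, hw.2⟩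
    · exact ⟨hw.1.1, hw.2⟩
  | .loop e c :: K =>
    simp only [List.mem_cons, forall_eq_or_imp, Prog.Deterministic, Config.next] at hw ⊢
    split_ifs
    · exact hw.2
    · simp only [List.mem_cons, forall_eq_or_imp, Prog.Deterministic]
      exact ⟨hw.1, hw.1, hw.2⟩

/-- This iterates `Config.next_translate` until the program stops. The instructions `L` still to
come are arbitrary and the registers outside the window are preserved, so a stand-alone program
becomes a subroutine. -/
theorem Config.reach_translate {b w : ℕ} {h : ℕ → Expr → ℕ → Prog}
    (coin : ℕ → Bool) (ans : ℕ → List Bool) (n : ℕ) (c : Config) (s' : Store)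
    (hd : ∀ P ∈ c.todo, P.Deterministic) (hw : ∀ P ∈ c.todo, P.width ≤ w)
    (ha : Agree b w c.store s') (hn : (c.exec coin ans n).todo = []) :
    ∃ s'' d, (∀ L t', Reach ⟨c.todo.map (Prog.translate b h) ++ L, s', t'⟩ ⟨L, s'', t' + d⟩) ∧
      c.time + d = (c.exec coin ans n).time ∧
      Agree b w (c.exec coin ans n).store s'' ∧ ∀ r, r < b ∨ b + w ≤ r → s'' r = s' r := by
  induction n generalizing c s' coin ans with
  | zero =>
    rw [exec] at hn ⊢
    rw [hn]
    exact ⟨s', 0, fun _ _ => .refl, rfl, ha, fun _ _ => rfl⟩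
  | succ n ih =>
    by_cases hne : c.todo = []
    · rw [exec_of_nil _ _ _ hne] at hn ⊢
      rw [hn]
      exact ⟨s', 0, fun _ _ => .refl, rfl, ha, fun _ _ => rfl⟩
    have hs := silent_of_deterministic hne hd
    rw [exec_succ', hs.next_eq _ false _ []] at hn ⊢
    obtain ⟨s1, d1, h1, h2, h3, h4⟩ := next_translate (h := h) hne hs.notCall hw ha false
    obtain ⟨s2, d2, h5, h6, h7, h8⟩ := ih _ _ (c.next false []) s1
      (deterministic_next hd _ _) (width_next hw _ _) h3 hn
    refine ⟨s2, d1 + d2, fun L t' => .head ⟨silent_translate hs L s' t', (h1 L t').symm⟩ ?_,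
      by omega, h7, fun r hr => by rw [h8 r hr, h4 r hr]⟩
    rw [← Nat.add_assoc]
    exact h5 L _

/-- Set the registers `b + 1`, ..., `b + n` to `nil`, then run `c`. -/
def Prog.clear (b : ℕ) : ℕ → Prog → Prog
  | 0, c => c
  | n + 1, c => .seq (.assign (b + 1 + n) .nil) (clear b n c)

/-- Programs for `PolyTime` start with empty registers, those for `PT` may find anything in them.
Clearing bridges the gap. -/
theorem Exec.clear {b : ℕ} {c : Prog} {m : ℕ} (n : ℕ) {s : Store} {Q : Store → Prop}
    (h : ∀ s₁ : Store, (∀ r < n, s₁ (b + 1 + r) = .nil) →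
      (∀ r, r < b + 1 ∨ b + 1 + n ≤ r → s₁ r = s r) → ∃ s₂ k, Exec c s₁ s₂ k ∧ Q s₂ ∧ k ≤ m) :
    ∃ s₂ k, Exec (.clear b n c) s s₂ k ∧ Q s₂ ∧ k ≤ 3 * n + m := by
  induction n generalizing s with
  | zero =>
    obtain ⟨s2, k, h1, h2, h3⟩ := h s (by simp) (fun _ _ => rfl)
    exact ⟨s2, k, h1, h2, by omega⟩
  | succ n ih =>
    obtain ⟨s2, k, h1, h2, h3⟩ := ih (s := Function.update s (b + 1 + n) .nil) fun s1 a1 a2 => by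
      refine h s1 (fun r hr => ?_) (fun r hr => ?_)
      · by_cases hrn : r = n
        · rw [hrn, a2 _ (by omega), Function.update_self]
        · exact a1 r (by omega)
      · rw [a2 r (by omega), Function.update_of_ne (by omega)]
    refine ⟨s2, _, .seq (.assign _ _ _) h1, h2, ?_⟩
    simp only [Expr.cost]
    omega

theorem Prog.deterministic_translate {b : ℕ} {h : ℕ → Expr → ℕ → Prog} (c : Prog)
    (hc : c.Deterministic) : (c.translate b h).Deterministic := by
  induction c with
  | assign => trivial
  | seq c d ihc ihd => exact ⟨ihc hc.1, ihd hc.2⟩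
  | ite e c d ihc ihd => exact ⟨ihc hc.1, ihd hc.2⟩
  | loop e c ihc => exact ihc hc
  | flip => exact hc.elim
  | call => exact hc.elim

theorem Prog.deterministic_clear {b n : ℕ} {c : Prog} (hc : c.Deterministic) :
    (Prog.clear b n c).Deterministic := by
  induction n with
  | zero => exact hc
  | succ n ih => exact ⟨trivial, ih⟩

theorem Config.Bounded.exec {Z : ℕ} {c : Config} (hZ : 3 ≤ Z) (h : c.Bounded Z)
    (coin : ℕ → Bool) (ans : ℕ → List Bool) (n : ℕ) : (c.exec coin ans n).Bounded Z := by
  induction n with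
  | zero => exact h
  | succ n ih => exact ih.next hZ _ _

theorem Config.bounded_init (c : Prog) (d : Data) : (Config.init c d).Bounded (d.size + 2) := by
  intro r
  simp only [init, Function.update_apply]
  split_ifs
  · omega
  · simp [Data.size]

/-- The program is moved to the registers from `b` on, after clearing the ones it may use. Its
output has polynomial size because a register holds no more than the input size plus the time used.
What replaces oracle calls is immaterial, since there are none. -/
theorem PT.of_polyTime {α β : Type} [Enc α] [Enc β] {f : α → β}
    (h : PolyTime (enc : α → Data) fun a => enc (f a)) : PT f := by
  obtain ⟨c, hc, T, h⟩ := h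
  refine ⟨fun b => .clear b (c.width + 1) (c.translate b fun _ _ _ => .assign 0 .nil),
    3 * .C c.width + T + .X + 5,
    fun b => Prog.deterministic_clear (c.deterministic_translate hc), fun a => ?_⟩
  obtain ⟨⟨h1, h2⟩, h3⟩ := h a
  set final := (Config.init c (enc a)).exec (fun _ => false) (fun _ => []) (T.eval (enc a).size)
    with hfinal
  simp only [Polynomial.eval_add, Polynomial.eval_mul, Polynomial.eval_X, Polynomial.eval_ofNat,
    Polynomial.eval_C]
  constructor
  · have := (Config.bounded_init c (enc a)).exec
      (by have := one_le_esize a; rw [size_enc]; omega) (fun _ => false)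
      (fun _ => []) (T.eval (enc a).size) 0
    rw [← hfinal, h3] at this
    simp only [size_enc] at *
    omega
  · intro b s hs
    obtain ⟨s2, k, e1, e2, e3⟩ := Exec.clear (b := b) (s := s)
        (c := c.translate b fun _ _ _ => .assign 0 .nil) (m := T.eval (esize a)) (c.width + 1)
        (Q := fun s2 => s2 b = enc (f a) ∧ ∀ r < b, s2 r = s r) fun s1 a1 a2 => by
      have ha : Agree b (c.width + 1) (Config.init c (enc a)).store s1 := by
        rintro (_ | r) hr
        · simp [Config.init, a2 b (by omega), hs]
        · have := a1 r (by omega)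
          rw [show b + 1 + r = b + (r + 1) by omega] at this
          simp [Config.init, this]
      obtain ⟨s2, d, h4, h5, h6, h7⟩ := Config.reach_translate
        (h := fun _ _ _ => .assign 0 .nil) _ _ _ (Config.init c (enc a)) s1
        (by simpa [Config.init] using hc) (by simp [Config.init]) ha h1
      refine ⟨s2, d, fun K t => h4 K t, ⟨?_, fun r hr => ?_⟩, ?_⟩
      · exact (h6 0 (by omega)).trans h3
      · rw [h7 r (by omega), a2 r (by omega)]
      · rw [← hfinal] at h5
        have : (Config.init c (enc a)).time = 0 := rfl
        simp only [size_enc] at *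
        omega
    refine ⟨s2, k, e1, e2.1, e2.2, ?_⟩
    omega

theorem PT.polyTime {α β : Type} [Enc α] [Enc β] {f : α → β} (h : PT f) :
    PolyTime (enc : α → Data) fun a => enc (f a) := by
  obtain ⟨c, P, hc, h⟩ := h
  refine ⟨c 0, hc 0, P, fun a => ?_⟩
  obtain ⟨s, n, h1, h2, -, h3⟩ := (h a).2 0 (Config.init (c 0) (enc a)).store rfl
  have h4 : RunsTo 0 (fun c' _ => c' = ⟨[], s, 0 + n⟩) (Config.init (c 0) (enc a)) (.ret ()) :=
    (h1 [] 0).runsTo (.ret rfl)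
  obtain ⟨_, h5⟩ := h4.exec_halts (B := P.eval (esize a))
    (by rintro _ _ rfl; exact ⟨rfl, by simpa using h3⟩) (fun _ => false) (fun _ => []) (by simp)
  simp only [size_enc, h5]
  exact ⟨⟨rfl, by simpa using h3⟩, h2⟩

/-! ## Sampling bit strings -/

/-- The tree tossing `n` coins and collecting the results in front of `acc`. -/
def Tree.flips : ℕ → List Bool → Tree (List Bool)
  | 0, acc => .ret acc
  | n + 1, acc => .flip fun b => flips n (b :: acc)

/-- The bit is split off at the end to match `Tree.flips`, where the coin tossed first ends up
behind those tossed later. -/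
theorem uniformBits_succ (n : ℕ) :
    uniformBits (n + 1) = (PMF.uniformOfFintype Bool).bind fun b =>
      (uniformBits n).map fun r => r ++ [b] := by
  have h : PMF.uniformOfFintype (Fin (n + 1) → Bool) = (PMF.uniformOfFintype Bool).bind fun b =>
      (PMF.uniformOfFintype (Fin n → Bool)).map fun r => Fin.snoc (α := fun _ => Bool) r b := by
    ext f
    have key : ∀ (b : Bool) (g : Fin n → Bool),
        (f = Fin.snoc (α := fun _ => Bool) g b) ↔ b = f (Fin.last n) ∧ g = Fin.init f := by
      intro b g
      constructor
      · rintro rfl; simp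
      · rintro ⟨rfl, rfl⟩; simp
    simp only [PMF.bind_apply, PMF.map_apply, PMF.uniformOfFintype_apply, tsum_fintype, key]
    rw [Finset.sum_eq_single (f (Fin.last n)) (by intro b _ hb; simp [hb]) (by simp)]
    simp only [true_and, Finset.sum_ite_eq', Finset.mem_univ, if_true, Fintype.card_bool,
      Fintype.card_pi, Finset.prod_const, Finset.card_univ, Fintype.card_fin]
    rw [Nat.pow_succ', Nat.cast_mul, ENNReal.mul_inv (by simp) (by simp)]
  rw [uniformBits, h, PMF.map_bind]
  congr 1
  funext b
  rw [uniformBits, PMF.map_comp, PMF.map_comp]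
  congr 1
  funext r
  rw [Function.comp, List.ofFn_succ']
  simp

theorem uniformBits_zero : uniformBits 0 = PMF.pure [] := by
  rw [uniformBits]
  have : (List.ofFn : (Fin 0 → Bool) → List Bool) = fun _ => [] := by
    funext f; simp
  rw [this]
  exact PMF.map_const _ _

theorem length_of_mem_uniformBits {n : ℕ} {r : List Bool} (h : r ∈ (uniformBits n).support) :
    r.length = n := by
  obtain ⟨f, -, rfl⟩ := (PMF.mem_support_map_iff _ _ _).1 h
  simp

theorem Tree.interp_flips {σ : Type} (O : Oracle σ) (n : ℕ) (acc : List Bool) (s : σ) :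
    (flips n acc).interp O s = (uniformBits n).map fun r => (r ++ acc, s) := by
  induction n generalizing acc with
  | zero => simp [flips, interp, uniformBits_zero, PMF.pure_map]
  | succ n ih =>
    rw [flips, interp, uniformBits_succ, PMF.map_bind]
    congr 1
    funext b
    rw [ih, PMF.map_comp]
    congr 1
    funext r
    simp

/-- Toss as many coins as there are entries in the list in register `src`, and collect the
results in register `dst`. -/
def Prog.sampler (src dst tmp : ℕ) : Prog :=
  .seq (.assign dst .nil) (.loop (.var src) (.seq (.flip tmp)
    (.seq (.assign dst (.pair (.var tmp) (.var dst))) (.assign src (.snd (.var src))))))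

/-- Each round handles both lists at a cost linear in `Z`, hence the quadratic bound. The assertion
records the length of the sample, which later bounds the values built from it. -/
theorem RunsTo.sampler {m src dst tmp : ℕ} (h₁ : src ≠ dst) (h₂ : src ≠ tmp) (h₃ : dst ≠ tmp)
    (K : List Prog) (s : Store) (t Z : ℕ) (hZ : (s src).size ≤ Z) :
    RunsTo m (fun c' r => r.length = (s src).toList.length ∧ ∃ s' t', c' = ⟨K, s', t'⟩ ∧
        s' dst = enc r ∧ (∀ x, x ≠ src → x ≠ dst → x ≠ tmp → s' x = s x) ∧
        t' ≤ t + 50 * (Z + 1) ^ 2)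
      ⟨.sampler src dst tmp :: K, s, t⟩ (.flips (s src).toList.length []) := by
  let body : Prog := .seq (.flip tmp)
    (.seq (.assign dst (.pair (.var tmp) (.var dst))) (.assign src (.snd (.var src))))
  have key : ∀ (d : Data) (acc : List Bool) (s₁ : Store) (t₁ : ℕ), s₁ src = d → d.size ≤ Z →
      acc.length + d.toList.length ≤ Z → s₁ dst = enc acc →
      RunsTo m (fun c' r => r.length = acc.length + d.toList.length ∧ ∃ s' t', c' = ⟨K, s', t'⟩ ∧
        s' dst = enc r ∧ (∀ x, x ≠ src → x ≠ dst → x ≠ tmp → s' x = s₁ x) ∧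
        t' ≤ t₁ + (d.toList.length + 1) * (15 * Z + 20))
      ⟨.loop (.var src) body :: K, s₁, t₁⟩ (.flips d.toList.length acc) := by
    intro d
    induction d with
    | nil =>
      intro acc s₁ t₁ hs hZ hl ha
      refine .silent trivial (.ret ⟨by simp [Data.toList], s₁,
        t₁ + 1 + (Expr.var src).cost s₁, ?_, ha, fun _ _ _ _ => rfl, ?_⟩)
      · simp [Config.next, Expr.eval, hs]
      · simp only [Expr.cost, hs, Data.size, Data.toList, List.length_nil]
        omega
    | pair a d _ ih =>
      intro acc s₁ t₁ hs hZ hl ha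
      refine .silent trivial ?_
      simp only [Config.next, Expr.eval, hs, reduceCtorEq, if_false]
      refine .silent trivial (.flip rfl fun b => .silent trivial (.silent trivial
        (.silent trivial ?_)))
      simp only [Data.size] at hZ
      simp only [Data.toList, List.length_cons] at hl
      refine (ih (b :: acc) _ _ ?_ (by omega) (by simp only [List.length_cons]; omega) ?_).mono ?_
      · simp [Expr.eval, h₁, h₂, hs, Data.snd]
      · simp [Expr.eval, h₁.symm, h₃, ha]
        rfl
      · rintro c' r ⟨hr, s', t', rfl, g1, g2, g3⟩
        refine ⟨by simpa [Data.toList, Nat.add_assoc, Nat.add_comm 1] using hr, s', t', rfl, g1,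
          fun x x1 x2 x3 => ?_, g3.trans ?_⟩
        · rw [g2 x x1 x2 x3]
          simp [x1, x2, x3]
        · have e1 := esize_bits_le acc
          have e2 := Data.size_ofBool b
          simp only [Expr.cost, Expr.eval, hs, ha, Function.update_self, ne_eq, h₁,
            h₂, h₃, not_false_eq_true, Function.update_of_ne, Data.size, Data.snd, Data.toList,
            List.length_cons, size_enc]
          have hmul : (d.toList.length + 1 + 1) * (15 * Z + 20)
            = (d.toList.length + 1) * (15 * Z + 20) + (15 * Z + 20) := by ring
          rw [hmul]
          omega
  refine .silent trivial (.silent trivial ?_)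
  have hlen := Data.length_toList_lt (s src)
  refine (key (s src) [] (Function.update s dst .nil) _ (by simp [h₁]) hZ (by simp; omega)
    (by simp; rfl)).mono ?_
  rintro c' r ⟨hr, s', t', rfl, g1, g2, g3⟩
  refine ⟨by simpa using hr, s', t', rfl, g1, fun x x1 x2 x3 => ?_, g3.trans ?_⟩
  · rw [g2 x x1 x2 x3, Function.update_of_ne x2]
  · have : ((s src).toList.length + 1) * (15 * Z + 20) ≤ (Z + 1) * (15 * Z + 20) := by
      gcongr; omega
    simp only [Expr.cost]
    nlinarith


/-! ## The construction is a user-tied token -/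

section scheme

variable {hmac : List Bool → List Bool → List Bool}

theorem chainFrom_append (p h : List Bool) (d cs : List (List Bool)) (c : List Bool) :
    chainFrom hmac p h d (cs ++ [c])
      = hmac (chainFrom hmac p h d cs) (encode ⟨p, d ++ (cs ++ [c])⟩) := by
  induction cs generalizing h d with
  | nil => rfl
  | cons c' cs ih => simp only [List.cons_append, chainFrom]; rw [ih]; simp

theorem chainTag_append (k p : List Bool) (cs : List (List Bool)) (c : List Bool) :
    chainTag hmac k ⟨p, cs ++ [c]⟩ = hmac (chainTag hmac k ⟨p, cs⟩) (encode ⟨p, cs ++ [c]⟩) :=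
  chainFrom_append p _ [] cs c

theorem raft_isWellFormed : (raft hmac).IsWellFormed := by
  refine ⟨fun k p c => rfl, fun k r c => ?_, fun k r c r' h => ?_⟩
  · simp only [raft]
    cases raftVer hmac k r <;> simp
  · simp only [raft] at h
    split_ifs at h
    cases h
    rfl

/-- The tag of a valid token is the last value of its chain, and this is exactly the key that the
chain applies to the next command. -/
theorem raft_isCorrect : (raft hmac).IsCorrect := by
  refine fun l k _ => ⟨fun p c => ?_, fun r c r' h => ?_⟩
  · simp [raft, raftVer, chainTag, chainFrom]
  · simp only [raft] at h ⊢
    split_ifs at h with hv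
    cases h
    simp only [raftVer, decide_eq_true_eq] at hv ⊢
    rw [chainTag_append, ← hv]

theorem PT.chainTag (hl : ∀ k m, (hmac k m).length = k.length)
    (hm : PT fun x : List Bool × List Bool => hmac x.1 x.2) {α : Type} [Enc α]
    {k : α → List Bool} {m : α → Message}
    (hk : PT k) (hmsg : PT m) : PT fun x => chainTag hmac (k x) (m x) :=
  PT.chainFrom hl hm (root.comp hmsg) (hm.comp₂ hk (root.comp hmsg)) (const _) (cmds.comp hmsg)

theorem PT.raftVer (hl : ∀ k m, (hmac k m).length = k.length)
    (hm : PT fun x : List Bool × List Bool => hmac x.1 x.2) {α : Type} [Enc α]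
    {k : α → List Bool} {r : α → Token}
    (hk : PT k) (hr : PT r) : PT fun x => raftVer hmac (k x) (r x) :=
  PT.eq enc_injective_bits (PT.chainTag hl hm hk (msg.comp hr)) (tag.comp hr)

end scheme

/-- The program that generates keys. -/
def genProg : Prog := .seq (.sampler 0 1 2) (.assign 0 (.var 1))

theorem ofBits_replicate_toList (l : ℕ) :
    (Data.ofBits (List.replicate l true)).toList.length = l := by
  simp [Data.ofBits, Data.toList_ofList]

theorem genProg_runsTo (m l : ℕ) :
    RunsTo m (fun c r => c.todo = [] ∧ c.time ≤ 50 * (4 * l + 2) ^ 2 + 4 * l + 3 ∧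
        (c.store 0).toBits = r)
      (Config.init genProg (Data.ofBits (List.replicate l true))) (.flips l []) := by
  -- Binding with `ret` splits off the final assignment as a second part of the program.
  have hb : ∀ T : Tree (List Bool), T.bind .ret = T := by
    intro T
    induction T with
    | ret a => rfl
    | flip f ih => simp [Tree.bind, ih]
    | call i d f ih => simp [Tree.bind, ih]
  rw [← hb (.flips l [])]
  refine .silent (by exact trivial) (RunsTo.bind (R := fun (c' : Config) (r : List Bool) =>
    r.length = l ∧ ∃ s' t', c' = ⟨[.assign 0 (.var 1)], s', t'⟩ ∧ s' 1 = enc r ∧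
      t' ≤ 1 + 50 * (4 * l + 2) ^ 2) ?_ _ ?_)
  · have := RunsTo.sampler (m := m) (src := 0) (dst := 1) (tmp := 2) (by omega) (by omega)
      (by omega) [.assign 0 (.var 1)]
      (Config.init genProg (Data.ofBits (List.replicate l true))).store 1 (4 * l + 1) (by
        have := Data.size_ofBits_le (List.replicate l true)
        simpa [Config.init] using this)
    simp only [Config.init, Function.update_self, ofBits_replicate_toList] at this
    refine this.mono ?_
    rintro c r ⟨h1, s', t', h2, h3, -, h4⟩
    exact ⟨h1, s', t', h2, h3, h4⟩
  · rintro c r ⟨h1, s', t', rfl, h2, h3⟩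
    refine .silent trivial (.ret ⟨rfl, ?_, ?_⟩)
    · have := esize_bits_le r
      simp only [Config.next, Expr.cost, h2, size_enc]
      omega
    · simp only [Config.next, Expr.eval, h2, Function.update_self]
      exact Data.toBits_ofBits r

/-- Key generation. -/
noncomputable def genPPT : PPT where
  prog := genProg
  bound := 50 * (4 * .X + 2) ^ 2 + 4 * .X + 3
  halts l coin ans hans := by
    have e : (50 * (4 * .X + 2) ^ 2 + 4 * .X + 3 : Polynomial ℕ).eval l
        = 50 * (4 * l + 2) ^ 2 + 4 * l + 3 := by simp
    rw [e]
    obtain ⟨b, h⟩ := (genProg_runsTo (l + 1) l).exec_halts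
      (B := 50 * (4 * l + 2) ^ 2 + 4 * l + 3) (fun c r h => ⟨h.1, h.2.1⟩) coin ans hans
    exact ⟨h.1, h.2.1⟩

theorem genPPT_run (l : ℕ) :
    (genPPT.run (fun _ _ s => PMF.pure ([], s)) l ()).map (fun r => r.1.toBits)
      = uniformBits l := by
  have e : (50 * (4 * .X + 2) ^ 2 + 4 * .X + 3 : Polynomial ℕ).eval l
      = 50 * (4 * l + 2) ^ 2 + 4 * l + 3 := by simp
  have h := (genProg_runsTo 0 l).map_runWith (O := fun _ _ s => PMF.pure ([], s))
    (W := fun _ : Unit => True) (B := 50 * (4 * l + 2) ^ 2 + 4 * l + 3)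
    (by simp) (fun c => (c.store 0).toBits) id (fun c r h => h) () trivial
    (genPPT.bound.eval l) (by simp [genPPT])
  have h2 := congrArg (PMF.map Prod.fst) h
  rw [PMF.map_comp, PMF.map_comp, Tree.interp_flips, PMF.map_comp] at h2
  rw [PPT.run, PMF.map_comp]
  refine Eq.trans h2 ?_
  simp only [Function.comp_def, List.append_nil, id]
  exact PMF.map_id _

theorem raft_isUserTiedToken {hmac : List Bool → List Bool → List Bool}
    (hl : ∀ k m, (hmac k m).length = k.length)
    (hm : PT fun x : List Bool × List Bool => hmac x.1 x.2) :
    (raft hmac).IsUserTiedToken := by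
  refine ⟨⟨⟨genPPT, genPPT_run⟩, ?_, ?_, ?_⟩, raft_isWellFormed, raft_isCorrect⟩
  · refine (PT.polyTime (f := fun a : List Bool × List Bool × List Bool =>
      Token.mk ⟨a.2.1, [a.2.2]⟩ (hmac (hmac a.1 a.2.1) (encode ⟨a.2.1, [a.2.2]⟩))) ?_ :)
    have h1 : PT fun a : List Bool × List Bool × List Bool => Message.mk a.2.1 [a.2.2] :=
      PT.message (PT.fst.comp PT.snd) (PT.cons (PT.snd.comp PT.snd) (PT.const _))
    exact PT.token h1 (hm.comp₂ (hm.comp₂ PT.fst (PT.fst.comp PT.snd)) (PT.encode.comp h1))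
  · have h1 : PT fun a : List Bool × Token × List Bool =>
        Message.mk a.2.1.msg.root (a.2.1.msg.cmds ++ [a.2.2]) :=
      PT.message (PT.root.comp (PT.msg.comp (PT.fst.comp PT.snd)))
        (PT.append (PT.cmds.comp (PT.msg.comp (PT.fst.comp PT.snd)))
          (PT.cons (PT.snd.comp PT.snd) (PT.const _)))
    have h2 : PT fun a : List Bool × Token × List Bool =>
        (raft hmac).serviceIssue a.1 a.2.1 a.2.2 :=
      PT.ite (PT.raftVer hl hm PT.fst (PT.fst.comp PT.snd))
        (PT.some.comp (PT.token h1
          (hm.comp₂ (PT.tag.comp (PT.fst.comp PT.snd)) (PT.encode.comp h1)))) (PT.const _)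
    have h3 : ∀ z : Option Token, (match z with
        | none => Data.nil
        | some r => .pair .nil r.toData) = enc z := by rintro (_ | _) <;> rfl
    exact Eq.mpr (congrArg (PolyTime _) (funext fun a => h3 _)) h2.polyTime
  · exact (PT.raftVer hl hm PT.fst PT.snd).polyTime


/-! ## Simulating the oracles of an algorithm -/

def Tree.map {α β : Type} (g : α → β) (T : Tree α) : Tree β := T.bind fun a => .ret (g a)

/-- The tree of an algorithm on input `1^l`, labelled by its outputs. -/
noncomputable def PPT.tree (A : PPT) (l : ℕ) : Tree Data :=
  ((Config.init A.prog (Data.ofBits (List.replicate l true))).tree (A.bound.eval l)).map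
    fun c => c.store 0

/-- A way to answer the oracle queries of an algorithm. A query `d` to oracle number `i` is
answered, in state `S` and with fresh random bits `r`, by `post (S, kind i, d, r, y)`, which also
yields the next state; here `y` is the answer to the query `pre (S, kind i, d)` to another oracle.
When the algorithm has stopped, one last query is asked, and its answer decides the outcome. -/
structure Simulator (S : Type) where
  pre : S × (Bool × Bool) × Data → Option (List Bool)
  post : S × (Bool × Bool) × Data × List Bool × List Bool → S × List Bool
  lastQuery : S → List Bool
  outcome : S × List Bool → Bool

/-- The number of an oracle in the forging game, as a pair of bits. -/
def kind : ℕ → Bool × Bool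
  | 0 => (false, false)
  | 1 => (true, false)
  | 2 => (false, true)
  | _ => (true, true)

namespace Simulator

variable {S α : Type} (M : Simulator S)

/-- The tree of one simulated answer. -/
def answer (l : ℕ) (st : S) (i : ℕ) (d : Data) : Tree (S × List Bool) :=
  (Tree.flips l []).bind fun r =>
    match M.pre (st, kind i, d) with
    | none => .ret (M.post (st, kind i, d, r, []))
    | some q => .call 0 (Data.ofBits q) fun y => .ret (M.post (st, kind i, d, r, y))

/-- The tree in which all oracle calls are replaced by simulated answers. -/
def handle (l : ℕ) : Tree α → S → Tree (α × S)
  | .ret a, st => .ret (a, st)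
  | .flip f, st => .flip fun b => handle l (f b) st
  | .call i d f, st => (M.answer l st i d).bind fun x => handle l (f x.2) x.1

/-- The last part of the simulation: the output of the algorithm is treated as a query to oracle
number `0`, and then the outcome is determined. -/
def finish (l : ℕ) (x : Data × S) : Tree Bool :=
  (M.answer l x.2 0 x.1).bind fun y =>
    .call 0 (Data.ofBits (M.lastQuery y.1)) fun z => .ret (M.outcome (y.1, z))

/-- The whole simulation. -/
def tree (l k : ℕ) (setup : List Bool → List Bool → List Bool → S) (T : Tree Data) : Tree Bool :=
  (Tree.flips k []).bind fun r₁ => (Tree.flips k []).bind fun r₂ => (Tree.flips k []).bind fun r₃ =>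
    (M.handle l T (setup r₁ r₂ r₃)).bind (M.finish l)

end Simulator

/-! ### Compiling a simulator into a program -/

/-- The programs `c` compute `f` within the time given by `P`. -/
def Computes {α β : Type} [Enc α] [Enc β] (f : α → β) (c : ℕ → Prog) (P : Polynomial ℕ) : Prop :=
  ∀ a, esize (f a) ≤ P.eval (esize a) ∧ ∀ b s, s b = enc a → ∃ s' n, Exec (c b) s s' n ∧
    s' b = enc (f a) ∧ (∀ r < b, s' r = s r) ∧ n ≤ P.eval (esize a)

theorem PT.exists_computes {α β : Type} [Enc α] [Enc β] {f : α → β} (h : PT f) :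
    ∃ c P, Computes f c P :=
  let ⟨c, P, _, h⟩ := h
  ⟨c, P, h⟩

namespace RunsTo

variable {m : ℕ} {β : Type} {R : Config → β → Prop} {T : Tree β} {c d : Prog} {K : List Prog}
  {s s' : Store} {t n : ℕ}

theorem of_exec (h : Exec c s s' n) (hT : RunsTo m R ⟨K, s', t + n⟩ T) :
    RunsTo m R ⟨c :: K, s, t⟩ T :=
  (h K t).runsTo hT

theorem seq (hT : RunsTo m R ⟨c :: d :: K, s, t + 1⟩ T) : RunsTo m R ⟨.seq c d :: K, s, t⟩ T :=
  .silent trivial hT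

theorem assign {x : ℕ} {e : Expr} {v : Data} (hv : e.eval s = v)
    (hT : RunsTo m R ⟨K, Function.update s x v, t + 1 + e.cost s⟩ T) :
    RunsTo m R ⟨.assign x e :: K, s, t⟩ T := by
  subst hv
  exact .silent trivial hT

end RunsTo

/-- The last part of the simulation of an oracle call: compute the new state and the answer. -/
def replyProg (cpost : ℕ → Prog) (w i x : ℕ) : Prog :=
  .seq (.assign (w + 7) (.pair (.var w) (.pair (.quote (enc (kind i))) (.pair (.var (w + 2))
    (.pair (.var (w + 4)) (.var (w + 6))))))) <|
  .seq (cpost (w + 7)) <| .seq (.assign w (.fst (.var (w + 7)))) (.assign x (.snd (.var (w + 7))))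

/-- The part of the simulation of an oracle call that follows the sampling. -/
def queryProg (cpre cpost : ℕ → Prog) (w i x : ℕ) : Prog :=
  .seq (.assign (w + 5) (.pair (.var w) (.pair (.quote (enc (kind i))) (.var (w + 2))))) <|
  .seq (cpre (w + 5)) <|
  .seq (.ite (.var (w + 5)) (.call 0 (.snd (.var (w + 5))) (w + 6)) (.assign (w + 6) .nil)) <|
  replyProg cpost w i x

/-- The program replacing a call `call i e x`. Register `w` holds the state and register `w + 1`
the number of random bits; the registers from `w + 2` on are used for intermediate values. -/
def answerProg (cpre cpost : ℕ → Prog) (w i : ℕ) (e : Expr) (x : ℕ) : Prog :=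
  .seq (.assign (w + 2) e) <| .seq (.assign (w + 3) (.var (w + 1))) <|
  .seq (.sampler (w + 3) (w + 4) (w + 5)) <| queryProg cpre cpost w i x

theorem cost_quote_kind (i : ℕ) (s : Store) : (Expr.quote (enc (kind i))).cost s ≤ 30 := by
  rcases i with _ | _ | _ | i <;>
    simp [kind, enc, Data.ofBool, Expr.quote, Expr.cost, Expr.eval, Data.size]

theorem esize_kind (i : ℕ) : esize (kind i) ≤ 7 := by
  rw [show kind i = ((kind i).1, (kind i).2) from rfl, esize_pair]
  have := esize_bool_le (kind i).1
  have := esize_bool_le (kind i).2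
  omega

/-- A bound for the time of a simulated answer. -/
noncomputable def answerBound (P Q : Polynomial ℕ) : Polynomial ℕ :=
  5 * P + 5 * Q + 50 * (.X + 1) ^ 2 + 20 * .X + 200

theorem Exec.reply {S : Type} [Enc S] {M : Simulator S} {cpost : ℕ → Prog} {Q : Polynomial ℕ}
    (hpost : Computes M.post cpost Q) {w l Z : ℕ} (i : ℕ) {x : ℕ} (hx : x < w) {s : Store}
    {st : S} {q : Data} {r y : List Bool} (hs : s w = enc st) (hs' : s (w + 1) = enc l)
    (hq : s (w + 2) = q) (hr : s (w + 4) = enc r) (hy : s (w + 6) = enc y)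
    (hrl : r.length = l) (hyl : y.length ≤ l + 1) (hZ : esize st + q.size + 8 * l + 40 ≤ Z) :
    ∃ s' n, Exec (replyProg cpost w i x) s s' n ∧
      s' w = enc (M.post (st, kind i, q, r, y)).1 ∧ s' (w + 1) = enc l ∧
      s' x = enc (M.post (st, kind i, q, r, y)).2 ∧ (∀ r < w, r ≠ x → s' r = s r) ∧
      n ≤ 5 * Q.eval Z + 6 * Z + 60 := by
  have hk := cost_quote_kind i s
  have hk' := esize_kind i
  have h1 := esize_bits_le r
  have h2 := esize_bits_le y
  obtain ⟨g1, g2⟩ := hpost (st, kind i, q, r, y)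
  have hin : esize (st, kind i, q, r, y) ≤ Z := by
    have : esize (st, kind i, q, r, y)
      = 1 + esize st + (1 + esize (kind i) + (1 + q.size + (1 + esize r + esize y))) := rfl
    omega
  have hQ := polyEval_mono Q hin
  set z := M.post (st, kind i, q, r, y) with hz
  have hzs : (enc z).size = 1 + esize z.1 + esize z.2 := rfl
  have hz1 : (enc z).fst = enc z.1 := rfl
  have hz2 : (enc z).snd = enc z.2 := rfl
  obtain ⟨s1, n1, e1, v1, f1, t1⟩ := g2 (w + 7) (Function.update s (w + 7)
    ((Expr.pair (.var w) (.pair (.quote (enc (kind i))) (.pair (.var (w + 2))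
      (.pair (.var (w + 4)) (.var (w + 6)))))).eval s)) (by
        simp only [Function.update_self, Expr.eval, Expr.eval_quote, hs, hq, hr, hy]
        rfl)
  have hf : ∀ r < w + 7, s1 r = s r := fun r hr => by
    rw [f1 r hr, Function.update_of_ne (by omega)]
  refine ⟨_, _, .seq (.assign _ _ _) (.seq e1 (.seq (.assign _ _ _) (.assign _ _ _))),
    ?_, ?_, ?_, fun r hr hrx => ?_, ?_⟩
  · rw [Function.update_of_ne (by omega), Function.update_self, Expr.eval, Expr.eval, v1, hz1]
  · rw [Function.update_of_ne (by omega), Function.update_of_ne (by omega), hf _ (by omega), hs']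
  · rw [Function.update_self]
    simp only [Expr.eval]
    rw [Function.update_of_ne (by omega), v1, hz2]
  · rw [Function.update_of_ne (by omega), Function.update_of_ne (by omega), hf _ (by omega)]
  · simp only [Expr.cost, Expr.eval, Expr.eval_quote, hs, hq, hr, hy, v1, hz1, hz2, Data.size,
      size_enc, ne_eq, Nat.add_eq_left, OfNat.ofNat_ne_zero, not_false_eq_true,
      Function.update_of_ne] at *
    omega

/-- Both branches continue with `replyProg`. If no query is made, the register of the answer is set
to the empty string, the value of `y` that `Simulator.answer` uses in this case. -/
theorem queryProg_runsTo {S : Type} [Enc S] {M : Simulator S} {cpre cpost : ℕ → Prog}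
    {P Q : Polynomial ℕ} (hpre : Computes M.pre cpre P) (hpost : Computes M.post cpost Q)
    {w l Z : ℕ} (i : ℕ) {x : ℕ} (hx : x < w) (K : List Prog) {s : Store} (t : ℕ)
    {st : S} {q : Data} {r : List Bool} (hs : s w = enc st) (hs' : s (w + 1) = enc l)
    (hq : s (w + 2) = q) (hr : s (w + 4) = enc r) (hrl : r.length = l)
    (hZ : esize st + q.size + 8 * l + 40 ≤ Z) :
    RunsTo (l + 1) (fun c' z => ∃ s' t' y, c' = ⟨K, s', t'⟩ ∧
        y.length ≤ l + 1 ∧ z = M.post (st, kind i, q, r, y) ∧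
        s' w = enc z.1 ∧ s' (w + 1) = enc l ∧ s' x = enc z.2 ∧ (∀ r < w, r ≠ x → s' r = s r) ∧
        t' ≤ t + 5 * P.eval Z + 5 * Q.eval Z + 15 * Z + 150)
      ⟨queryProg cpre cpost w i x :: K, s, t⟩
      (match M.pre (st, kind i, q) with
        | none => .ret (M.post (st, kind i, q, r, []))
        | some p => .call 0 (Data.ofBits p) fun y => .ret (M.post (st, kind i, q, r, y))) := by
  have hk := cost_quote_kind i s
  have hk' := esize_kind i
  obtain ⟨g1, g2⟩ := hpre (st, kind i, q)
  have hin : esize (st, kind i, q) ≤ Z := by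
    have : esize (st, kind i, q) = 1 + esize st + (1 + esize (kind i) + q.size) := rfl
    omega
  have hP := polyEval_mono P hin
  obtain ⟨s1, n1, e1, v1, f1, t1⟩ := g2 (w + 5) (Function.update s (w + 5)
    ((Expr.pair (.var w) (.pair (.quote (enc (kind i))) (.var (w + 2)))).eval s)) (by
        simp only [Function.update_self, Expr.eval, Expr.eval_quote, hs, hq]
        rfl)
  have hf : ∀ r < w + 5, s1 r = s r := fun r hr => by
    rw [f1 r hr, Function.update_of_ne (by omega)]
  have c1 : (Expr.pair (.var w) (.pair (.quote (enc (kind i))) (.var (w + 2)))).cost s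
      ≤ 3 * Z + 60 := by
    simp only [Expr.cost, Expr.eval, Expr.eval_quote, hs, hq, Data.size, size_enc]
    omega
  refine .seq (.assign rfl (.seq (.of_exec e1 (.seq ?_))))
  have finish : ∀ (y : List Bool) (t₁ : ℕ), y.length ≤ l + 1 →
      t₁ ≤ t + 5 * P.eval Z + 6 * Z + 80 →
      RunsTo (l + 1) (fun c' z => ∃ s' t' y, c' = ⟨K, s', t'⟩ ∧
        y.length ≤ l + 1 ∧ z = M.post (st, kind i, q, r, y) ∧
        s' w = enc z.1 ∧ s' (w + 1) = enc l ∧ s' x = enc z.2 ∧ (∀ r < w, r ≠ x → s' r = s r) ∧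
        t' ≤ t + 5 * P.eval Z + 5 * Q.eval Z + 15 * Z + 150)
      ⟨replyProg cpost w i x :: K, Function.update s1 (w + 6) (enc y), t₁⟩
      (.ret (M.post (st, kind i, q, r, y))) := by
    intro y t₁ hy ht
    obtain ⟨s2, n2, e2, a1, a2, a3, a4, a5⟩ := Exec.reply hpost (Z := Z) i hx
      (s := Function.update s1 (w + 6) (enc y)) (st := st) (q := q) (r := r) (y := y)
      (by rw [Function.update_of_ne (by omega), hf _ (by omega), hs])
      (by rw [Function.update_of_ne (by omega), hf _ (by omega), hs'])
      (by rw [Function.update_of_ne (by omega), hf _ (by omega), hq])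
      (by rw [Function.update_of_ne (by omega), hf _ (by omega), hr])
      (by rw [Function.update_self]) hrl hy hZ
    refine .of_exec e2 (.ret ⟨s2, _, y, rfl, hy, rfl, a1, a2, a3, fun r hr hrx => ?_, by omega⟩)
    rw [a4 r hr hrx, Function.update_of_ne (by omega), hf _ (by omega)]
  cases hp : M.pre (st, kind i, q) with
  | none =>
    rw [hp] at v1
    have v1' : s1 (w + 5) = .nil := v1
    refine .silent trivial ?_
    simp only [Config.next, Expr.eval, v1', if_true]
    refine .assign (v := enc ([] : List Bool)) rfl (finish [] _ (by simp) ?_)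
    have h1 : (Expr.var (w + 5)).cost s1 = 1 := by simp [Expr.cost, v1', Data.size]
    have h2 : Expr.nil.cost s1 = 1 := rfl
    omega
  | some p =>
    rw [hp] at v1 g1
    have v1' : s1 (w + 5) = .pair .nil (enc p) := v1
    have v2 : (Expr.snd (.var (w + 5))).eval s1 = Data.ofBits p := by
      simp only [Expr.eval, v1']; rfl
    refine .silent trivial ?_
    simp only [Config.next, Expr.eval, v1', reduceCtorEq, if_false]
    rw [← v2]
    refine .call rfl fun y hy => finish y _ hy ?_
    have h3 := Data.size_ofBits_le y
    rw [esize_some] at g1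
    have h1 : (Expr.var (w + 5)).cost s1 = 2 + esize p := by
      simp [Expr.cost, v1', Data.size, size_enc]
    have h2 : (Expr.snd (.var (w + 5))).cost s1 = 2 + 2 * esize p := by
      simp only [Expr.cost, Expr.eval, v1', Data.size, Data.snd, size_enc]
      omega
    omega

theorem answerProg_runsTo {S : Type} [Enc S] {M : Simulator S} {cpre cpost : ℕ → Prog}
    {P Q : Polynomial ℕ} (hpre : Computes M.pre cpre P) (hpost : Computes M.post cpost Q)
    {w l Z : ℕ} (i : ℕ) {e : Expr} {x : ℕ} (hx : x < w) (K : List Prog) {s : Store} (t : ℕ)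
    {st : S} (hs : s w = enc st) (hs' : s (w + 1) = enc l)
    (hZ : esize st + (e.eval s).size + 8 * l + 40 ≤ Z) :
    RunsTo (l + 1) (fun c' z => ∃ s' t' r y, c' = ⟨K, s', t'⟩ ∧ r.length = l ∧
        y.length ≤ l + 1 ∧ z = M.post (st, kind i, e.eval s, r, y) ∧
        s' w = enc z.1 ∧ s' (w + 1) = enc l ∧ s' x = enc z.2 ∧ (∀ r < w, r ≠ x → s' r = s r) ∧
        t' ≤ t + e.cost s + (answerBound P Q).eval Z)
      ⟨answerProg cpre cpost w i e x :: K, s, t⟩ (M.answer l st i (e.eval s)) := by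
  set q := e.eval s with hq
  have hb : (answerBound P Q).eval Z
      = 5 * P.eval Z + 5 * Q.eval Z + 50 * (Z + 1) ^ 2 + 20 * Z + 200 := by
    simp [answerBound]
  -- `Prog.sampler` uses up its counter, so the number of random bits is copied first.
  refine .seq (.assign (v := q) rfl (.seq (.assign (v := enc l) ?_ (.seq ?_))))
  · simp [Expr.eval, hs']
  set s2 := Function.update (Function.update s (w + 2) q) (w + 3) (enc l) with hs2
  have a2 : ∀ r < w + 2, s2 r = s r := fun r hr => by
    rw [hs2, Function.update_of_ne (by omega), Function.update_of_ne (by omega)]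
  have b2 : s2 (w + 2) = q := by simp [hs2]
  have c2 : s2 (w + 3) = enc l := by simp [hs2]
  have hsize : (s2 (w + 3)).size = 2 * l + 1 := by rw [c2, size_enc, esize_nat]
  have hlen : (s2 (w + 3)).toList.length = l := by
    rw [c2]; simp [enc, Data.toList_ofList]
  have hc1 : (Expr.var (w + 1)).cost (Function.update s (w + 2) q) = 2 * l + 1 := by
    simp [Expr.cost, hs', size_enc, esize_nat]
  refine RunsTo.bind (R := fun (c' : Config) (r : List Bool) => r.length = l ∧ ∃ s3 t3,
    c' = ⟨queryProg cpre cpost w i x :: K, s3, t3⟩ ∧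
    s3 (w + 4) = enc r ∧ (∀ r < w + 3, s3 r = s2 r) ∧
    t3 ≤ t + e.cost s + 2 * l + 6 + 50 * (Z + 1) ^ 2) ?_ _ ?_
  · have := RunsTo.sampler (m := l + 1) (src := w + 3) (dst := w + 4) (tmp := w + 5) (by omega)
      (by omega) (by omega) (queryProg cpre cpost w i x :: K) s2
      (t + 1 + 1 + e.cost s + 1 + 1 + (Expr.var (w + 1)).cost (Function.update s (w + 2) q) + 1) Z
      (by omega)
    rw [hlen] at this
    refine this.mono ?_
    rintro c' r ⟨h1, s', t', rfl, h2, h3, h4⟩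
    refine ⟨h1, s', t', rfl, h2, fun r hr => h3 r (by omega) (by omega) (by omega), ?_⟩
    rw [hc1] at h4
    omega
  · rintro c' r ⟨h1, s3, t3, rfl, h2, h3, h4⟩
    refine (queryProg_runsTo hpre hpost i hx K t3 (st := st) (q := q) ?_ ?_ ?_ h2 h1 hZ).mono ?_
    · rw [h3 _ (by omega), a2 _ (by omega), hs]
    · rw [h3 _ (by omega), a2 _ (by omega), hs']
    · rw [h3 _ (by omega), b2]
    · rintro c' z ⟨s', t', y, rfl, g1, g2, g3, g4, g5, g6, g7⟩
      refine ⟨s', t', r, y, rfl, h1, g1, g2, g3, g4, g5, fun r hr hrx => ?_, ?_⟩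
      · rw [g6 r hr hrx, h3 _ (by omega), a2 _ (by omega)]
      · omega


/-- The translated program, in which the oracle calls are replaced by simulated answers, unfolds
to the tree with simulated answers. -/
theorem RunsTo.simulate {S : Type} [Enc S] {M : Simulator S} {cpre cpost : ℕ → Prog}
    {P Q : Polynomial ℕ} (hpre : Computes M.pre cpre P) (hpost : Computes M.post cpost Q)
    {w l Tm Z₀ Zm G : ℕ} {V : S → Prop} {X : Config → Prop}
    (hV : ∀ st i d r y, V st → d.size ≤ Tm → r.length = l → y.length ≤ l + 1 →
      V (M.post (st, kind i, d, r, y)).1 ∧ (M.post (st, kind i, d, r, y)).2.length ≤ l + 1 ∧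
      esize (M.post (st, kind i, d, r, y)).1 ≤ esize st + G)
    (hZm : Z₀ + Tm * G + Tm + 8 * l + 40 ≤ Zm) (L : List Prog) (t₀ : ℕ) {c : Config}
    {T : Tree Config}
    (h : RunsTo (l + 1) (fun c' b => c' = b ∧ c'.todo = [] ∧ c'.time ≤ Tm ∧ X c') c T)
    (hw : ∀ p ∈ c.todo, p.width ≤ w) {s' : Store} (ha : Agree 0 w c.store s') {st : S}
    (hs : s' w = enc st) (hs' : s' (w + 1) = enc l) (hst : V st)
    (hsize : esize st ≤ Z₀ + c.time * G) {t' : ℕ}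
    (ht : t' ≤ t₀ + c.time * ((answerBound P Q).eval Zm + 1)) :
    RunsTo (l + 1) (fun c' b => ∃ s'' t'', c' = ⟨L, s'', t''⟩ ∧ X b.1 ∧ Agree 0 w b.1.store s'' ∧
        s'' w = enc b.2 ∧ s'' (w + 1) = enc l ∧ V b.2 ∧ esize b.2 ≤ Z₀ + Tm * G ∧
        t'' ≤ t₀ + Tm * ((answerBound P Q).eval Zm + 1))
      ⟨c.todo.map (Prog.translate 0 (answerProg cpre cpost w)) ++ L, s', t'⟩
      (M.handle l T st) := by
  -- Amortized accounting: a unit of time of the original run pays for `C + 1` units of the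
  -- simulation and for a growth of the state by `G`. An oracle call takes at least one unit, which
  -- pays for the simulated answer.
  set C := (answerBound P Q).eval Zm with hC
  have htm := h.time_le (B := Tm) fun c b h => h.2.2.1
  induction h generalizing s' st t' with
  | @ret c b hr =>
    obtain ⟨rfl, hc, hc', hX⟩ := hr
    rw [hc]
    refine .ret ⟨s', t', rfl, hX, ha, hs, hs', hst, hsize.trans ?_, ht.trans ?_⟩ <;> gcongr
  | @silent c T hsil hrun ih =>
    obtain ⟨s1, d, h1, h2, h3, h4⟩ := Config.next_translate
      (h := answerProg cpre cpost w) hsil.ne_nil hsil.notCall hw ha false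
    refine .silent (Config.silent_translate hsil L s' t') ?_
    rw [h1]
    have hle : c.time ≤ (c.next false []).time := by omega
    refine ih (Config.width_next hw _ _) h3 (by rw [h4 w (by omega), hs])
      (by rw [h4 _ (by omega), hs']) hst (hsize.trans (by gcongr)) ?_
      (hrun.time_le fun c b h => h.2.2.1)
    rw [← h2, add_mul, mul_add d]
    omega
  | @flip c x K f hc hrun ih =>
    have hnc : c.NotCall := by
      intro i e x K h
      rw [hc] at h
      cases h
    refine .flip (x := 0 + x) (K := K.map (Prog.translate 0 (answerProg cpre cpost w)) ++ L)
      (by rw [hc]; rfl) fun b => ?_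
    obtain ⟨s1, d, h1, h2, h3, h4⟩ := Config.next_translate
      (h := answerProg cpre cpost w) (by simp [hc]) hnc hw ha b
    rw [h1]
    have hle : c.time ≤ (c.next b []).time := by omega
    refine ih b (Config.width_next hw _ _) h3 (by rw [h4 w (by omega), hs])
      (by rw [h4 _ (by omega), hs']) hst (hsize.trans (by gcongr)) ?_
      ((hrun b).time_le fun c b h => h.2.2.1)
    rw [← h2, add_mul, mul_add d]
    omega
  | @call c i e x K f hc hrun ih =>
    obtain ⟨todo, s, t⟩ := c
    simp only at hc
    subst hc
    have hp := hw _ List.mem_cons_self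
    simp only [Prog.width, max_le_iff] at hp
    obtain ⟨he1, he2⟩ := e.eval_cost_shift ha hp.2
    simp only at hsize ht htm ha he1 he2
    have hbig : t + 1 + e.cost s ≤ Tm := by
      have := (hrun [] (by simp)).time_le (B := Tm) fun c b h => h.2.2.1
      simp only [Config.next] at this
      omega
    have hesz := e.size_eval_le s
    have hZ : esize st + ((e.shift 0).eval s').size + 8 * l + 40 ≤ Zm := by
      have : t * G ≤ Tm * G := by gcongr
      rw [he1]
      omega
    have := answerProg_runsTo hpre hpost i (x := 0 + x) (w := w) (by omega)
      (K.map (Prog.translate 0 (answerProg cpre cpost w)) ++ L) t' hs hs' hZ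
    rw [he1] at this
    refine this.bind _ ?_
    rintro c' ⟨S', a⟩ ⟨s1, t1, r, y, rfl, h1, h2, h3, h4, h5, h6, h7, h8⟩
    obtain ⟨v1, v2, v3⟩ := hV st i (e.eval s) r y hst (by omega) h1 h2
    rw [← h3] at v1 v2 v3
    have hmul : (t + 1 + e.cost s) * G = t * G + (1 + e.cost s) * G := by ring
    have hG : G ≤ (1 + e.cost s) * G := Nat.le_mul_of_pos_left _ (by omega)
    refine ih a v2 (Config.width_next hw _ _) ?_ h4 h5 v1 ?_ ?_
      ((hrun a v2).time_le fun c b h => h.2.2.1)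
    · intro r hr
      simp only [Config.next]
      by_cases hrx : r = x
      · subst hrx
        rw [Function.update_self]
        exact h6
      · rw [Function.update_of_ne hrx, h7 _ (by omega) (by omega), ha r hr]
    · simp only [Config.next]
      refine v3.trans ?_
      have : (t + 1 + e.cost s) * G ≤ (t + 1 + e.cost s + (Data.ofBits a).size) * G := by
        exact Nat.mul_le_mul_right _ (by omega)
      omega
    · simp only [Config.next]
      refine h8.trans ?_
      rw [he2]
      have : (t + 1 + e.cost s + (Data.ofBits a).size) * (C + 1) = t * (C + 1) + (C + 1)
        + e.cost s * C + e.cost s + (Data.ofBits a).size * (C + 1) := by ring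
      rw [this]
      omega

/-- Sample as many bits as register `w + 2` prescribes, into register `x`. -/
def sampleProg (w x : ℕ) : Prog :=
  .seq (.assign (w + 3) (.var (w + 2))) (.sampler (w + 3) x (w + 7))

theorem sampleProg_runsTo {m w x k : ℕ} (h₁ : w + 3 < x) (h₂ : x < w + 7) (K : List Prog)
    {s : Store} (t : ℕ) (hs : s (w + 2) = enc k) :
    RunsTo m (fun c' r => r.length = k ∧ ∃ s' t', c' = ⟨K, s', t'⟩ ∧ s' x = enc r ∧
        (∀ y, y < w + 7 → y ≠ w + 3 → y ≠ x → s' y = s y) ∧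
        t' ≤ t + 50 * (2 * k + 2) ^ 2 + 2 * k + 5)
      ⟨sampleProg w x :: K, s, t⟩ (.flips k []) := by
  refine .seq (.assign (v := enc k) (by rw [Expr.eval, hs]) ?_)
  have hc : (Expr.var (w + 2)).cost s = 2 * k + 1 := by
    rw [Expr.cost, hs, size_enc, esize_nat]
  have := RunsTo.sampler (m := m) (src := w + 3) (dst := x) (tmp := w + 7) (by omega) (by omega)
    (by omega) K (Function.update s (w + 3) (enc k)) (t + 1 + 1 + (Expr.var (w + 2)).cost s)
    (2 * k + 1) (by rw [Function.update_self, size_enc, esize_nat])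
  rw [Function.update_self, show (enc k).toList.length = k by simp [enc, Data.toList_ofList]]
    at this
  refine this.mono ?_
  rintro c' r ⟨h3, s', t', rfl, h4, h5, h6⟩
  refine ⟨h3, s', t', rfl, h4, fun y y1 y2 y3 => ?_, ?_⟩
  · rw [h5 y y2 y3 (by omega), Function.update_of_ne y2]
  · rw [hc] at h6
    rw [show 2 * k + 2 = 2 * k + 1 + 1 by rfl]
    omega

/-- The random choices made at the beginning of a simulation. -/
abbrev SetupInput (ρ : ℕ → ℕ) : Type :=
  {x : ℕ × List Bool × List Bool × List Bool // x.2.1.length = ρ x.1 ∧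
    x.2.2.1.length = ρ x.1 ∧ x.2.2.2.length = ρ x.1}

/-- Compute the length of the input, make the random choices, compute the initial state. -/
def setupProg (clen crho csetup : ℕ → Prog) (w : ℕ) : Prog :=
  .seq (.assign (w + 2) (.var 0)) <| .seq (clen (w + 2)) <|
  .seq (.assign (w + 1) (.var (w + 2))) <| .seq (crho (w + 2)) <|
  .seq (sampleProg w (w + 4)) <| .seq (sampleProg w (w + 5)) <| .seq (sampleProg w (w + 6)) <|
  .seq (.assign (w + 7) (.pair (.var (w + 1)) (.pair (.var (w + 4)) (.pair (.var (w + 5))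
    (.var (w + 6)))))) <|
  .seq (csetup (w + 7)) (.assign w (.var (w + 7)))

/-- The continuation is a hypothesis: if for all samples of the right length the rest `K` unfolds to
`U r₁ r₂ r₃`, the whole unfolds to the three samplings followed by `U`. -/
theorem setupProg_runsTo {S β : Type} [Enc S] {ρ : ℕ → ℕ}
    {setup : ℕ → List Bool → List Bool → List Bool → S} {clen crho csetup : ℕ → Prog}
    {Pl Pr Ps : Polynomial ℕ} (hlen : Computes (List.length : List Bool → ℕ) clen Pl)
    (hrho : Computes ρ crho Pr)
    (hsetup : Computes (fun x : SetupInput ρ => setup x.1.1 x.1.2.1 x.1.2.2.1 x.1.2.2.2)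
      csetup Ps) {m w l : ℕ} (K : List Prog) {s : Store}
    (hs : s 0 = enc (List.replicate l true)) {R : Config → β → Prop}
    {U : List Bool → List Bool → List Bool → Tree β}
    (hU : ∀ r₁ r₂ r₃ s' t', r₁.length = ρ l → r₂.length = ρ l → r₃.length = ρ l →
      s' w = enc (setup l r₁ r₂ r₃) → s' (w + 1) = enc l → (∀ r < w, s' r = s r) →
      t' ≤ Pl.eval (4 * l + 1) + Pr.eval (2 * l + 1)
        + 3 * (50 * (Pr.eval (2 * l + 1) + 2) ^ 2 + Pr.eval (2 * l + 1) + 5)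
        + 5 * Ps.eval (2 * l + 10 + 12 * Pr.eval (2 * l + 1)) + 20 * l
        + 60 * Pr.eval (2 * l + 1) + 200 →
      esize (setup l r₁ r₂ r₃) ≤ Ps.eval (2 * l + 10 + 12 * Pr.eval (2 * l + 1)) →
      RunsTo m R ⟨K, s', t'⟩ (U r₁ r₂ r₃)) :
    RunsTo m R ⟨setupProg clen crho csetup w :: K, s, 1⟩
      ((Tree.flips (ρ l) []).bind fun r₁ => (Tree.flips (ρ l) []).bind fun r₂ =>
        (Tree.flips (ρ l) []).bind fun r₃ => U r₁ r₂ r₃) := by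
  have hin : esize (List.replicate l true) ≤ 4 * l + 1 := by
    simpa using esize_bits_le (List.replicate l true)
  obtain ⟨g1, g2⟩ := hlen (List.replicate l true)
  rw [List.length_replicate, esize_nat] at g1
  rw [List.length_replicate] at g2
  have hPl := polyEval_mono Pl hin
  obtain ⟨s1, n1, e1, v1, f1, t1⟩ := g2 (w + 2) (Function.update s (w + 2)
    (enc (List.replicate l true))) (by rw [Function.update_self])
  refine .seq (.assign (v := enc (List.replicate l true)) (by rw [Expr.eval, hs])
    (.seq (.of_exec e1 (.seq (.assign (v := enc l) (by rw [Expr.eval, v1]) (.seq ?_))))))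
  obtain ⟨p1, p2⟩ := hrho l
  rw [esize_nat, esize_nat] at p1
  rw [esize_nat] at p2
  obtain ⟨s2, n2, e2, v2, f2, t2⟩ := p2 (w + 2) (Function.update s1 (w + 1) (enc l))
    (by rw [Function.update_of_ne (by omega), v1])
  refine .of_exec e2 (.seq ?_)
  have a2 : s2 (w + 1) = enc l := by rw [f2 _ (by omega), Function.update_self]
  have b2 : ∀ r < w, s2 r = s r := fun r hr => by
    rw [f2 _ (by omega), Function.update_of_ne (by omega), f1 _ (by omega),
      Function.update_of_ne (by omega)]
  have k1 : (Expr.var 0).cost s ≤ 4 * l + 1 := by rw [Expr.cost, hs, size_enc]; exact hin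
  have k2 : (Expr.var (w + 2)).cost s1 = 2 * l + 1 := by rw [Expr.cost, v1, size_enc, esize_nat]
  set k := ρ l with hk
  set B := Pr.eval (2 * l + 1) with hB
  have hkB : 50 * (2 * k + 2) ^ 2 + 2 * k + 5 ≤ 50 * (B + 2) ^ 2 + B + 5 := by
    have : (2 * k + 2) ^ 2 ≤ (B + 2) ^ 2 := by gcongr; omega
    omega
  refine (sampleProg_runsTo (x := w + 4) (by omega) (by omega) _ _ v2).bind _ ?_
  rintro _ r₁ ⟨l1, s3, t3, rfl, v3, f3, u3⟩
  refine .seq ((sampleProg_runsTo (k := k) (x := w + 5) (by omega) (by omega) _ _ ?_).bind _ ?_)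
  · rw [f3 _ (by omega) (by omega) (by omega), v2]
  rintro _ r₂ ⟨l2, s4, t4, rfl, v4, f4, u4⟩
  refine .seq ((sampleProg_runsTo (k := k) (x := w + 6) (by omega) (by omega) _ _ ?_).bind _ ?_)
  · rw [f4 _ (by omega) (by omega) (by omega), f3 _ (by omega) (by omega) (by omega), v2]
  rintro _ r₃ ⟨l3, s5, t5, rfl, v5, f5, u5⟩
  have a5 : s5 (w + 1) = enc l := by
    rw [f5 _ (by omega) (by omega) (by omega), f4 _ (by omega) (by omega) (by omega),
      f3 _ (by omega) (by omega) (by omega), a2]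
  have b5 : ∀ r < w, s5 r = s r := fun r hr => by
    rw [f5 _ (by omega) (by omega) (by omega), f4 _ (by omega) (by omega) (by omega),
      f3 _ (by omega) (by omega) (by omega), b2 r hr]
  have c5 : s5 (w + 4) = enc r₁ := by
    rw [f5 _ (by omega) (by omega) (by omega), f4 _ (by omega) (by omega) (by omega), v3]
  have d5 : s5 (w + 5) = enc r₂ := by
    rw [f5 _ (by omega) (by omega) (by omega), v4]
  -- The lengths belong to the input type, because `setup` need only be polynomial on strings of the
  -- prescribed length.
  let z : SetupInput ρ := ⟨(l, r₁, r₂, r₃), l1, l2, l3⟩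
  have hz : (Expr.pair (.var (w + 1)) (.pair (.var (w + 4)) (.pair (.var (w + 5))
      (.var (w + 6))))).eval s5 = enc z := by
    simp only [Expr.eval, a5, c5, d5, v5]
    rfl
  obtain ⟨q1, q2⟩ := hsetup z
  obtain ⟨s6, n6, e6, v6, f6, u6⟩ := q2 (w + 7) (Function.update s5 (w + 7) (enc z))
    (by rw [Function.update_self])
  have m1 := esize_bits_le r₁
  have m2 := esize_bits_le r₂
  have m3 := esize_bits_le r₃
  have hz' : esize z ≤ 2 * l + 10 + 12 * B := by
    have : esize z = 1 + esize l + (1 + esize r₁ + (1 + esize r₂ + esize r₃)) := rfl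
    rw [esize_nat] at this
    omega
  have hPs := polyEval_mono Ps hz'
  have hv6 : s6 (w + 7) = enc (setup l r₁ r₂ r₃) := v6
  refine .seq (.assign hz (.seq (.of_exec e6 (.assign (v := enc (setup l r₁ r₂ r₃))
    (by rw [Expr.eval, hv6]) ?_))))
  refine hU r₁ r₂ r₃ _ _ l1 l2 l3 (by rw [Function.update_self]) ?_ (fun r hr => ?_) ?_
    (q1.trans hPs)
  · rw [Function.update_of_ne (by omega), f6 _ (by omega), Function.update_of_ne (by omega), a5]
  · rw [Function.update_of_ne (by omega), f6 _ (by omega), Function.update_of_ne (by omega),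
      b5 r hr]
  · have m4 : (Expr.pair (.var (w + 1)) (.pair (.var (w + 4)) (.pair (.var (w + 5))
        (.var (w + 6))))).cost s5 ≤ 4 * (2 * l + 10 + 12 * B) := by
      have : esize z = 1 + esize l + (1 + esize r₁ + (1 + esize r₂ + esize r₃)) := rfl
      simp only [Expr.cost, Expr.eval, a5, c5, d5, v5, Data.size, size_enc]
      omega
    have m5 : (Expr.var (w + 7)).cost s6 ≤ Ps.eval (2 * l + 10 + 12 * B) := by
      rw [Expr.cost, hv6, size_enc]
      exact q1.trans hPs
    rw [k2] at u3
    omega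

/-- Ask the last query and compute the outcome. -/
def outcomeProg (cq cout : ℕ → Prog) (w : ℕ) : Prog :=
  .seq (.assign (w + 2) (.var w)) <| .seq (cq (w + 2)) <|
  .seq (.call 0 (.var (w + 2)) (w + 3)) <| .seq (.assign (w + 4) (.pair (.var w) (.var (w + 3)))) <|
  .seq (cout (w + 4)) (.assign 0 (.var (w + 4)))

theorem outcomeProg_runsTo {S : Type} [Enc S] {M : Simulator S} {cq cout : ℕ → Prog}
    {P Q : Polynomial ℕ} (hq : Computes M.lastQuery cq P) (hout : Computes M.outcome cout Q)
    {w l Z : ℕ} {s : Store} (t : ℕ) {st : S} (hs : s w = enc st)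
    (hZ : esize st + 8 * l + 40 ≤ Z) :
    RunsTo (l + 1) (fun c' b => c'.todo = [] ∧ c'.time ≤ t + 5 * P.eval Z + 5 * Q.eval Z
        + 10 * Z + 50 ∧ (c'.store 0).toBool = b)
      ⟨[outcomeProg cq cout w], s, t⟩
      (.call 0 (Data.ofBits (M.lastQuery st)) fun z => .ret (M.outcome (st, z))) := by
  obtain ⟨g1, g2⟩ := hq st
  have hP := polyEval_mono P (show esize st ≤ Z by omega)
  obtain ⟨s1, n1, e1, v1, f1, t1⟩ := g2 (w + 2) (Function.update s (w + 2) (enc st))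
    (by rw [Function.update_self])
  refine .seq (.assign (v := enc st) (by rw [Expr.eval, hs]) (.seq (.of_exec e1 (.seq ?_))))
  have hcall : (Expr.var (w + 2)).eval s1 = Data.ofBits (M.lastQuery st) := v1
  rw [← hcall]
  refine .call rfl fun z hz => ?_
  have hzs : (Data.ofBits z).size ≤ 4 * z.length + 1 := Data.size_ofBits_le z
  simp only [Config.next]
  set s2 := Function.update s1 (w + 3) (Data.ofBits z) with hs2
  have a2 : s2 w = enc st := by
    rw [hs2, Function.update_of_ne (by omega), f1 _ (by omega), Function.update_of_ne (by omega),
      hs]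
  have b2 : s2 (w + 3) = enc z := by rw [hs2, Function.update_self]; rfl
  have hv : (Expr.pair (.var w) (.var (w + 3))).eval s2 = enc (st, z) := by
    simp only [Expr.eval, a2, b2]
    rfl
  obtain ⟨p1, p2⟩ := hout (st, z)
  have hzs' : esize z ≤ 4 * z.length + 1 := hzs
  have hQ := polyEval_mono Q (show esize (st, z) ≤ Z by rw [esize_pair]; omega)
  obtain ⟨s3, n3, e3, v3, f3, t3⟩ := p2 (w + 4) (Function.update s2 (w + 4) (enc (st, z)))
    (by rw [Function.update_self])
  refine .seq (.assign hv (.seq (.of_exec e3 (.assign (v := enc (M.outcome (st, z)))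
    (by rw [Expr.eval, v3]) (.ret ⟨rfl, ?_, ?_⟩)))))
  · have k1 : (Expr.var w).cost s = esize st := by rw [Expr.cost, hs, size_enc]
    have k2 : (Expr.var (w + 2)).cost s1 = esize (M.lastQuery st) := by
      rw [Expr.cost, v1, size_enc]
    have k3 : (Expr.pair (.var w) (.var (w + 3))).cost s2
        = 1 + 2 * esize st + 2 * esize z := by
      simp only [Expr.cost, Expr.eval, a2, b2, Data.size, size_enc]
      omega
    have k4 : (Expr.var (w + 4)).cost s3 = esize (M.outcome (st, z)) := by
      rw [Expr.cost, v3, size_enc]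
    simp only
    omega
  · simp only [Function.update_self]
    exact Data.toBool_ofBool _


theorem Tree.bind_assoc {α β γ : Type} (T : Tree α) (f : α → Tree β) (g : β → Tree γ) :
    (T.bind f).bind g = T.bind fun a => (f a).bind g := by
  induction T with
  | ret a => rfl
  | flip f ih => simp only [bind, ih]
  | call i d f ih => simp only [bind, ih]

theorem Simulator.handle_map {S α β : Type} (M : Simulator S) (l : ℕ) (g : α → β) (T : Tree α)
    (st : S) :
    M.handle l (T.map g) st = (M.handle l T st).bind fun x => .ret (g x.1, x.2) := by
  induction T generalizing st with
  | ret a => rfl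
  | flip f ih =>
    simp only [Tree.map, Tree.bind, handle] at ih ⊢
    simp only [ih]
  | call i d f ih =>
    simp only [Tree.map, Tree.bind, handle] at ih ⊢
    rw [Tree.bind_assoc]
    simp only [ih]

/-- The encoded input `1^l` has size at most `4 * l + 1`, and `Config.bounded_init` adds `2`. -/
theorem PPT.runsTo (A : PPT) (l : ℕ) :
    RunsTo (l + 1) (fun c' b => c' = b ∧ c'.todo = [] ∧ c'.time ≤ A.bound.eval l ∧
        c'.Bounded (4 * l + 3))
      (Config.init A.prog (Data.ofBits (List.replicate l true)))
      ((Config.init A.prog (Data.ofBits (List.replicate l true))).tree (A.bound.eval l)) := by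
  refine Config.runsTo_tree _ _ fun coin ans hans => ?_
  refine ⟨(A.halts l coin ans hans).1, (A.halts l coin ans hans).2,
    Config.Bounded.exec (by omega) (fun r => ?_) _ _ _⟩
  have h1 := Config.bounded_init A.prog (Data.ofBits (List.replicate l true)) r
  have h2 := Data.size_ofBits_le (List.replicate l true)
  rw [List.length_replicate] at h2
  omega

/-- A simulator that works in polynomial time turns every algorithm into another one. -/
theorem Simulator.exists_ppt (A : PPT) {S : Type} [Enc S] (M : Simulator S) (hpre : PT M.pre)
    (hpost : PT M.post) (hquery : PT M.lastQuery) (hout : PT M.outcome) {ρ : ℕ → ℕ} (hρ : PT ρ)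
    {setup : ℕ → List Bool → List Bool → List Bool → S}
    (hsetup : PT fun x : SetupInput ρ => setup x.1.1 x.1.2.1 x.1.2.2.1 x.1.2.2.2)
    (V : ℕ → S → Prop)
    (hV₀ : ∀ l r₁ r₂ r₃, r₁.length = ρ l → r₂.length = ρ l → r₃.length = ρ l →
      V l (setup l r₁ r₂ r₃)) (G : Polynomial ℕ)
    (hV : ∀ l st i d r y, V l st → r.length = l → y.length ≤ l + 1 →
      V l (M.post (st, kind i, d, r, y)).1 ∧ (M.post (st, kind i, d, r, y)).2.length ≤ l + 1 ∧
      esize (M.post (st, kind i, d, r, y)).1 ≤ esize st + G.eval (l + d.size)) :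
    ∃ D : PPT, ∀ (l : ℕ) (σ : Type) (O : Oracle σ) (W : σ → Prop),
      (∀ i d s, W s → ∀ r ∈ (O i d s).support, r.1.length ≤ l + 1 ∧ W r.2) → ∀ s, W s →
      (D.run O l s).map (fun r => r.1.toBool)
        = ((M.tree l (ρ l) (setup l) (A.tree l)).interp O s).map Prod.fst := by
  obtain ⟨cpre, P, hpre⟩ := hpre.exists_computes
  obtain ⟨cpost, Q, hpost⟩ := hpost.exists_computes
  obtain ⟨cq, P', hquery⟩ := hquery.exists_computes
  obtain ⟨cout, Q', hout⟩ := hout.exists_computes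
  obtain ⟨crho, Pr, hρ⟩ := hρ.exists_computes
  obtain ⟨csetup, Ps, hsetup⟩ := hsetup.exists_computes
  obtain ⟨clen, Pl, hlen⟩ := (PT.length (α := Bool)).exists_computes
  -- The state is stored above all registers of `A`; the `+ 1` makes sure that register `0`, with
  -- input and output, lies below it.
  set w := A.prog.width + 1 with hw
  let prog : Prog := .seq (setupProg clen crho csetup w) <|
    .seq (A.prog.translate 0 (answerProg cpre cpost w)) <|
    .seq (answerProg cpre cpost w 0 (.var 0) 0) (outcomeProg cq cout w)
  let Bin : Polynomial ℕ := Pr.comp (2 * .X + 1)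
  let Z₀ : Polynomial ℕ := Ps.comp (2 * .X + 10 + 12 * Bin)
  let Tset : Polynomial ℕ := Pl.comp (4 * .X + 1) + Bin + 3 * (50 * (Bin + 2) ^ 2 + Bin + 5)
    + 5 * Z₀ + 20 * .X + 60 * Bin + 200
  -- This bounds the running time of `A` and also the size of its output, since a register holds at
  -- most `4 * l + 3` more than the time used. The output is the argument of one further simulated
  -- query.
  let Tm : Polynomial ℕ := A.bound + 4 * .X + 4
  let Gm : Polynomial ℕ := G.comp (.X + Tm)
  let Zm : Polynomial ℕ := Z₀ + Tm * Gm + Gm + Tm + 8 * .X + 40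
  let Ca : Polynomial ℕ := (answerBound P Q).comp Zm
  let bound : Polynomial ℕ := Tset + Tm * (Ca + 1) + Tm + Ca + 5 * P'.comp Zm + 5 * Q'.comp Zm
    + 10 * Zm + 100
  have hBin : ∀ l, Bin.eval l = Pr.eval (2 * l + 1) := fun l => by simp [Bin, Polynomial.eval_comp]
  have hZ₀ : ∀ l, Z₀.eval l = Ps.eval (2 * l + 10 + 12 * Bin.eval l) := fun l => by
    simp [Z₀, Polynomial.eval_comp]
  have hTset : ∀ l, Tset.eval l = Pl.eval (4 * l + 1) + Bin.eval l
      + 3 * (50 * (Bin.eval l + 2) ^ 2 + Bin.eval l + 5) + 5 * Z₀.eval l + 20 * l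
      + 60 * Bin.eval l + 200 := fun l => by simp [Tset, Polynomial.eval_comp]
  have hTm : ∀ l, Tm.eval l = A.bound.eval l + 4 * l + 4 := fun l => by simp [Tm]
  have hGm : ∀ l, Gm.eval l = G.eval (l + Tm.eval l) := fun l => by
    simp [Gm, Polynomial.eval_comp]
  have hZm : ∀ l, Zm.eval l = Z₀.eval l + Tm.eval l * Gm.eval l + Gm.eval l + Tm.eval l + 8 * l
      + 40 := fun l => by simp [Zm]
  have hCa : ∀ l, Ca.eval l = (answerBound P Q).eval (Zm.eval l) := fun l => by
    simp [Ca, Polynomial.eval_comp]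
  have hbound : ∀ l, bound.eval l = Tset.eval l + Tm.eval l * (Ca.eval l + 1) + Tm.eval l
      + Ca.eval l + 5 * P'.eval (Zm.eval l) + 5 * Q'.eval (Zm.eval l) + 10 * Zm.eval l + 100 :=
    fun l => by simp [bound, Polynomial.eval_comp]
  -- From here on only the evaluations above are needed; as opaque terms they leave linear
  -- arithmetic.
  clear_value Bin Z₀ Tset Tm Gm Zm Ca bound
  have main : ∀ l, RunsTo (l + 1) (fun c b => c.todo = [] ∧ c.time ≤ bound.eval l ∧
      (c.store 0).toBool = b) (Config.init prog (Data.ofBits (List.replicate l true)))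
      (M.tree l (ρ l) (setup l) (A.tree l)) := by
    intro l
    refine .seq ?_
    refine setupProg_runsTo hlen hρ hsetup _ (by rw [Function.update_self]; rfl) ?_
    intro r₁ r₂ r₃ s t l₁ l₂ l₃ hs hs' hf ht hsz
    rw [← hBin] at ht hsz
    rw [← hZ₀] at ht hsz
    rw [← hTset] at ht
    rw [PPT.tree, Simulator.handle_map, Tree.bind_assoc]
    have hGe : ∀ d : Data, d.size ≤ Tm.eval l → G.eval (l + d.size) ≤ Gm.eval l := by
      intro d hd
      rw [hGm]
      exact polyEval_mono _ (by omega)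
    refine .seq (RunsTo.bind (RunsTo.simulate (M := M) (w := w) (l := l) (Tm := Tm.eval l)
      (Z₀ := Z₀.eval l) (Zm := Zm.eval l) (G := Gm.eval l) (V := V l)
      (X := fun c => (c.store 0).size ≤ Tm.eval l) hpre hpost ?_ ?_ [_] (t + 1)
      ((A.runsTo l).mono ?_) ?_ ?_ hs hs' (hV₀ l r₁ r₂ r₃ l₁ l₂ l₃) ?_ ?_) _ ?_)
    · intro st i d r y h1 h2 h3 h4
      obtain ⟨g1, g2, g3⟩ := hV l st i d r y h1 h3 h4
      exact ⟨g1, g2, g3.trans (by have := hGe d h2; omega)⟩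
    · rw [hZm]; omega
    · rintro c b ⟨rfl, h1, h2, h3⟩
      have := h3 0
      have := hTm l
      exact ⟨rfl, h1, by omega, by omega⟩
    · simp [Config.init, hw]
    · intro r hr
      rw [Nat.zero_add, hf r hr]
      rfl
    · omega
    · simp [Config.init]
    rintro _ ⟨c, st⟩ ⟨s1, t1, rfl, g1, g2, g3, g4, g5, g6, g7⟩
    simp only at g1 g2 g3 g4 g5 g6 g7
    have hs0 : s1 0 = c.store 0 := by simpa using g2 0 (by omega)
    have hZ : esize st + ((Expr.var 0).eval s1).size + 8 * l + 40 ≤ Zm.eval l := by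
      rw [Expr.eval, hs0, hZm]
      omega
    have key := answerProg_runsTo (M := M) hpre hpost (w := w) 0 (e := .var 0) (x := 0)
      (by omega) [outcomeProg cq cout w] (t1 + 1) g3 g4 hZ
    rw [Expr.eval, hs0] at key
    refine .seq (RunsTo.bind key _ ?_)
    rintro _ ⟨st', a⟩ ⟨s2, t2, r, y, rfl, h1, h2, h3, h4, h5, h6, h7, h8⟩
    obtain ⟨v1, v2, v3⟩ := hV l st 0 (c.store 0) r y g5 h1 h2
    rw [← h3] at v1 v2 v3
    have hG' := hGe _ g1
    refine (outcomeProg_runsTo hquery hout t2 h4 (Z := Zm.eval l) (by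
      rw [hZm]; simp only at v3 ⊢; omega)).mono ?_
    rintro c' b ⟨e1, e2, e3⟩
    refine ⟨e1, ?_, e3⟩
    rw [Expr.cost, hs0, ← hCa] at h8
    rw [← hCa] at g7
    have hb := hbound l
    omega
  refine ⟨⟨prog, bound, fun l coin ans hans => ?_⟩, fun l σ O W hW s hs => ?_⟩
  · obtain ⟨b, h⟩ := (main l).exec_halts (B := bound.eval l) (fun c b h => ⟨h.1, h.2.1⟩) coin ans
      hans
    exact ⟨h.1, h.2.1⟩
  · have h := (main l).map_runWith (O := O) (W := W) hW (fun c => (c.store 0).toBool) id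
      (B := bound.eval l) (fun c b h => h) s hs (bound.eval l) (by omega)
    have h2 := congrArg (PMF.map Prod.fst) h
    rw [PMF.map_comp, PMF.map_comp] at h2
    rw [PPT.run, PMF.map_comp]
    exact h2


/-! ## The simulator -/

/-- The guesses of the simulator: the `level` of the key on the path to the forged token that is
replaced by the oracle, the number `start` of the first query with the root payload of the forged
token, the number `attempt` of the query that is the forgery, and the length `depth` to which the
forged token is extended. -/
structure Guess : Type where
  level : ℕ
  start : ℕ
  attempt : ℕ
  depth : ℕ

/-- What the simulator remembers: the number of queries, the root payload guessed to be that of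
the forgery, the keys belonging to the other root payloads, the tags of the tokens issued to users,
and the forgery. -/
structure Log : Type where
  count : ℕ
  star : Option (List Bool)
  keys : List (List Bool × List Bool)
  issued : List ((List Bool × List Bool) × List Bool)
  target : Option Token

def Log.empty : Log := ⟨0, none, [], [], none⟩

instance : Enc Guess := ⟨fun g => enc (g.level, g.start, g.attempt, g.depth)⟩
instance : Enc Log := ⟨fun D => enc (D.count, D.star, D.keys, D.issued, D.target)⟩

/-- The token in a query. -/
def queryToken (k : Bool × Bool) (d : Data) : Token := Token.ofData (if k.2 = true then d.fst else d)

/-- The root payload in a query. -/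
def queryRoot (k : Bool × Bool) (d : Data) : List Bool :=
  if k.1 = true then d.fst.toBits else (queryToken k d).msg.root

/-- The command in a query. -/
def queryCmd (d : Data) : List Bool := d.snd.toBits

namespace Log

/-- The guessed root payload after a query with root payload `p`. -/
def mark (D : Log) (g : Guess) (p : List Bool) : Option (List Bool) :=
  if (!D.star.isSome && (decide (D.count = g.start) && !(look p D.keys).isSome)) = true
  then some p else D.star

def tick (D : Log) (g : Guess) (p : List Bool) : Log :=
  ⟨D.count + 1, D.mark g p, D.keys, D.issued, D.target⟩

/-- The tag issued to the user from whose token the given one may be derived. -/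
def cover (D : Log) (m : Message) : Option (List Bool) :=
  match m.cmds.head? with
  | none => none
  | some c => look (m.root, c) D.issued

/-- A command that has not been issued to a user. -/
def fresh (D : Log) : List Bool := D.issued.flatMap (fun x => x.1.2) ++ [true]

/-- Commands to be added to a token to reach a given length. -/
def padding (D : Log) (g : Guess) (r : Token) : List (List Bool) :=
  (List.replicate g.depth D.fresh).drop r.msg.cmds.length

def padded (D : Log) (g : Guess) (r : Token) : List (List Bool) := r.msg.cmds ++ D.padding g r

def newKeys (D : Log) (g : Guess) (p r y : List Bool) : List (List Bool × List Bool) :=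
  if (decide (D.mark g p = some p) || (look p D.keys).isSome) = true then D.keys
  else (p, if decide (g.level = 0) = true then y else r) :: D.keys

end Log

section simulator

variable (hmac : List Bool → List Bool → List Bool)

/-- The tag for a user, given fresh random bits and an answer of the oracle. -/
def newTag (g : Guess) (D : Log) (p c r y : List Bool) : List Bool :=
  -- For the guessed root the oracle is the key at level `1`, so its answer is the tag; at higher
  -- levels that key has already been replaced and the tag is random. In the remaining cases the key
  -- of the root is known and is applied honestly.
  if (!decide (g.level = 0) && decide (D.mark g p = some p)) = true then
    if decide (g.level = 1) = true then y else r
  else hmac (if decide (g.level = 0) = true then y else (look p D.keys).getD r) (encode ⟨p, [c]⟩)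

/-- Issue a token to a user. -/
def simIssue (g : Guess) (D : Log) (p c r y : List Bool) : (Guess × Log) × List Bool :=
  match look (p, c) D.issued with
  | some t => ((g, D.tick g p), t)
  | none => ((g, ⟨D.count + 1, D.mark g p, D.newKeys g p r y,
      ((p, c), newTag hmac g D p c r y) :: D.issued, D.target⟩), newTag hmac g D p c r y)

/-- Validity of a token derived from one with tag `t` that was issued to a user. -/
def validFrom (t : List Bool) (r : Token) : Bool :=
  decide (chainFrom hmac r.msg.root t (r.msg.cmds.take 1) r.msg.cmds.tail = r.tag)

/-- Verify a token, or extend it by a command. -/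
def simCheck (g : Guess) (D : Log) (serv : Bool) (r : Token) (c : List Bool) :
    (Guess × Log) × List Bool :=
  match D.cover r.msg with
  | none =>
      ((g, ⟨D.count + 1, D.mark g r.msg.root, D.keys, D.issued,
        if (decide (D.count = g.attempt) && decide (D.mark g r.msg.root = some r.msg.root)) = true
        then some r else D.target⟩), if serv = true then [] else [false])
  | some t => ((g, D.tick g r.msg.root),
      if serv = true then
        if validFrom hmac t r = true then hmac r.tag (encode ⟨r.msg.root, r.msg.cmds ++ [c]⟩)
        else []
      else [validFrom hmac t r])

/-- The simulator. -/
def simulator : Simulator (Guess × Log) where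
  pre x :=
    if (x.1.2.target.isSome || (!decide (x.2.1 = (true, false)) ||
      (look (queryRoot x.2.1 x.2.2, queryCmd x.2.2) x.1.2.issued).isSome)) = true then none
    else if decide (x.1.1.level = 0) = true then some (queryRoot x.2.1 x.2.2)
    else if (decide (x.1.1.level = 1) && decide (x.1.2.mark x.1.1 (queryRoot x.2.1 x.2.2)
        = some (queryRoot x.2.1 x.2.2))) = true
      then some (encode ⟨queryRoot x.2.1 x.2.2, [queryCmd x.2.2]⟩)
    else none
  post x :=
    if (x.1.2.target.isSome || (x.2.1.1 && x.2.1.2)) = true then (x.1, [])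
    else if x.2.1.1 = true then
      simIssue hmac x.1.1 x.1.2 (queryRoot x.2.1 x.2.2.1) (queryCmd x.2.2.1) x.2.2.2.1 x.2.2.2.2
    else simCheck hmac x.1.1 x.1.2 x.2.1.2 (queryToken x.2.1 x.2.2.1) (queryCmd x.2.2.1)
  lastQuery x :=
    match x.2.target with
    | none => []
    | some r => if decide (x.1.level = 0) = true then r.msg.root
        else encode ⟨r.msg.root, (x.2.padded x.1 r).take x.1.level⟩
  outcome x :=
    match x.1.2.target with
    | none => false
    | some r => decide ((x.1.2.padded x.1.1 r).length = x.1.1.depth) &&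
        decide (chainFrom hmac r.msg.root x.2 ((x.1.2.padded x.1.1 r).take x.1.1.level)
            ((x.1.2.padded x.1.1 r).drop x.1.1.level)
          = chainFrom hmac r.msg.root r.tag r.msg.cmds (x.1.2.padding x.1.1 r))

end simulator

/-! ### The simulator works in polynomial time -/

namespace PT

variable {α : Type} [Enc α]

theorem level : PT Guess.level :=
  fst.comp (of_enc (f := fun g : Guess => (g.level, g.start, g.attempt, g.depth)) fun _ => rfl)

theorem start : PT Guess.start :=
  (fst.comp snd).comp
    (of_enc (f := fun g : Guess => (g.level, g.start, g.attempt, g.depth)) fun _ => rfl)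

theorem attempt : PT Guess.attempt :=
  (fst.comp (snd.comp snd)).comp
    (of_enc (f := fun g : Guess => (g.level, g.start, g.attempt, g.depth)) fun _ => rfl)

theorem depth : PT Guess.depth :=
  (snd.comp (snd.comp snd)).comp
    (of_enc (f := fun g : Guess => (g.level, g.start, g.attempt, g.depth)) fun _ => rfl)

theorem guess {a b c d : α → ℕ} (ha : PT a) (hb : PT b) (hc : PT c) (hd : PT d) :
    PT fun x => Guess.mk (a x) (b x) (c x) (d x) :=
  (of_enc (f := fun x : ℕ × ℕ × ℕ × ℕ => Guess.mk x.1 x.2.1 x.2.2.1 x.2.2.2) fun _ => rfl).comp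
    (ha.pair (hb.pair (hc.pair hd)))

theorem logTuple : PT fun D : Log => (D.count, D.star, D.keys, D.issued, D.target) :=
  of_enc fun _ => rfl

theorem count : PT Log.count := fst.comp logTuple

theorem star : PT Log.star := (fst.comp snd).comp logTuple

theorem keys : PT Log.keys := (fst.comp (snd.comp snd)).comp logTuple

theorem issued : PT Log.issued := (fst.comp (snd.comp (snd.comp snd))).comp logTuple

theorem target : PT Log.target := (snd.comp (snd.comp (snd.comp snd))).comp logTuple

theorem log {a : α → ℕ} {b : α → Option (List Bool)} {c : α → List (List Bool × List Bool)}
    {d : α → List ((List Bool × List Bool) × List Bool)} {e : α → Option Token}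
    (ha : PT a) (hb : PT b) (hc : PT c) (hd : PT d) (he : PT e) :
    PT fun x => Log.mk (a x) (b x) (c x) (d x) (e x) :=
  (of_enc (f := fun x : ℕ × Option (List Bool) × List (List Bool × List Bool) ×
      List ((List Bool × List Bool) × List Bool) × Option Token =>
    Log.mk x.1 x.2.1 x.2.2.1 x.2.2.2.1 x.2.2.2.2) fun _ => rfl).comp
    (ha.pair (hb.pair (hc.pair (hd.pair he))))

theorem eqNat {f g : α → ℕ} (hf : PT f) (hg : PT g) : PT fun x => decide (f x = g x) :=
  eq enc_injective_nat hf hg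

theorem eqOpt {f g : α → Option (List Bool)} (hf : PT f) (hg : PT g) :
    PT fun x => decide (f x = g x) :=
  eq (enc_injective_option enc_injective_bits) hf hg

variable {k : α → Bool × Bool} {d : α → Data} {g : α → Guess} {D : α → Log}
  {p c r y : α → List Bool} {t : α → Token} {hmac : List Bool → List Bool → List Bool}

theorem queryToken (hk : PT k) (hd : PT d) : PT fun x => queryToken (k x) (d x) :=
  tokenOfData.comp (ite (snd.comp hk) (dataFst.comp hd) hd)

theorem queryRoot (hk : PT k) (hd : PT d) : PT fun x => queryRoot (k x) (d x) :=
  ite (fst.comp hk) (toBits.comp (dataFst.comp hd)) (root.comp (msg.comp (queryToken hk hd)))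

theorem queryCmd (hd : PT d) : PT fun x => queryCmd (d x) := toBits.comp (dataSnd.comp hd)

theorem mark (hD : PT D) (hg : PT g) (hp : PT p) : PT fun x => (D x).mark (g x) (p x) :=
  ite (and (not (isSome.comp (star.comp hD))) (and (eqNat (count.comp hD) (start.comp hg))
    (not (isSome.comp (look enc_injective_bits hp (keys.comp hD)))))) (PT.some.comp hp)
    (star.comp hD)

theorem tick (hD : PT D) (hg : PT g) (hp : PT p) : PT fun x => (D x).tick (g x) (p x) :=
  log (succ.comp (count.comp hD)) (mark hD hg hp) (keys.comp hD) (issued.comp hD) (target.comp hD)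

theorem cover {m : α → Message} (hD : PT D) (hm : PT m) : PT fun x => (D x).cover (m x) :=
  (option_elim (head?.comp (cmds.comp hm)) (const none)
    (look (enc_injective_prod enc_injective_bits enc_injective_bits)
      (pair (root.comp (hm.comp fst)) snd) (issued.comp (hD.comp fst)))).congr fun x => by
    rw [Log.cover]
    cases (m x).cmds.head? <;> rfl

theorem fresh : PT Log.fresh :=
  append (flatMap (f := Log.issued) (g := fun y => y.2.1.2) issued (snd.comp (fst.comp snd)))
    (const _)

theorem padding (hD : PT D) (hg : PT g) (ht : PT t) : PT fun x => (D x).padding (g x) (t x) :=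
  drop (length.comp (cmds.comp (msg.comp ht))) (replicate (depth.comp hg) (fresh.comp hD))

theorem padded (hD : PT D) (hg : PT g) (ht : PT t) : PT fun x => (D x).padded (g x) (t x) :=
  append (cmds.comp (msg.comp ht)) (padding hD hg ht)

theorem newKeys (hD : PT D) (hg : PT g) (hp : PT p) (hr : PT r) (hy : PT y) :
    PT fun x => (D x).newKeys (g x) (p x) (r x) (y x) :=
  ite (or (eqOpt (mark hD hg hp) (PT.some.comp hp))
      (isSome.comp (look enc_injective_bits hp (keys.comp hD)))) (keys.comp hD)
    (cons (pair hp (ite (eqNat (level.comp hg) (const _)) hy hr)) (keys.comp hD))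

theorem newTag (hm : PT fun x : List Bool × List Bool => hmac x.1 x.2) (hg : PT g) (hD : PT D)
    (hp : PT p) (hc : PT c) (hr : PT r) (hy : PT y) :
    PT fun x => newTag hmac (g x) (D x) (p x) (c x) (r x) (y x) :=
  ite (and (not (eqNat (level.comp hg) (const _))) (eqOpt (mark hD hg hp) (PT.some.comp hp)))
    (ite (eqNat (level.comp hg) (const _)) hy hr)
    (hm.comp₂ (ite (eqNat (level.comp hg) (const _)) hy
      (getD (look enc_injective_bits hp (keys.comp hD)) hr))
      (encode.comp (message hp (cons hc (const _)))))

theorem simIssue (hm : PT fun x : List Bool × List Bool => hmac x.1 x.2) (hg : PT g) (hD : PT D)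
    (hp : PT p) (hc : PT c) (hr : PT r) (hy : PT y) :
    PT fun x => simIssue hmac (g x) (D x) (p x) (c x) (r x) (y x) :=
  have ht := newTag hm hg hD hp hc hr hy
  (option_elim (look (enc_injective_prod enc_injective_bits enc_injective_bits) (pair hp hc)
      (issued.comp hD))
    (pair (pair hg (log (succ.comp (count.comp hD)) (mark hD hg hp) (newKeys hD hg hp hr hy)
      (cons (pair (pair hp hc) ht) (issued.comp hD)) (target.comp hD))) ht)
    (pair ((pair hg (tick hD hg hp)).comp fst) snd)).congr fun x => by
      rw [RAF.simIssue]
      cases RAF.look (p x, c x) (D x).issued <;> rfl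

theorem validFrom (hl : ∀ k m, (hmac k m).length = k.length)
    (hm : PT fun x : List Bool × List Bool => hmac x.1 x.2) (hp : PT p) (ht : PT t) :
    PT fun x => validFrom hmac (p x) (t x) :=
  eq enc_injective_bits (PT.chainFrom hl hm (root.comp (msg.comp ht)) hp
    (take (const 1) (cmds.comp (msg.comp ht))) (tail.comp (cmds.comp (msg.comp ht))))
    (tag.comp ht)

theorem simCheck (hl : ∀ k m, (hmac k m).length = k.length)
    (hm : PT fun x : List Bool × List Bool => hmac x.1 x.2) (hg : PT g) (hD : PT D)
    {s : α → Bool} (hs : PT s) (ht : PT t) (hc : PT c) :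
    PT fun x => simCheck hmac (g x) (D x) (s x) (t x) (c x) :=
  have hp := root.comp (msg.comp ht)
  have hv := validFrom hl hm snd (ht.comp fst)
  (option_elim (cover hD (msg.comp ht))
    (pair (pair hg (log (succ.comp (count.comp hD)) (mark hD hg hp) (keys.comp hD)
      (issued.comp hD) (ite (and (eqNat (count.comp hD) (attempt.comp hg))
        (eqOpt (mark hD hg hp) (PT.some.comp hp))) (PT.some.comp ht) (target.comp hD))))
      (ite hs (const _) (const _)))
    (pair ((pair hg (tick hD hg hp)).comp fst) (ite (hs.comp fst)
      (ite hv ((hm.comp₂ (tag.comp ht) (encode.comp (message hp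
        (append (cmds.comp (msg.comp ht)) (cons hc (const _)))))).comp fst) (const _))
      (cons hv (const _))))).congr fun x => by
      rw [RAF.simCheck]
      cases Log.cover (D x) (t x).msg <;> rfl

theorem simulator_pre : PT (simulator hmac).pre :=
  have hk := fst.comp (snd (α := Guess × Log) (β := (Bool × Bool) × Data))
  have hd := snd.comp (snd (α := Guess × Log) (β := (Bool × Bool) × Data))
  have hg := fst.comp (fst (α := Guess × Log) (β := (Bool × Bool) × Data))
  have hD := snd.comp (fst (α := Guess × Log) (β := (Bool × Bool) × Data))
  have hp := queryRoot hk hd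
  ite (or (isSome.comp (target.comp hD))
      (or (not (eq (enc_injective_prod enc_injective_bool enc_injective_bool) hk (const _)))
        (isSome.comp (look (enc_injective_prod enc_injective_bits enc_injective_bits)
          (pair hp (queryCmd hd)) (issued.comp hD))))) (const _)
    (ite (eqNat (level.comp hg) (const _)) (PT.some.comp hp)
      (ite (and (eqNat (level.comp hg) (const _)) (eqOpt (mark hD hg hp) (PT.some.comp hp)))
        (PT.some.comp (encode.comp (message hp (cons (queryCmd hd) (const _))))) (const _)))

theorem simulator_post (hl : ∀ k m, (hmac k m).length = k.length)
    (hm : PT fun x : List Bool × List Bool => hmac x.1 x.2) : PT (simulator hmac).post := by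
  have h2 := snd (α := Guess × Log) (β := (Bool × Bool) × Data × List Bool × List Bool)
  have h1 := fst (α := Guess × Log) (β := (Bool × Bool) × Data × List Bool × List Bool)
  have hk := fst.comp h2
  have hd := fst.comp (snd.comp h2)
  have hr := fst.comp (snd.comp (snd.comp h2))
  have hy := snd.comp (snd.comp (snd.comp h2))
  have hg := fst.comp h1
  have hD := snd.comp h1
  exact ite (or (isSome.comp (target.comp hD)) (and (fst.comp hk) (snd.comp hk)))
    (pair h1 (const _)) (ite (fst.comp hk)
      (simIssue hm hg hD (queryRoot hk hd) (queryCmd hd) hr hy)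
      (simCheck hl hm hg hD (snd.comp hk) (queryToken hk hd) (queryCmd hd)))

theorem simulator_lastQuery : PT (simulator hmac).lastQuery :=
  (option_elim (f := fun x : Guess × Log => x.2.target)
    (h := fun x : (Guess × Log) × Token => if decide (x.1.1.level = 0) = true then x.2.msg.root
      else RAF.encode ⟨x.2.msg.root, (x.1.2.padded x.1.1 x.2).take x.1.1.level⟩)
    (target.comp snd) (const [])
    (ite (eqNat (level.comp (fst.comp fst)) (const _)) (root.comp (msg.comp snd))
      (encode.comp (message (root.comp (msg.comp snd)) (take (level.comp (fst.comp fst))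
        (padded (snd.comp fst) (fst.comp fst) snd)))))).congr fun x => by
    simp only [simulator]
    cases x.2.target <;> rfl

theorem simulator_outcome (hl : ∀ k m, (hmac k m).length = k.length)
    (hm : PT fun x : List Bool × List Bool => hmac x.1 x.2) : PT (simulator hmac).outcome := by
  have hD := snd.comp (fst.comp (fst (α := (Guess × Log) × List Bool) (β := Token)))
  have hg := fst.comp (fst.comp (fst (α := (Guess × Log) × List Bool) (β := Token)))
  have hy := snd.comp (fst (α := (Guess × Log) × List Bool) (β := Token))
  have ht := snd (α := (Guess × Log) × List Bool) (β := Token)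
  refine (option_elim (f := fun x : (Guess × Log) × List Bool => x.1.2.target)
    (target.comp (snd.comp fst)) (const false)
    (and (eqNat (length.comp (padded hD hg ht)) (depth.comp hg))
      (eq enc_injective_bits (PT.chainFrom hl hm (root.comp (msg.comp ht)) hy
          (take (level.comp hg) (padded hD hg ht)) (drop (level.comp hg) (padded hD hg ht)))
        (PT.chainFrom hl hm (root.comp (msg.comp ht)) (tag.comp ht) (cmds.comp (msg.comp ht))
          (padding hD hg ht))))).congr fun x => ?_
  simp only [simulator]
  cases x.1.2.target <;> rfl

end PT


/-! ### The size of the simulator's state -/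

/-- The strings stored in the log have at most `n` bits. -/
def Log.Short (n : ℕ) (D : Log) : Prop :=
  (∀ x ∈ D.keys, x.2.length ≤ n) ∧ ∀ x ∈ D.issued, x.2.length ≤ n

section short

variable {hmac : List Bool → List Bool → List Bool}

theorem length_newTag_le (hl : ∀ k m, (hmac k m).length = k.length) {n : ℕ} {D : Log}
    (hD : D.Short n) {r y : List Bool} (hr : r.length ≤ n) (hy : y.length ≤ n) (g : Guess)
    (p c : List Bool) : (newTag hmac g D p c r y).length ≤ n := by
  have hk : ((look p D.keys).getD r).length ≤ n := by
    cases h : look p D.keys with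
    | none => exact hr
    | some v => exact hD.1 _ (look_eq_some_mem h)
  rw [newTag]
  split_ifs
  · exact hy
  · exact hr
  · rw [hl]; exact hy
  · rw [hl]; exact hk

theorem Log.Short.newKeys {n : ℕ} {D : Log} (hD : D.Short n) {r y : List Bool}
    (hr : r.length ≤ n) (hy : y.length ≤ n) (g : Guess) (p : List Bool) :
    ∀ x ∈ D.newKeys g p r y, x.2.length ≤ n := by
  rw [Log.newKeys]
  split_ifs
  · exact hD.1
  · exact List.forall_mem_cons.2 ⟨hy, hD.1⟩
  · exact List.forall_mem_cons.2 ⟨hr, hD.1⟩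

theorem Log.length_le_of_cover {n : ℕ} {D : Log} (hD : D.Short n) {m : Message} {t : List Bool}
    (h : D.cover m = some t) : t.length ≤ n := by
  rw [Log.cover] at h
  cases hm : m.cmds.head? with
  | none => simp [hm] at h
  | some c =>
    rw [hm] at h
    exact hD.2 _ (look_eq_some_mem h)

/-- Tags are samples, oracle answers or `hmac` values under stored keys. In an extension the key is
the tag submitted by the algorithm, which could be long; but it is used only after verification has
shown it to be a chain value. `hn` leaves room for the one-bit answers of `Ver`. -/
theorem simulator_post_short (hl : ∀ k m, (hmac k m).length = k.length) {n : ℕ} (hn : 1 ≤ n)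
    {st : Guess × Log} (hst : st.2.Short n) (k : Bool × Bool) (d : Data) {r y : List Bool}
    (hr : r.length ≤ n) (hy : y.length ≤ n) :
    ((simulator hmac).post (st, k, d, r, y)).1.2.Short n ∧
      ((simulator hmac).post (st, k, d, r, y)).2.length ≤ n := by
  simp only [simulator]
  split_ifs
  · exact ⟨hst, Nat.zero_le _⟩
  · have ht := length_newTag_le hl hst hr hy st.1 (queryRoot k d) (queryCmd d)
    rw [simIssue]
    cases h : look (queryRoot k d, queryCmd d) st.2.issued with
    | some t => exact ⟨hst, hst.2 _ (look_eq_some_mem h)⟩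
    | none =>
      exact ⟨⟨hst.newKeys hr hy _ _, List.forall_mem_cons.2 ⟨ht, hst.2⟩⟩, ht⟩
  · rw [simCheck]
    cases h : st.2.cover (queryToken k d).msg with
    | none =>
      refine ⟨hst, ?_⟩
      simp only
      split_ifs <;> simp [hn]
    | some t =>
      have ht := Log.length_le_of_cover hst h
      refine ⟨hst, ?_⟩
      simp only
      split_ifs with h1 h2
      · rw [validFrom, decide_eq_true_eq] at h2
        rw [hl, ← h2, length_chainFrom hl]
        exact ht
      · exact Nat.zero_le _
      · simp [hn]

theorem esize_log (D : Log) : esize D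
    = 1 + esize D.count + (1 + esize D.star + (1 + esize D.keys + (1 + esize D.issued
      + esize D.target))) := rfl

theorem esize_mark_le (D : Log) (g : Guess) (p : List Bool) :
    esize (D.mark g p) ≤ esize D.star + 2 + esize p := by
  rw [Log.mark]
  split_ifs
  · rw [esize_some]; omega
  · omega

theorem esize_newKeys_le (D : Log) (g : Guess) (p r y : List Bool) :
    esize (D.newKeys g p r y) ≤ esize D.keys + 2 + esize p + esize r + esize y := by
  rw [Log.newKeys]
  split_ifs
  · omega
  · rw [esize_cons, esize_pair]; omega
  · rw [esize_cons, esize_pair]; omega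

/-- The growth depends on the query and on `l`, not on the state, so it adds up over the queries
instead of multiplying. A query adds at most a root, a key, an issued tag and a target. -/
theorem simulator_growth (hl : ∀ k m, (hmac k m).length = k.length) :
    ∃ G : Polynomial ℕ, ∀ (l : ℕ) (st : Guess × Log) (i : ℕ) (d : Data) (r y : List Bool),
      st.2.Short (l + 1) → r.length = l → y.length ≤ l + 1 →
      ((simulator hmac).post (st, kind i, d, r, y)).1.2.Short (l + 1) ∧
      ((simulator hmac).post (st, kind i, d, r, y)).2.length ≤ l + 1 ∧
      esize ((simulator hmac).post (st, kind i, d, r, y)).1 ≤ esize st + G.eval (l + d.size) := by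
  obtain ⟨P, hP⟩ := (PT.queryRoot (PT.fst (α := Bool × Bool) (β := Data)) PT.snd).esize_le
  obtain ⟨Q, hQ⟩ := (PT.queryCmd PT.snd (α := (Bool × Bool) × Data)).esize_le
  obtain ⟨R, hR⟩ := (PT.queryToken (PT.fst (α := Bool × Bool) (β := Data)) PT.snd).esize_le
  obtain ⟨R', hR'⟩ := (PT.root.comp (PT.msg.comp (PT.queryToken
    (PT.fst (α := Bool × Bool) (β := Data)) PT.snd))).esize_le
  refine ⟨3 * P.comp (.X + 8) + Q.comp (.X + 8) + R.comp (.X + 8) + R'.comp (.X + 8) + 12 * .X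
    + 40, fun l st i d r y hst hr hy => ?_⟩
  have hs := simulator_post_short hl (n := l + 1) (by omega) hst (kind i) d
    (show r.length ≤ l + 1 by omega) hy
  refine ⟨hs.1, hs.2, ?_⟩
  have hk := esize_kind i
  have hsz : esize (kind i, d) ≤ l + d.size + 8 := by
    rw [esize_pair]
    have : esize d = d.size := rfl
    omega
  have h1 := (hP (kind i, d)).trans (polyEval_mono P hsz)
  have h2 := (hQ (kind i, d)).trans (polyEval_mono Q hsz)
  have h3 := (hR (kind i, d)).trans (polyEval_mono R hsz)
  have h4 := (hR' (kind i, d)).trans (polyEval_mono R' hsz)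
  simp only at h1 h2 h3 h4
  have hr' := esize_bits_le r
  have hy' := esize_bits_le y
  have ht := esize_bits_le (newTag hmac st.1 st.2 (queryRoot (kind i) d) (queryCmd d) r y)
  have htl := length_newTag_le hl hst (show r.length ≤ l + 1 by omega) hy st.1
    (queryRoot (kind i) d) (queryCmd d)
  have hm := esize_mark_le st.2 st.1 (queryRoot (kind i) d)
  have hm' := esize_mark_le st.2 st.1 (queryToken (kind i) d).msg.root
  have hk' := esize_newKeys_le st.2 st.1 (queryRoot (kind i) d) r y
  have hst2 : esize st = 1 + esize st.1 + esize st.2 := rfl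
  simp only [Polynomial.eval_add, Polynomial.eval_mul, Polynomial.eval_comp, Polynomial.eval_X,
    Polynomial.eval_ofNat]
  rw [hst2, esize_log]
  have hc : esize st.2.count = 2 * st.2.count + 1 := esize_nat _
  simp only [simulator]
  split_ifs
  · rw [hst2, esize_log]; omega
  · rw [simIssue]
    cases look (queryRoot (kind i) d, queryCmd d) st.2.issued with
    | some t =>
      simp only [esize_pair, esize_log, Log.tick, esize_nat] at *
      omega
    | none =>
      simp only [esize_pair, esize_log, esize_nat, esize_cons] at *
      omega
  · rw [simCheck]
    cases st.2.cover (queryToken (kind i) d).msg with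
    | some t =>
      simp only [esize_pair, esize_log, Log.tick, esize_nat] at *
      omega
    | none =>
      have hif : ∀ b : Bool, esize (if b = true then some (queryToken (kind i) d)
          else st.2.target) ≤ esize st.2.target + 2 + esize (queryToken (kind i) d) := by
        intro b
        split_ifs
        · rw [esize_some]; omega
        · omega
      have := hif (decide (st.2.count = st.1.attempt) &&
        decide (st.2.mark st.1 (queryToken (kind i) d).msg.root
          = some (queryToken (kind i) d).msg.root))
      simp only [esize_pair, esize_log, esize_nat] at *
      omega

end short

/-! ### The random choices of the simulator -/

/-- The number with the given binary digits, the most significant first. -/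
def bitsValue (r : List Bool) : ℕ := r.foldl (fun v b => 2 * v + b.toNat) 0

theorem bitsValue_append (r : List Bool) (b : Bool) :
    bitsValue (r ++ [b]) = 2 * bitsValue r + b.toNat := by
  simp [bitsValue]

theorem bitsValue_lt (r : List Bool) : bitsValue r < 2 ^ r.length := by
  induction r using List.reverseRecOn with
  | nil => simp [bitsValue]
  | append_singleton r b ih =>
    rw [bitsValue_append, List.length_append, List.length_singleton, pow_succ]
    have := b.toNat_lt
    omega

theorem bitsValue_replicate (n : ℕ) : bitsValue (List.replicate n true) = 2 ^ n - 1 := by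
  induction n with
  | zero => rfl
  | succ n ih =>
    rw [List.replicate_succ', bitsValue_append, ih, pow_succ]
    have := Nat.one_le_two_pow (n := n)
    simp only [Bool.toNat_true]
    omega

/-- A step of a counter: the number of steps, a power of two above it, and its exponent. -/
def counterStep (x : ℕ × ℕ × ℕ) : ℕ × ℕ × ℕ :=
  if decide (x.1 + 1 = x.2.1) = true then (x.1 + 1, x.2.1 + x.2.1, x.2.2 + 1)
  else (x.1 + 1, x.2.1, x.2.2)

def counter (n : ℕ) : ℕ × ℕ × ℕ := counterStep^[n] (0, 1, 0)

theorem counter_spec (n : ℕ) : (counter n).1 = n ∧ (counter n).2.1 = 2 ^ (counter n).2.2 ∧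
    n < (counter n).2.1 ∧ (counter n).2.1 ≤ 2 * n + 1 := by
  induction n with
  | zero => simp [counter]
  | succ n ih =>
    obtain ⟨h1, h2, h3, h4⟩ := ih
    rw [counter, Function.iterate_succ_apply', ← counter, counterStep]
    split_ifs with h
    · rw [decide_eq_true_eq] at h
      refine ⟨by simp [h1], ?_, ?_, ?_⟩
      · simp only [pow_succ]; omega
      · simp only; omega
      · simp only; omega
    · rw [decide_eq_true_eq] at h
      exact ⟨by simp [h1], h2, by simp only; omega, by simp only; omega⟩

/-- The number of random bits for a guess. -/
def guessBits (a l : ℕ) : ℕ := a * (counter (l + 2)).2.2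

theorem two_pow_guessBits (a l : ℕ) : 2 ^ guessBits a l = (counter (l + 2)).2.1 ^ a := by
  rw [(counter_spec _).2.1, guessBits, ← pow_mul, mul_comm]

theorem pow_le_two_pow_guessBits (a l : ℕ) : (l + 2) ^ a ≤ 2 ^ guessBits a l := by
  rw [two_pow_guessBits]
  exact Nat.pow_le_pow_left (counter_spec _).2.2.1.le _

theorem two_pow_guessBits_le (a l : ℕ) : 2 ^ guessBits a l ≤ (2 * l + 5) ^ a := by
  rw [two_pow_guessBits]
  exact Nat.pow_le_pow_left ((counter_spec _).2.2.2.trans (by omega)) _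

/-- With base `l + 2 ≥ 2` a pure power also dominates constants, by `c < 2 ^ c`, and one more factor
absorbs a sum. -/
theorem polyEval_le_pow (P : Polynomial ℕ) : ∃ a, ∀ l, P.eval l ≤ (l + 2) ^ a := by
  induction P using Polynomial.induction_on' with
  | add P Q hP hQ =>
    obtain ⟨a, ha⟩ := hP
    obtain ⟨b, hb⟩ := hQ
    refine ⟨max a b + 1, fun l => ?_⟩
    have h1 := (ha l).trans (Nat.pow_le_pow_right (by omega) (le_max_left a b))
    have h2 := (hb l).trans (Nat.pow_le_pow_right (by omega) (le_max_right a b))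
    rw [Polynomial.eval_add, pow_succ]
    nlinarith [Nat.zero_le (l * (l + 2) ^ max a b)]
  | monomial n c =>
    refine ⟨c + n, fun l => ?_⟩
    rw [Polynomial.eval_monomial, pow_add]
    exact Nat.mul_le_mul (Nat.lt_two_pow_self.le.trans (Nat.pow_le_pow_left (by omega) _))
      (Nat.pow_le_pow_left (by omega) _)

/-- The initial state of the simulator. -/
def simSetup (k : ℕ) (r₁ r₂ r₃ : List Bool) : Guess × Log :=
  (⟨bitsValue r₁, bitsValue r₂, bitsValue r₃, bitsValue (List.replicate k true)⟩, Log.empty)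

namespace PT

variable {α : Type} [Enc α]

theorem add {f g : α → ℕ} (hf : PT f) (hg : PT g) : PT fun x => f x + g x :=
  (length.comp (append (units.comp hf) (units.comp hg))).congr fun x => by simp

theorem const_mul (a : ℕ) {f : α → ℕ} (hf : PT f) : PT fun x => a * f x := by
  induction a with
  | zero => exact (const 0).congr fun x => by simp
  | succ a ih => exact (add ih hf).congr fun x => by ring

/-- Numbers are encoded in unary, so evaluating binary digits is feasible only for strings of
logarithmic length; this is what `hB` expresses. -/
theorem bitsValue {f : α → List Bool} (hf : PT f) (B : Polynomial ℕ)
    (hB : ∀ x, 2 ^ (f x).length ≤ B.eval (esize x)) : PT fun x => bitsValue (f x) := by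
  refine (foldl (f := f) (i := fun _ => 0)
    (g := fun y : α × ℕ × Bool => y.2.1 + y.2.1 + if y.2.2 = true then 1 else 0) hf (const 0)
    (add (add (fst.comp snd) (fst.comp snd)) (ite (snd.comp snd) (const 1) (const 0)))
    (2 * B) ?_).congr fun x => ?_
  · intro x l hl
    have h : l.foldl (fun (b : ℕ) (a : Bool) => b + b + if a = true then 1 else 0) 0
        = RAF.bitsValue l := by
      rw [RAF.bitsValue]
      congr 1
      ext b a
      cases a <;> simp <;> omega
    simp only [h, esize_nat, Polynomial.eval_mul, Polynomial.eval_ofNat]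
    have h1 := bitsValue_lt l
    have h2 := (Nat.pow_le_pow_right (by omega : 0 < 2) hl.length_le).trans (hB x)
    omega
  · rw [RAF.bitsValue]
    congr 1
    ext b a
    cases a <;> simp <;> omega

theorem counter {f : α → ℕ} (hf : PT f) : PT fun x => counter (f x) := by
  have hstep : PT counterStep :=
    ite (eqNat (succ.comp fst) (fst.comp snd))
      (pair (succ.comp fst) (pair (add (fst.comp snd) (fst.comp snd)) (succ.comp (snd.comp snd))))
      (pair (succ.comp fst) (pair (fst.comp snd) (snd.comp snd)))
  obtain ⟨F, hF⟩ := hf.esize_le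
  refine (foldl (f := fun x => List.replicate (f x) ()) (i := fun _ => ((0, 1, 0) : ℕ × ℕ × ℕ))
    (g := fun y => counterStep y.2.1) (units.comp hf) (const _)
    (hstep.comp (fst.comp snd)) (10 * F + 10) ?_).congr fun x => ?_
  · intro x u hu
    have h1 := hu.length_le
    rw [List.length_replicate] at h1
    obtain ⟨a1, a2, a3, a4⟩ := counter_spec u.length
    have h2 := hF x
    rw [esize_nat] at h2
    have h3 := (Nat.lt_two_pow_self (n := (RAF.counter u.length).2.2))
    simp only [List.foldl_const]
    rw [← RAF.counter]
    have h4 : esize (RAF.counter u.length) = 1 + esize (RAF.counter u.length).1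
      + (1 + esize (RAF.counter u.length).2.1 + esize (RAF.counter u.length).2.2) := rfl
    simp only [h4, esize_nat, Polynomial.eval_add, Polynomial.eval_mul,
      Polynomial.eval_ofNat]
    omega
  · simp only [List.foldl_const]
    simp [RAF.counter]

theorem guessBits (a : ℕ) : PT (guessBits a) :=
  const_mul a (snd.comp (snd.comp (counter (succ.comp succ))))

theorem simSetup (a : ℕ) : PT fun x : SetupInput (RAF.guessBits a) =>
    simSetup (RAF.guessBits a x.1.1) x.1.2.1 x.1.2.2.1 x.1.2.2.2 := by
  have hx : PT fun x : SetupInput (RAF.guessBits a) => x.1 := of_enc fun _ => rfl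
  have key : ∀ f : SetupInput (RAF.guessBits a) → List Bool, PT f →
      (∀ x, (f x).length = RAF.guessBits a x.1.1) → PT fun x => RAF.bitsValue (f x) := by
    intro f hf h
    refine bitsValue hf ((2 * .X + 5) ^ a) fun x => ?_
    rw [h]
    refine (two_pow_guessBits_le a _).trans ?_
    have h1 : esize x = 1 + esize x.1.1 + esize x.1.2 := rfl
    rw [esize_nat] at h1
    simp only [Polynomial.eval_pow, Polynomial.eval_add, Polynomial.eval_mul, Polynomial.eval_ofNat,
      Polynomial.eval_X]
    exact Nat.pow_le_pow_left (by omega) _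
  exact pair (guess (key _ (fst.comp (snd.comp hx)) fun x => x.2.1)
    (key _ (fst.comp (snd.comp (snd.comp hx))) fun x => x.2.2.1)
    (key _ (snd.comp (snd.comp (snd.comp hx))) fun x => x.2.2.2)
    (key _ (replicate ((guessBits a).comp (fst.comp hx)) (const true)) fun x => by simp))
    (const _)

end PT


/-! ## Games with a simulator -/

/-- Ask a last query about the output. -/
def Tree.closed (T : Tree Data) : Tree Unit := T.bind fun d => .call 0 d fun _ => .ret ()

namespace Simulator

variable {S σ : Type} (M : Simulator S)

/-- The simulated oracle as an oracle. -/
noncomputable def respond (O : Oracle σ) (l : ℕ) : Oracle (S × σ) := fun i d x =>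
  ((M.answer l x.1 i d).interp O x.2).map fun r => (r.1.2, (r.1.1, r.2))

/-- The last query of the simulator itself and the outcome. -/
noncomputable def last (O : Oracle σ) (x : S × σ) : PMF Bool :=
  (O 0 (Data.ofBits (M.lastQuery x.1)) x.2).bind fun y => PMF.pure (M.outcome (x.1, y.1))

noncomputable def game (O : Oracle σ) (l : ℕ) (T : Tree Data) (x : S × σ) : PMF Bool :=
  (T.closed.interp (M.respond O l) x).bind fun z => M.last O z.2

variable {M} {O : Oracle σ} {l : ℕ}

theorem respond_of_none {i : ℕ} {d : Data} {st : S} {s : σ} (h : M.pre (st, kind i, d) = none) :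
    M.respond O l i d (st, s) = (uniformBits l).bind fun r =>
      PMF.pure ((M.post (st, kind i, d, r, [])).2, (M.post (st, kind i, d, r, [])).1, s) := by
  simp only [respond, answer, h, Tree.interp_bind, Tree.interp_flips, Tree.interp, List.append_nil,
    PMF.bind_map, PMF.map_bind, PMF.pure_map, Function.comp_def]

theorem respond_of_some {i : ℕ} {d : Data} {st : S} {s : σ} {q : List Bool}
    (h : M.pre (st, kind i, d) = some q) :
    M.respond O l i d (st, s) = (uniformBits l).bind fun r =>
      (O 0 (Data.ofBits q) s).bind fun y => PMF.pure
        ((M.post (st, kind i, d, r, y.1)).2, (M.post (st, kind i, d, r, y.1)).1, y.2) := by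
  simp only [respond, answer, h, Tree.interp_bind, Tree.interp_flips, Tree.interp, List.append_nil,
    PMF.bind_map, PMF.map_bind, PMF.pure_map, Function.comp_def]

/-- Answers simulated inside the tree amount to an oracle whose state includes that of the
simulator. In this form two games on the same tree differ only in their oracles and in the final
test. -/
theorem interp_handle_finish (T : Tree Data) (st : S) (s : σ) :
    (((M.handle l T st).bind (M.finish l)).interp O s).map Prod.fst = M.game O l T (st, s) := by
  induction T generalizing st s with
  | ret d =>
    simp only [handle, Tree.bind, finish, game, Tree.closed, Tree.interp, respond, last,
      Tree.interp_bind, PMF.bind_map, PMF.map_bind, PMF.pure_map, PMF.bind_bind, PMF.pure_bind,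
      Function.comp_def]
  | flip f ih =>
    simp only [game, Tree.closed] at ih ⊢
    simp only [handle, Tree.bind, Tree.interp, PMF.map_bind, PMF.bind_bind, ih]
  | call i d f ih =>
    simp only [game, Tree.closed] at ih ⊢
    simp only [handle, Tree.bind, Tree.interp, Tree.bind_assoc, Tree.interp_bind O (M.answer l st i d),
      PMF.map_bind, PMF.bind_bind, PMF.bind_map, ih, respond, Function.comp_def]

theorem interp_tree (k : ℕ) (setup : List Bool → List Bool → List Bool → S) (T : Tree Data)
    (s : σ) : ((M.tree l k setup T).interp O s).map Prod.fst
      = (uniformBits k).bind fun r₁ => (uniformBits k).bind fun r₂ => (uniformBits k).bind fun r₃ =>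
        M.game O l T (setup r₁ r₂ r₃, s) := by
  simp only [tree, Tree.interp_bind O (Tree.flips k []), Tree.interp_flips, List.append_nil,
    PMF.bind_map, PMF.map_bind, Function.comp_def, interp_handle_finish]

end Simulator

/-! ### Coupling the states of two oracles -/

section transport

variable {σ τ α : Type}

theorem Tree.invariant {O : Oracle σ} {I : σ → Prop}
    (hI : ∀ i d s, I s → ∀ r ∈ (O i d s).support, I r.2) (T : Tree α) {s : σ} (hs : I s) :
    ∀ r ∈ (T.interp O s).support, I r.2 := by
  induction T generalizing s with
  | ret a => simpa [interp] using hs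
  | flip f ih =>
    intro r hr
    rw [interp, PMF.mem_support_bind_iff] at hr
    obtain ⟨b, _, hr⟩ := hr
    exact ih b hs r hr
  | call i d f ih =>
    intro r hr
    rw [interp, PMF.mem_support_bind_iff] at hr
    obtain ⟨b, hb, hr⟩ := hr
    exact ih b.1 (hI i d s hs b hb) r hr

theorem pmf_bind_congr {β γ : Type} {p : PMF β} {f g : β → PMF γ}
    (h : ∀ a ∈ p.support, f a = g a) : p.bind f = p.bind g := by
  ext b
  rw [PMF.bind_apply, PMF.bind_apply]
  refine tsum_congr fun a => ?_
  by_cases ha : p a = 0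
  · simp [ha]
  · rw [h a ha]

/-- A randomized change of the oracle state that commutes with the answers of two oracles
commutes with every computation. -/
theorem Tree.interp_transport {O₁ : Oracle σ} {O₂ : Oracle τ} {I : σ → Prop} {κ : σ → PMF τ}
    (hI : ∀ i d s, I s → ∀ r ∈ (O₁ i d s).support, I r.2)
    (h : ∀ i d s, I s → ((O₁ i d s).bind fun r => (κ r.2).bind fun t => PMF.pure (r.1, t))
      = (κ s).bind (O₂ i d)) (T : Tree α) {s : σ} (hs : I s) :
    ((T.interp O₁ s).bind fun r => (κ r.2).bind fun t => PMF.pure (r.1, t))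
      = (κ s).bind (T.interp O₂) := by
  induction T generalizing s with
  | ret a => simp only [interp, PMF.pure_bind]
  | flip f ih =>
    simp only [interp, PMF.bind_bind, ih _ hs]
    exact PMF.bind_comm _ _ _
  | call i d f ih =>
    simp only [interp, PMF.bind_bind]
    rw [pmf_bind_congr fun r hr => ih r.1 (hI i d s hs r hr)]
    have := congrArg (fun p => p.bind fun r => (f r.1).interp O₂ r.2) (h i d s hs)
    simpa only [PMF.bind_bind, PMF.pure_bind] using this

/-- This is the form in which hops are proved: if `κ` is compatible with every single answer and
with the final test, the outcomes agree, however the queries are chosen. -/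
theorem Simulator.game_transport {S : Type} {M : Simulator S} {O₁ : Oracle σ} {O₂ : Oracle τ}
    {l : ℕ} {I : S × σ → Prop} {κ : S × σ → PMF (S × τ)}
    (hI : ∀ i d s, I s → ∀ r ∈ (M.respond O₁ l i d s).support, I r.2)
    (h : ∀ i d s, I s → ((M.respond O₁ l i d s).bind fun r => (κ r.2).bind fun t =>
      PMF.pure (r.1, t)) = (κ s).bind (M.respond O₂ l i d))
    (hlast : ∀ s, I s → M.last O₁ s = (κ s).bind (M.last O₂)) (T : Tree Data) {s : S × σ}
    (hs : I s) : M.game O₁ l T s = (κ s).bind (M.game O₂ l T) := by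
  have key := congrArg (fun p => p.bind fun r => M.last O₂ r.2)
    (Tree.interp_transport hI h T.closed hs)
  simp only [PMF.bind_bind, PMF.pure_bind] at key
  rw [game, pmf_bind_congr fun r hr => hlast r.2 (Tree.invariant hI T.closed hs r hr), key]
  rfl

theorem pmf_bind_apply_le {β γ : Type} {p : PMF β} {f : β → PMF γ} {b : γ} {C : ENNReal}
    (h : ∀ a ∈ p.support, f a b ≤ C) : p.bind f b ≤ C := by
  rw [PMF.bind_apply]
  calc ∑' a, p a * f a b ≤ ∑' a, p a * C := by
        refine ENNReal.tsum_le_tsum fun a => ?_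
        by_cases ha : p a = 0
        · simp [ha]
        · gcongr
          exact h a ha
    _ = C := by rw [ENNReal.tsum_mul_right, p.tsum_coe, one_mul]

/-- The states of two oracles may be related by a function. -/
theorem Tree.interp_map {O₁ : Oracle σ} {O₂ : Oracle τ} (f : σ → τ)
    (h : ∀ i d s, O₂ i d (f s) = (O₁ i d s).bind fun r => PMF.pure (r.1, f r.2)) (T : Tree α)
    (s : σ) : T.interp O₂ (f s) = (T.interp O₁ s).bind fun r => PMF.pure (r.1, f r.2) := by
  have := Tree.interp_transport (I := fun _ => True) (κ := fun s => PMF.pure (f s))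
    (O₁ := O₁) (O₂ := O₂) (fun _ _ _ _ _ _ => trivial)
    (fun i d s _ => by simp only [PMF.pure_bind, h]) T (s := s) trivial
  simpa only [PMF.pure_bind] using this.symm

end transport

/-! ### Oracles -/

theorem randomOracle_of_some {l i : ℕ} {q v : List Bool} {tbl : List Bool → Option (List Bool)}
    (h : tbl q = some v) : randomOracle l i (Data.ofBits q) tbl = PMF.pure (v, tbl) := by
  simp only [randomOracle, Data.toBits_ofBits, h]

theorem randomOracle_of_none {l i : ℕ} {q : List Bool} {tbl : List Bool → Option (List Bool)}
    (h : tbl q = none) : randomOracle l i (Data.ofBits q) tbl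
      = (uniformBits l).bind fun y => PMF.pure (y, Function.update tbl q (some y)) := by
  simp only [randomOracle, Data.toBits_ofBits, h]
  rfl

/-- The oracle `F k` for a key `k` stored as its state. -/
noncomputable def keyOracle (F : List Bool → List Bool → List Bool) : Oracle (List Bool) :=
  fun _ d k => PMF.pure (F k d.toBits, k)

theorem keyOracle_ofBits (F : List Bool → List Bool → List Bool) (i : ℕ) (q k : List Bool) :
    keyOracle F i (Data.ofBits q) k = PMF.pure (F k q, k) := by
  simp only [keyOracle, Data.toBits_ofBits]

theorem uniformBits_apply_le (l : ℕ) (v : List Bool) : uniformBits l v ≤ (2 ^ l)⁻¹ := by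
  rw [uniformBits, PMF.map_apply]
  by_cases h : ∃ f : Fin l → Bool, v = List.ofFn f
  · obtain ⟨f, rfl⟩ := h
    simp only [List.ofFn_injective.eq_iff]
    simp
  · push Not at h
    simp [h]

/-! ### Encodings of messages -/

/-- Each `true` announces another bit and `false` ends the field, so a field can be read off from
the front. -/
theorem field_append_inj {x y u v : List Bool} (h : field x ++ u = field y ++ v) :
    x = y ∧ u = v := by
  induction x generalizing y with
  | nil =>
    cases y with
    | nil => simpa [field] using h
    | cons b y => simp [field] at h
  | cons a x ih =>
    cases y with
    | nil => simp [field] at h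
    | cons b y =>
      have h' : a = b ∧ field x ++ u = field y ++ v := by simpa [field] using h
      obtain ⟨rfl, rfl⟩ := ih h'.2
      exact ⟨by rw [h'.1], rfl⟩

theorem encode_injective {m m' : Message} (h : encode m = encode m') : m = m' := by
  have key : ∀ u v : List (List Bool), u.flatMap field = v.flatMap field → u = v := by
    intro u
    induction u with
    | nil =>
      intro v hv
      cases v with
      | nil => rfl
      | cons b v => simp [field] at hv
    | cons a u ih =>
      intro v hv
      cases v with
      | nil => simp [field] at hv
      | cons b v =>
        obtain ⟨rfl, h⟩ := field_append_inj (by simpa using hv)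
        rw [ih v h]
  obtain ⟨p, c⟩ := m
  obtain ⟨p', c'⟩ := m'
  have := key _ _ h
  simp only [List.cons.injEq] at this
  rw [this.1, this.2]


/-! ## Replacing the keys along the path to the forgery -/

section hops

/-- Pass to the next key on the path. -/
def bump (st : Guess × Log) : Guess × Log :=
  (⟨st.1.level + 1, st.1.start, st.1.attempt, st.1.depth⟩, st.2)

/-- A query that leads to a new token for a user. -/
def IsNew (st : Guess × Log) (k : Bool × Bool) (d : Data) : Prop :=
  st.2.target = none ∧ k = (true, false) ∧ look (queryRoot k d, queryCmd d) st.2.issued = none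

/-- The condition on `keys` makes the hop at the root possible: when a root is singled out, the
random function is still undefined there. -/
theorem Log.mark_cases (D : Log) (g : Guess) (p : List Bool) :
    D.mark g p = D.star ∨ D.star = none ∧ look p D.keys = none ∧ D.mark g p = some p := by
  rw [Log.mark]
  split_ifs with h
  · simp only [Bool.and_eq_true, Bool.not_eq_true', Option.isSome_eq_false_iff,
      Option.isNone_iff_eq_none] at h
    exact .inr ⟨h.1, h.2.2, rfl⟩
  · exact .inl rfl

variable {hmac : List Bool → List Bool → List Bool} {st : Guess × Log} {k : Bool × Bool} {d : Data}

theorem simulator_pre_of_not_new (h : ¬ IsNew st k d) :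
    (simulator hmac).pre (st, k, d) = none := by
  simp only [simulator]
  rw [if_pos]
  by_contra hc
  simp only [Bool.or_eq_true, not_or, Bool.not_eq_true, Bool.not_eq_false',
    Option.isSome_eq_false_iff, Option.isNone_iff_eq_none, decide_eq_true_eq] at hc
  exact h hc

theorem simulator_pre_of_new (h : IsNew st k d) :
    (simulator hmac).pre (st, k, d) =
      if st.1.level = 0 then some (queryRoot k d)
      else if st.1.level = 1 ∧ st.2.mark st.1 (queryRoot k d) = some (queryRoot k d)
        then some (encode ⟨queryRoot k d, [queryCmd d]⟩)
      else none := by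
  obtain ⟨h1, h2, h3⟩ := h
  simp [simulator, h1, h2, h2 ▸ h3]

theorem simulator_post_of_new (h : IsNew st k d) (r y : List Bool) :
    (simulator hmac).post (st, k, d, r, y) =
      ((st.1, ⟨st.2.count + 1, st.2.mark st.1 (queryRoot k d),
        st.2.newKeys st.1 (queryRoot k d) r y, ((queryRoot k d, queryCmd d),
          newTag hmac st.1 st.2 (queryRoot k d) (queryCmd d) r y) :: st.2.issued, none⟩),
        newTag hmac st.1 st.2 (queryRoot k d) (queryCmd d) r y) := by
  obtain ⟨h1, rfl, h3⟩ := h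
  simp only [simulator, h1]
  simp [simIssue, h3, h1]

/-- Fresh randomness and the oracle enter only into tokens newly issued to users; the rest is
answered from the log. Hence only `IsNew` queries need attention in a hop. -/
theorem simulator_post_of_not_new (h : ¬ IsNew st k d) (r y : List Bool) :
    (simulator hmac).post (st, k, d, r, y) = (simulator hmac).post (st, k, d, [], []) := by
  simp only [simulator]
  split_ifs with h1 h2
  · rfl
  · simp only [h2, Bool.true_and, Bool.or_eq_true, not_or, Bool.not_eq_true,
      Option.isSome_eq_false_iff, Option.isNone_iff_eq_none] at h1
    cases hl : look (queryRoot k d, queryCmd d) st.2.issued with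
    | none => exact absurd ⟨h1.1, Prod.ext h2 h1.2, hl⟩ h
    | some t => simp only [simIssue, hl]
  · rfl

theorem simulator_post_bump (h : ¬ IsNew st k d) (r y : List Bool) :
    (simulator hmac).post (bump st, k, d, r, y)
      = (bump ((simulator hmac).post (st, k, d, r, y)).1,
        ((simulator hmac).post (st, k, d, r, y)).2) := by
  have hd : (RAF.bump st).2 = st.2 := rfl
  simp only [simulator, hd]
  by_cases h1 : (st.2.target.isSome || (k.1 && k.2)) = true
  · simp only [h1, if_true]
  by_cases h2 : k.1 = true
  · simp only [h2, Bool.true_and, Bool.or_eq_true, not_or, Bool.not_eq_true,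
      Option.isSome_eq_false_iff, Option.isNone_iff_eq_none] at h1
    cases hl : look (queryRoot k d, queryCmd d) st.2.issued with
    | none => exact absurd ⟨h1.1, Prod.ext h2 h1.2, hl⟩ h
    | some t =>
      simp only [h1.1, h1.2, h2, simIssue, hl, Option.isSome_none, Bool.and_false, Bool.or_false,
        Bool.false_eq_true, if_false, if_true]
      rfl
  · simp only [if_neg h1, if_neg h2]
    cases hc : st.2.cover (queryToken k d).msg with
    | none =>
      simp only [simCheck, hc]
      rfl
    | some t =>
      simp only [simCheck, hc]
      rfl

/-- The effect on the state of a query that does not lead to a new token for a user. -/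
theorem simulator_post_state (h : ¬ IsNew st k d) (r y : List Bool) {st' : Guess × Log}
    (hst' : ((simulator hmac).post (st, k, d, r, y)).1 = st') :
    st' = st ∨ st'.1 = st.1 ∧ st.2.target = none ∧ st'.2.keys = st.2.keys ∧
      st'.2.issued = st.2.issued ∧ (st'.2.star = st.2.star ∨
        ∃ p, st.2.star = none ∧ look p st.2.keys = none ∧ st'.2.star = some p) ∧
      ∀ r, st'.2.target = some r → st'.2.star = some r.msg.root ∧ st'.2.cover r.msg = none := by
  subst hst'
  have hmark : ∀ p, st.2.mark st.1 p = st.2.star ∨ ∃ q, st.2.star = none ∧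
      look q st.2.keys = none ∧ st.2.mark st.1 p = some q :=
    fun p => (st.2.mark_cases st.1 p).imp_right fun h => ⟨p, h⟩
  simp only [simulator]
  split_ifs with h1 h2
  · exact .inl rfl
  all_goals
    simp only [Bool.or_eq_true, not_or, Bool.not_eq_true, Bool.and_eq_false_imp,
      Option.isSome_eq_false_iff, Option.isNone_iff_eq_none] at h1
  · cases hl : look (queryRoot k d, queryCmd d) st.2.issued with
    | none => exact absurd ⟨h1.1, Prod.ext h2 (h1.2 h2), hl⟩ h
    | some t =>
      rw [simIssue, hl]
      exact .inr ⟨rfl, h1.1, rfl, rfl, hmark _, fun r hr => by simp [Log.tick, h1.1] at hr⟩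
  · cases hc : st.2.cover (queryToken k d).msg with
    | some t =>
      rw [simCheck, hc]
      exact .inr ⟨rfl, h1.1, rfl, rfl, hmark _, fun r hr => by simp [Log.tick, h1.1] at hr⟩
    | none =>
      rw [simCheck, hc]
      refine .inr ⟨rfl, h1.1, rfl, rfl, hmark _, fun r hr => ?_⟩
      simp only at hr
      split_ifs at hr with h3
      · simp only [Bool.and_eq_true, decide_eq_true_eq] at h3
        obtain rfl := Option.some.inj hr
        exact ⟨h3.2, hc⟩
      · rw [h1.1] at hr
        cases hr

theorem chainFrom_take_drop (p h : List Bool) {e : ℕ} {cs : List (List Bool)} (he : e < cs.length) :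
    chainFrom hmac p h (cs.take e) (cs.drop e)
      = chainFrom hmac p (hmac h (encode ⟨p, cs.take (e + 1)⟩)) (cs.take (e + 1))
        (cs.drop (e + 1)) := by
  rw [List.drop_eq_getElem_cons he, chainFrom, List.take_succ_eq_append_getElem he]

/-- Applying the key `h` to the message with `level + 1` commands and chaining on from there is the
same as chaining from `h` one level earlier. If the padded length is wrong, both outcomes are
`false`. -/
theorem simulator_outcome_bump (hd : st.1.level < st.1.depth) (h : List Bool) :
    (simulator hmac).outcome (bump st, hmac h ((simulator hmac).lastQuery (bump st)))
      = (simulator hmac).outcome (st, h) := by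
  cases hr : st.2.target with
  | none =>
    have hr' : (bump st).2.target = none := hr
    simp only [simulator, hr, hr']
  | some r =>
    have hr' : (bump st).2.target = some r := hr
    simp only [simulator, hr, hr']
    change (decide ((st.2.padded st.1 r).length = st.1.depth) && _) = _
    by_cases hl : (st.2.padded st.1 r).length = st.1.depth
    · rw [chainFrom_take_drop r.msg.root h (hd.trans_eq hl.symm)]
      rfl
    · simp [hl]

theorem simulator_outcome_none (h : st.2.target = none) (z : List Bool) :
    (simulator hmac).outcome (st, z) = false := by
  simp only [simulator, h]

theorem simulator_outcome_of_length {r : Token} (h : st.2.target = some r)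
    (hl : (st.2.padded st.1 r).length ≠ st.1.depth) (z : List Bool) :
    (simulator hmac).outcome (st, z) = false := by
  simp only [simulator, h]
  simp [hl]

theorem pmf_bind_const {α β : Type} (p : PMF α) (q : PMF β) : (p.bind fun _ => q) = q :=
  PMF.bind_const p q

/-- The distribution of the key that takes the place of the value of the random function at the
guessed root payload. -/
noncomputable def keyDist (l : ℕ) (star : Option (List Bool))
    (tbl : List Bool → Option (List Bool)) : PMF (List Bool) :=
  match star.bind tbl with
  | some v => PMF.pure v
  | none => uniformBits l

theorem keyDist_none {l : ℕ} {tbl : List Bool → Option (List Bool)} :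
    keyDist l none tbl = uniformBits l := rfl

theorem keyDist_some_none {l : ℕ} {p : List Bool} {tbl : List Bool → Option (List Bool)}
    (h : tbl p = none) : keyDist l (some p) tbl = uniformBits l := by
  simp [keyDist, h]

theorem keyDist_some_some {l : ℕ} {p v : List Bool} {tbl : List Bool → Option (List Bool)}
    (h : tbl p = some v) : keyDist l (some p) tbl = PMF.pure v := by
  simp [keyDist, h]

/-- The invariant of the game in which the root key is replaced by a random function. -/
structure RootInv (N : ℕ) (x : (Guess × Log) × (List Bool → Option (List Bool))) : Prop where
  level : x.1.1.level = 0
  depth : x.1.1.depth = N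
  table : ∀ p, x.1.2.star ≠ some p → x.2 p = look p x.1.2.keys
  target : ∀ r, x.1.2.target = some r → x.1.2.star = some r.msg.root

/-- Marking a root does not change the distribution of the next key: the random function is
undefined at a newly marked root, so the key is uniform before and after. -/
theorem RootInv.of_not_new {N : ℕ} {tbl : List Bool → Option (List Bool)}
    (hI : RootInv N (st, tbl)) (h : ¬ IsNew st k d) :
    RootInv N (((simulator hmac).post (st, k, d, [], [])).1, tbl) ∧
      ∀ l, keyDist l ((simulator hmac).post (st, k, d, [], [])).1.2.star tbl
        = keyDist l st.2.star tbl := by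
  obtain ⟨i1, i2, i3, i4⟩ := hI
  rcases simulator_post_state h [] [] rfl with h1 | ⟨h1, h2, h3, h4, h5, h6⟩
  · rw [h1]
    exact ⟨⟨i1, i2, i3, i4⟩, fun _ => rfl⟩
  · refine ⟨⟨by rw [h1]; exact i1, by rw [h1]; exact i2, fun p hp => ?_,
      fun r hr => (h6 r hr).1⟩, fun l => ?_⟩
    · simp only at hp ⊢
      rw [h3]
      refine i3 p fun hp' => hp ?_
      simp only at hp'
      rcases h5 with h5 | ⟨q, h5, _, _⟩
      · rw [h5, hp']
      · simp [h5] at hp'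
    · rcases h5 with h5 | ⟨q, h5, h5', h5''⟩
      · rw [h5]
      · rw [h5, h5'', keyDist_none, keyDist_some_none]
        exact (i3 q (by simp [h5])).trans h5'

theorem respond_of_not_new {σ : Type} {O : Oracle σ} {l i : ℕ} {s : σ}
    (h : ¬ IsNew st (kind i) d) : (simulator hmac).respond O l i d (st, s) = PMF.pure
      (((simulator hmac).post (st, kind i, d, [], [])).2,
        ((simulator hmac).post (st, kind i, d, [], [])).1, s) := by
  rw [Simulator.respond_of_none (simulator_pre_of_not_new h)]
  rw [show (fun r => PMF.pure (((simulator hmac).post (st, kind i, d, r, [])).2,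
    ((simulator hmac).post (st, kind i, d, r, [])).1, s)) = fun _ => PMF.pure
      (((simulator hmac).post (st, kind i, d, [], [])).2,
        ((simulator hmac).post (st, kind i, d, [], [])).1, s) from
    funext fun r => by rw [simulator_post_of_not_new h r []], pmf_bind_const]

theorem not_isNew_bump (h : ¬ IsNew st k d) : ¬ IsNew (RAF.bump st) k d := h

end hops


/-! ### The root key as a random function -/

section hops

variable {hmac : List Bool → List Bool → List Bool} {st : Guess × Log} {k : Bool × Bool} {d : Data}

/-- The state after a new token for a user has been issued. -/
def issue (st : Guess × Log) (p c r t : List Bool) : Guess × Log :=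
  (st.1, ⟨st.2.count + 1, st.2.mark st.1 p, st.2.newKeys st.1 p r r, ((p, c), t) :: st.2.issued,
    none⟩)

theorem newKeys_bump (p r : List Bool) :
    st.2.newKeys (bump st).1 p r r = st.2.newKeys st.1 p r r := by
  simp only [Log.newKeys, ite_self]
  rfl

theorem bump_issue (p c r t : List Bool) : bump (issue st p c r t) = issue (bump st) p c r t := by
  have : (bump st).2 = st.2 := rfl
  simp only [issue, this, newKeys_bump]
  rfl

theorem newKeys_of_mark {p : List Bool} (h : st.2.mark st.1 p = some p) (r y : List Bool) :
    st.2.newKeys st.1 p r y = st.2.keys := by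
  simp [Log.newKeys, h]

theorem newKeys_of_look {p v : List Bool} (h : look p st.2.keys = some v) (r y : List Bool) :
    st.2.newKeys st.1 p r y = st.2.keys := by
  simp [Log.newKeys, h]

theorem newKeys_of_none {p : List Bool} (h : st.2.mark st.1 p ≠ some p)
    (h' : look p st.2.keys = none) (r : List Bool) :
    st.2.newKeys st.1 p r r = (p, r) :: st.2.keys := by
  simp [Log.newKeys, h, h']

theorem issue_of_mark {p : List Bool} (h : st.2.mark st.1 p = some p) (c r r' t : List Bool) :
    issue st p c r t = issue st p c r' t := by
  simp only [issue, newKeys_of_mark h]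

theorem issue_of_look {p v : List Bool} (h : look p st.2.keys = some v) (c r r' t : List Bool) :
    issue st p c r t = issue st p c r' t := by
  simp only [issue, newKeys_of_look h]

variable {σ : Type} {O : Oracle σ} {l i : ℕ} {s : σ}

theorem respond_root (h : IsNew st (kind i) d) (h0 : st.1.level = 0) :
    (simulator hmac).respond O l i d (st, s)
      = (O 0 (Data.ofBits (queryRoot (kind i) d)) s).bind fun y => PMF.pure
        (hmac y.1 (encode ⟨queryRoot (kind i) d, [queryCmd d]⟩),
          issue st (queryRoot (kind i) d) (queryCmd d) y.1
            (hmac y.1 (encode ⟨queryRoot (kind i) d, [queryCmd d]⟩)), y.2) := by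
  rw [Simulator.respond_of_some (by rw [simulator_pre_of_new h, if_pos h0])]
  simp only [simulator_post_of_new h, newTag, Log.newKeys, h0, issue, decide_true, Bool.not_true,
    Bool.false_and, Bool.false_eq_true, if_false, if_true, pmf_bind_const]

theorem respond_star (h : IsNew st (kind i) d) (h1 : st.1.level = 1)
    (hm : st.2.mark st.1 (queryRoot (kind i) d) = some (queryRoot (kind i) d)) :
    (simulator hmac).respond O l i d (st, s)
      = (O 0 (Data.ofBits (encode ⟨queryRoot (kind i) d, [queryCmd d]⟩)) s).bind fun y => PMF.pure
        (y.1, issue st (queryRoot (kind i) d) (queryCmd d) y.1 y.1, y.2) := by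
  rw [Simulator.respond_of_some (by
    rw [simulator_pre_of_new h, if_neg (by omega), if_pos ⟨h1, hm⟩])]
  simp only [simulator_post_of_new h, newTag, newKeys_of_mark hm, h1, issue, hm, decide_true,
    one_ne_zero, decide_false, Bool.not_false, Bool.and_self, if_true, pmf_bind_const]

theorem respond_inner (h : IsNew st (kind i) d) (h2 : 2 ≤ st.1.level)
    (hm : st.2.mark st.1 (queryRoot (kind i) d) = some (queryRoot (kind i) d)) :
    (simulator hmac).respond O l i d (st, s) = (uniformBits l).bind fun r => PMF.pure
      (r, issue st (queryRoot (kind i) d) (queryCmd d) r r, s) := by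
  rw [Simulator.respond_of_none (by
    rw [simulator_pre_of_new h, if_neg (by omega), if_neg (by omega)])]
  have e0 : st.1.level ≠ 0 := by omega
  have e1 : st.1.level ≠ 1 := by omega
  simp only [simulator_post_of_new h, newTag, newKeys_of_mark hm, e0, e1, issue, hm, decide_true,
    decide_false, Bool.not_false, Bool.and_self, if_true, Bool.false_eq_true, if_false]

theorem respond_other (h : IsNew st (kind i) d) (h0 : st.1.level ≠ 0)
    (hm : st.2.mark st.1 (queryRoot (kind i) d) ≠ some (queryRoot (kind i) d)) :
    (simulator hmac).respond O l i d (st, s) = (uniformBits l).bind fun r => PMF.pure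
      (hmac ((look (queryRoot (kind i) d) st.2.keys).getD r)
          (encode ⟨queryRoot (kind i) d, [queryCmd d]⟩),
        issue st (queryRoot (kind i) d) (queryCmd d) r
          (hmac ((look (queryRoot (kind i) d) st.2.keys).getD r)
            (encode ⟨queryRoot (kind i) d, [queryCmd d]⟩)), s) := by
  rw [Simulator.respond_of_none (by
    rw [simulator_pre_of_new h, if_neg h0, if_neg (by tauto)])]
  simp only [simulator_post_of_new h, newTag, Log.newKeys, h0, issue, hm,
    decide_false, Bool.and_false, Bool.false_eq_true, if_false]

theorem mark_eq_star {p : List Bool} (hm : st.2.mark st.1 p ≠ some p) :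
    st.2.mark st.1 p = st.2.star :=
  (st.2.mark_cases st.1 p).resolve_right fun h => hm h.2.2

/-- At the guessed root the value of the random function is the key of the next level, drawn when
first needed on one side and beforehand on the other. At other roots the table agrees with the
stored keys, and a new value is a fresh sample in both games. -/
theorem RootInv.of_new {N : ℕ} {tbl : List Bool → Option (List Bool)}
    (hI : RootInv N (st, tbl)) (h : IsNew st (kind i) d) :
    (∀ r ∈ ((simulator hmac).respond (randomOracle l) l i d (st, tbl)).support, RootInv N r.2) ∧
    (((simulator hmac).respond (randomOracle l) l i d (st, tbl)).bind fun r =>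
        (keyDist l r.2.1.2.star r.2.2).bind fun k => PMF.pure (r.1, bump r.2.1, k))
      = (keyDist l st.2.star tbl).bind fun k =>
        (simulator hmac).respond (keyOracle hmac) l i d (bump st, k) := by
  obtain ⟨i1, i2, i3, i4⟩ := hI
  simp only at i1 i2 i3 i4
  have h' : IsNew (bump st) (kind i) d := h
  have hlev : (bump st).1.level = 1 := by rw [← Nat.zero_add 1, ← i1]; rfl
  rw [respond_root h i1]
  set p := queryRoot (kind i) d with hp
  set c := queryCmd d with hc
  have inv : ∀ (y : List Bool) (tbl' : List Bool → Option (List Bool)) (t : List Bool),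
      (∀ q, st.2.mark st.1 p ≠ some q → tbl' q = look q (st.2.newKeys st.1 p y y)) →
      RootInv N (issue st p c y t, tbl') := fun y tbl' t hy =>
    ⟨i1, i2, hy, fun r hr => by cases hr⟩
  by_cases hm : st.2.mark st.1 p = some p
  · have h2 : ∀ k, (simulator hmac).respond (keyOracle hmac) l i d (bump st, k)
        = PMF.pure (hmac k (encode ⟨p, [c]⟩), bump (issue st p c k (hmac k (encode ⟨p, [c]⟩))),
          k) := fun k => by
      rw [respond_star h' hlev hm, keyOracle_ofBits, PMF.pure_bind, bump_issue,
        issue_of_mark (show (bump st).2.mark (bump st).1 p = some p from hm) c _ k]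
    simp only [h2]
    have hs : ∀ q, st.2.mark st.1 p ≠ some q → st.2.star ≠ some q := fun q hq hq' => by
      rcases st.2.mark_cases st.1 p with h1 | h1
      · exact hq (h1.trans hq')
      · rw [h1.1] at hq'; cases hq'
    have hstar : ∀ y t, (issue st p c y t).2.star = some p := fun _ _ => hm
    cases ht : tbl p with
    | some v =>
      rw [randomOracle_of_some ht, PMF.pure_bind, PMF.pure_bind]
      refine ⟨fun r hr => ?_, ?_⟩
      · rw [PMF.support_pure, Set.mem_singleton_iff] at hr
        subst hr
        refine inv v tbl _ fun q hq => ?_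
        rw [newKeys_of_mark hm]
        exact i3 q (hs q hq)
      -- The root cannot have been marked just now, as the table would be undefined there.
      · have hst : st.2.star = some p := by
          rcases st.2.mark_cases st.1 p with h1 | ⟨h1, h1', _⟩
          · exact h1.symm.trans hm
          · rw [i3 p (by simp [h1]), h1'] at ht; cases ht
        rw [hst, keyDist_some_some ht, PMF.pure_bind]
        simp only [hstar, keyDist_some_some ht, PMF.pure_bind]
    | none =>
      rw [randomOracle_of_none ht]
      simp only [PMF.bind_bind, PMF.pure_bind]
      refine ⟨fun r hr => ?_, ?_⟩
      · obtain ⟨y, -, hr⟩ := (PMF.mem_support_bind_iff _ _ _).1 hr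
        rw [PMF.support_pure, Set.mem_singleton_iff] at hr
        subst hr
        refine inv y _ _ fun q hq => ?_
        rw [newKeys_of_mark hm, Function.update_of_ne]
        · exact i3 q (hs q hq)
        · rintro rfl; exact hq hm
      · have hkd : keyDist l st.2.star tbl = uniformBits l := by
          rcases st.2.mark_cases st.1 p with h1 | ⟨h1, _⟩
          · rw [← h1, hm, keyDist_some_none ht]
          · rw [h1, keyDist_none]
        rw [hkd]
        simp only [hstar, keyDist_some_some (Function.update_self p (some _) tbl), PMF.pure_bind]
  · have hst := mark_eq_star hm
    have hstp : st.2.star ≠ some p := hst ▸ hm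
    have htp := i3 p hstp
    have hstar : ∀ y t, (issue st p c y t).2.star = st.2.star := fun _ _ => hst
    have h2 : ∀ k, (simulator hmac).respond (keyOracle hmac) l i d (bump st, k)
        = (uniformBits l).bind fun r => PMF.pure
          (hmac ((look p st.2.keys).getD r) (encode ⟨p, [c]⟩),
          bump (issue st p c r (hmac ((look p st.2.keys).getD r) (encode ⟨p, [c]⟩))), k) :=
        fun k => by
      rw [respond_other h' (by omega) hm]
      simp only [bump_issue]
      rfl
    simp only [h2]
    cases ht : look p st.2.keys with
    | some v =>
      rw [randomOracle_of_some (htp.trans ht), PMF.pure_bind, PMF.pure_bind]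
      refine ⟨fun r hr => ?_, ?_⟩
      · rw [PMF.support_pure, Set.mem_singleton_iff] at hr
        subst hr
        refine inv v tbl _ fun q hq => ?_
        rw [newKeys_of_look ht]
        exact i3 q (hst ▸ hq)
      · simp only [hstar, Option.getD_some, issue_of_look ht c _ v, pmf_bind_const]
    | none =>
      rw [randomOracle_of_none (htp.trans ht)]
      simp only [PMF.bind_bind, PMF.pure_bind]
      refine ⟨fun r hr => ?_, ?_⟩
      · obtain ⟨y, -, hr⟩ := (PMF.mem_support_bind_iff _ _ _).1 hr
        rw [PMF.support_pure, Set.mem_singleton_iff] at hr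
        subst hr
        refine inv y _ _ fun q hq => ?_
        rw [newKeys_of_none hm ht, look]
        split_ifs with hqp
        · subst hqp; simp
        · rw [Function.update_of_ne (Ne.symm hqp)]
          exact i3 q (hst ▸ hq)
      -- The table changes only at `p`, which is not the guessed root.
      · have hkd : ∀ y, keyDist l st.2.star (Function.update tbl p (some y))
            = keyDist l st.2.star tbl := fun y => by
          unfold keyDist
          congr 1
          cases hs : st.2.star with
          | none => rfl
          | some q =>
            simp only [Option.bind_some]
            rw [Function.update_of_ne]
            rintro rfl
            exact hstp hs
        simp only [hstar, hkd, Option.getD_none]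
        exact PMF.bind_comm _ _ _

/-- Replacing the root key by a random function amounts to choosing its value at the root payload
of the forgery as a key of the next level. -/
theorem game_root {N : ℕ} (hN : 1 ≤ N) (T : Tree Data) {tbl : List Bool → Option (List Bool)}
    (hI : RootInv N (st, tbl)) : (simulator hmac).game (randomOracle l) l T (st, tbl)
      = (keyDist l st.2.star tbl).bind fun k =>
        (simulator hmac).game (keyOracle hmac) l T (bump st, k) := by
  have := Simulator.game_transport (M := simulator hmac) (O₁ := randomOracle l)
    (O₂ := keyOracle hmac) (l := l) (I := RootInv N)
    (κ := fun x => (keyDist l x.1.2.star x.2).bind fun k => PMF.pure (bump x.1, k))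
    ?_ ?_ ?_ T hI
  · rw [this, PMF.bind_bind]
    simp only [PMF.pure_bind]
  · rintro i d ⟨st, tbl⟩ hI
    by_cases h : IsNew st (kind i) d
    · exact (hI.of_new h).1
    · rw [respond_of_not_new h]
      intro r hr
      rw [PMF.support_pure, Set.mem_singleton_iff] at hr
      subst hr
      exact (hI.of_not_new h).1
  · rintro i d ⟨st, tbl⟩ hI
    simp only [PMF.bind_bind, PMF.pure_bind]
    by_cases h : IsNew st (kind i) d
    · exact (hI.of_new h).2
    · simp only [respond_of_not_new h, respond_of_not_new (not_isNew_bump h), PMF.pure_bind,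
        (hI.of_not_new h).2, simulator_post_bump h]
  · rintro ⟨st, tbl⟩ ⟨i1, i2, i3, i4⟩
    simp only at i1 i2 i3 i4
    simp only [Simulator.last, PMF.bind_bind, PMF.pure_bind, keyOracle_ofBits,
      simulator_outcome_bump (hmac := hmac) (show st.1.level < st.1.depth by omega)]
    cases hr : st.2.target with
    | none => simp only [simulator_outcome_none hr, pmf_bind_const]
    | some r =>
      -- The last query at level `0` is the guessed root. If its value is still undefined, it is
      -- drawn now, uniformly like the key in the other game.
      have hq : (simulator hmac).lastQuery st = r.msg.root := by simp [simulator, hr, i1]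
      rw [hq, i4 r hr]
      cases ht : tbl r.msg.root with
      | some v => rw [randomOracle_of_some ht, keyDist_some_some ht, PMF.pure_bind, PMF.pure_bind]
      | none =>
        rw [randomOracle_of_none ht, keyDist_some_none ht, PMF.bind_bind]
        simp only [PMF.pure_bind]

end hops


/-! ### Later keys on the path as random functions -/

section hops

variable {hmac : List Bool → List Bool → List Bool} {st : Guess × Log} {d : Data} {l i : ℕ}

/-- The fresh command is longer than all issued commands together. -/
theorem Log.look_fresh (D : Log) (p : List Bool) : look (p, D.fresh) D.issued = none := by
  rw [look_eq_none]
  intro x hx h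
  have h1 : x.1.2.length ≤ (D.issued.flatMap fun x => x.1.2).length := by
    rw [List.length_flatMap]
    exact List.single_le_sum (fun _ _ => Nat.zero_le _) _ (List.mem_map_of_mem hx)
  have h2 : x.1.2.length = D.fresh.length := by rw [h]
  rw [Log.fresh, List.length_append, List.length_singleton] at h2
  omega

theorem Log.length_padded {D : Log} {g : Guess} {r : Token} (h : r.msg.cmds.length ≤ g.depth) :
    (D.padded g r).length = g.depth := by
  simp only [Log.padded, Log.padding, List.length_append, List.length_drop, List.length_replicate]
  omega

/-- The first command of a padded token that is not covered has not been issued with its root. -/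
theorem Log.look_of_padded {D : Log} {g : Guess} {r : Token} (h : D.cover r.msg = none)
    {c : List Bool} (hc : (D.padded g r).take 1 = [c]) : look (r.msg.root, c) D.issued = none := by
  rw [Log.padded, Log.padding] at hc
  rw [Log.cover] at h
  cases hm : r.msg.cmds with
  | nil =>
    rw [hm] at hc
    cases hd : g.depth with
    | zero => simp [hd] at hc
    | succ n =>
      have : D.fresh = c := by simpa [hd, List.replicate_succ] using hc
      rw [← this]
      exact D.look_fresh _
  | cons a u =>
    rw [hm] at h hc
    have : a = c := by simpa using hc
    rw [← this]
    exact h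

/-- The invariant of the games in which a later key on the path is replaced by a random
function. -/
structure PathInv (e N : ℕ) (x : (Guess × Log) × (List Bool → Option (List Bool))) : Prop where
  level : x.1.1.level = e
  depth : x.1.1.depth = N
  table : ∀ q v, x.2 q = some v → ∃ p c t, q = encode ⟨p, [c]⟩ ∧ ((p, c), t) ∈ x.1.2.issued
  target : ∀ r, x.1.2.target = some r → x.1.2.cover r.msg = none

variable {e N : ℕ} {tbl : List Bool → Option (List Bool)}

theorem PathInv.table_eq_none (hI : PathInv e N (st, tbl)) {p c : List Bool}
    (h : look (p, c) st.2.issued = none) : tbl (encode ⟨p, [c]⟩) = none := by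
  cases ht : tbl (encode ⟨p, [c]⟩) with
  | none => rfl
  | some v =>
    obtain ⟨p', c', t, h1, h2⟩ := hI.table _ _ ht
    have := encode_injective h1
    simp only [Message.mk.injEq, List.cons.injEq, and_true] at this
    rw [look_eq_none] at h
    exact absurd (by rw [this.1, this.2]) (h _ h2)

/-- Only messages with a single command, issued to users, have been asked before. The last query has
`e` commands, so a coincidence forces `e = 1`; then its command would have been issued with this
root, although the target is not covered and the padding is fresh. -/
theorem PathInv.lastQuery_eq_none (hI : PathInv e N (st, tbl)) (he : 1 ≤ e) (heN : e ≤ N)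
    {r : Token} (hr : st.2.target = some r)
    (hl : (st.2.padded st.1 r).length = st.1.depth) :
    tbl ((simulator hmac).lastQuery st) = none := by
  have hI' := hI
  obtain ⟨h1, h2, h3, h4⟩ := hI'
  simp only at h1 h2 h3 h4
  have hq : (simulator hmac).lastQuery st
      = encode ⟨r.msg.root, (st.2.padded st.1 r).take e⟩ := by
    simp only [simulator, hr, h1]
    rw [if_neg (by simp; omega)]
  have hlen : ((st.2.padded st.1 r).take e).length = e := by
    rw [List.length_take, hl, h2]; omega
  rw [hq]
  cases ht : tbl (encode ⟨r.msg.root, (st.2.padded st.1 r).take e⟩) with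
  | none => rfl
  | some v =>
    obtain ⟨p, c, t, g1, -⟩ := h3 _ _ ht
    have g2 := encode_injective g1
    simp only [Message.mk.injEq] at g2
    have : e = 1 := by rw [← hlen, g2.2]; rfl
    subst this
    rw [g2.2, hI.table_eq_none (Log.look_of_padded (h4 r hr) g2.2)] at ht
    cases ht

theorem PathInv.of_not_new {k : Bool × Bool} (hI : PathInv e N (st, tbl)) (h : ¬ IsNew st k d) :
    PathInv e N (((simulator hmac).post (st, k, d, [], [])).1, tbl) := by
  rcases simulator_post_state (hmac := hmac) h [] [] rfl with h1 | ⟨h1, h2, h3, h4, h5, h6⟩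
  · rw [h1]; exact hI
  · obtain ⟨i1, i2, i3, i4⟩ := hI
    refine ⟨by rw [h1]; exact i1, by rw [h1]; exact i2, fun q v hq => ?_, fun r hr => (h6 r hr).2⟩
    simp only
    rw [h4]
    exact i3 q v hq

/-- For the guessed root both games return a uniform tag: at level `1` as the value of the random
function at a new point, otherwise by sampling. The next key has no influence on these answers, so
it can be drawn independently, before or after. -/
theorem PathInv.of_new (hI : PathInv e N (st, tbl)) (he : 1 ≤ e) (h : IsNew st (kind i) d) :
    (∀ r ∈ ((simulator hmac).respond (randomOracle l) l i d (st, tbl)).support,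
      PathInv e N r.2) ∧
    (((simulator hmac).respond (randomOracle l) l i d (st, tbl)).bind fun r =>
        (uniformBits l).bind fun k => PMF.pure (r.1, bump r.2.1, k))
      = (uniformBits l).bind fun k =>
        (simulator hmac).respond (keyOracle hmac) l i d (bump st, k) := by
  have hI' := hI
  obtain ⟨i1, i2, i3, i4⟩ := hI'
  simp only at i1 i2 i3 i4
  have h' : IsNew (bump st) (kind i) d := h
  have hlev : (bump st).1.level = e + 1 := by rw [← i1]; rfl
  have inv : ∀ (y t : List Bool), PathInv e N (issue st (queryRoot (kind i) d) (queryCmd d) y t,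
      tbl) := fun y t =>
    ⟨i1, i2, fun q v hq => by
      obtain ⟨p, c, t, g1, g2⟩ := i3 q v hq
      exact ⟨p, c, t, g1, List.mem_cons_of_mem _ g2⟩, fun r hr => by cases hr⟩
  by_cases hm : st.2.mark st.1 (queryRoot (kind i) d) = some (queryRoot (kind i) d)
  · have hm' : (bump st).2.mark (bump st).1 (queryRoot (kind i) d) = some (queryRoot (kind i) d) :=
      hm
    simp only [respond_inner h' (by omega) hm', ← bump_issue]
    rcases Nat.lt_or_ge e 2 with h2 | h2
    · have ht := hI.table_eq_none h.2.2
      rw [respond_star h (by omega) hm, randomOracle_of_none ht]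
      simp only [PMF.bind_bind, PMF.pure_bind]
      refine ⟨fun r hr => ?_, PMF.bind_comm _ _ _⟩
      obtain ⟨y, -, hr⟩ := (PMF.mem_support_bind_iff _ _ _).1 hr
      rw [PMF.support_pure, Set.mem_singleton_iff] at hr
      subst hr
      refine ⟨i1, i2, fun q v hq => ?_, fun r hr => by cases hr⟩
      simp only at hq
      by_cases hqe : q = encode ⟨queryRoot (kind i) d, [queryCmd d]⟩
      · exact ⟨_, _, _, hqe, List.mem_cons_self⟩
      · rw [Function.update_of_ne hqe] at hq
        exact (inv y y).table q v hq
    · rw [respond_inner h (by omega) hm]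
      simp only [PMF.bind_bind, PMF.pure_bind]
      refine ⟨fun r hr => ?_, PMF.bind_comm _ _ _⟩
      obtain ⟨y, -, hr⟩ := (PMF.mem_support_bind_iff _ _ _).1 hr
      rw [PMF.support_pure, Set.mem_singleton_iff] at hr
      subst hr
      exact inv _ _
  · have hm' : (bump st).2.mark (bump st).1 (queryRoot (kind i) d) ≠ some (queryRoot (kind i) d) :=
      hm
    simp only [respond_other h' (by omega) hm', ← bump_issue]
    rw [respond_other h (by omega) hm]
    simp only [PMF.bind_bind, PMF.pure_bind]
    refine ⟨fun r hr => ?_, PMF.bind_comm _ _ _⟩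
    obtain ⟨y, -, hr⟩ := (PMF.mem_support_bind_iff _ _ _).1 hr
    rw [PMF.support_pure, Set.mem_singleton_iff] at hr
    subst hr
    exact inv _ _

theorem PathInv.respond (he : 1 ≤ e) (i : ℕ) (d : Data)
    (s : (Guess × Log) × (List Bool → Option (List Bool))) (hI : PathInv e N s) :
    ∀ r ∈ ((simulator hmac).respond (randomOracle l) l i d s).support, PathInv e N r.2 := by
  obtain ⟨st, tbl⟩ := s
  by_cases h : IsNew st (kind i) d
  · exact (hI.of_new he h).1
  · rw [respond_of_not_new h]
    intro r hr
    rw [PMF.support_pure, Set.mem_singleton_iff] at hr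
    subst hr
    exact hI.of_not_new h

/-- Replacing a later key on the path by a random function amounts to choosing the next key at
random. -/
theorem game_path (he : 1 ≤ e) (heN : e < N) (T : Tree Data) (hI : PathInv e N (st, tbl)) :
    (simulator hmac).game (randomOracle l) l T (st, tbl) = (uniformBits l).bind fun k =>
      (simulator hmac).game (keyOracle hmac) l T (bump st, k) := by
  have := Simulator.game_transport (M := simulator hmac) (O₁ := randomOracle l)
    (O₂ := keyOracle hmac) (l := l) (I := PathInv e N)
    (κ := fun x => (uniformBits l).bind fun k => PMF.pure (bump x.1, k))
    (PathInv.respond he) ?_ ?_ T hI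
  · rw [this, PMF.bind_bind]
    simp only [PMF.pure_bind]
  · rintro i d ⟨st, tbl⟩ hI
    simp only [PMF.bind_bind, PMF.pure_bind]
    by_cases h : IsNew st (kind i) d
    · exact (hI.of_new he h).2
    · simp only [respond_of_not_new h, respond_of_not_new (not_isNew_bump h), PMF.pure_bind,
        simulator_post_bump h]
  · rintro ⟨st, tbl⟩ hI
    have i1 : st.1.level = e := hI.level
    have i2 : st.1.depth = N := hI.depth
    simp only [Simulator.last, PMF.bind_bind, PMF.pure_bind, keyOracle_ofBits,
      simulator_outcome_bump (hmac := hmac) (show st.1.level < st.1.depth by omega)]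
    cases hr : st.2.target with
    | none => simp only [simulator_outcome_none hr, pmf_bind_const]
    | some r =>
      by_cases hl : (st.2.padded st.1 r).length = st.1.depth
      · rw [randomOracle_of_none (hI.lastQuery_eq_none he heN.le hr hl), PMF.bind_bind]
        simp only [PMF.pure_bind]
      · simp only [simulator_outcome_of_length hr hl, pmf_bind_const]

/-- When the last key on the path is replaced by a random function, a forgery is a guess of a
random value. -/
theorem game_end_le (hN : 1 ≤ N) (T : Tree Data) (hI : PathInv N N (st, tbl)) :
    (simulator hmac).game (randomOracle l) l T (st, tbl) true ≤ (2 ^ l)⁻¹ := by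
  refine pmf_bind_apply_le fun z hz => ?_
  replace hz := Tree.invariant (PathInv.respond hN) T.closed hI z hz
  obtain ⟨_, st, tbl⟩ := z
  have i1 : st.1.level = N := hz.level
  have i2 : st.1.depth = N := hz.depth
  have hf : ((PMF.pure false : PMF Bool) true) = 0 := by simp
  simp only [Simulator.last]
  cases hr : st.2.target with
  | none => simp only [simulator_outcome_none hr, pmf_bind_const, hf, zero_le]
  | some r =>
    by_cases hl : (st.2.padded st.1 r).length = st.1.depth
    · rw [randomOracle_of_none (hz.lastQuery_eq_none hN le_rfl hr hl), PMF.bind_bind]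
      simp only [PMF.pure_bind]
      -- At level `N` no commands remain after the oracle's answer, so acceptance means that this
      -- answer equals a string determined before it is drawn.
      have ho : ∀ y, (simulator hmac).outcome (st, y)
          = decide (y = chainFrom hmac r.msg.root r.tag r.msg.cmds (st.2.padding st.1 r)) := by
        intro y
        simp only [simulator, hr, hl, i1]
        rw [List.drop_eq_nil_of_le (by omega), chainFrom]
        simp
      simp only [ho]
      rw [PMF.bind_apply, tsum_eq_single
        (chainFrom hmac r.msg.root r.tag r.msg.cmds (st.2.padding st.1 r))
        fun y hy => by simp [hy]]
      simpa using uniformBits_apply_le l _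
    · simp only [simulator_outcome_of_length hr hl, pmf_bind_const, hf, zero_le]

end hops


/-! ## A forgery is recognized by one of the simulators -/

/-- With answers of length at most `m`, at most `n` queries are asked, and all queries and outputs
have size at most `B`. -/
def Tree.Within (m B : ℕ) : Tree Data → ℕ → Prop
  | .ret d, _ => d.size ≤ B
  | .flip f, n => ∀ b, (f b).Within m B n
  | .call _ d f, n => d.size ≤ B ∧ ∃ n', n = n' + 1 ∧
      ∀ a : List Bool, a.length ≤ m → (f a).Within m B n'

theorem Message.length_cmds_ofData_le (d : Data) : (Message.ofData d).cmds.length ≤ d.size := by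
  rw [Message.ofData, List.length_map]
  exact (Data.length_toList_lt _).le.trans (Data.size_snd_le d)

theorem length_cmds_queryToken_le (k : Bool × Bool) (d : Data) :
    (queryToken k d).msg.cmds.length ≤ d.size := by
  have h : ∀ d, (Token.ofData d).msg.cmds.length ≤ d.size := fun d =>
    (Message.length_cmds_ofData_le _).trans (Data.size_fst_le d)
  rw [queryToken]
  split_ifs
  · exact (h _).trans (Data.size_fst_le d)
  · exact h d

section forgery

variable {hmac : List Bool → List Bool → List Bool}

theorem chainFrom_append_list (p h : List Bool) (d u v : List (List Bool)) :
    chainFrom hmac p h d (u ++ v) = chainFrom hmac p (chainFrom hmac p h d u) (d ++ u) v := by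
  induction u generalizing h d with
  | nil => simp [chainFrom]
  | cons c u ih => simp only [List.cons_append, chainFrom, ih, List.append_assoc, List.nil_append]

theorem isParent_chainTag (k p : List Bool) (cs : List (List Bool)) (c : List Bool) :
    (raft hmac).IsParent k ⟨⟨p, cs⟩, chainTag hmac k ⟨p, cs⟩⟩
      ⟨⟨p, cs ++ [c]⟩, chainTag hmac k ⟨p, cs ++ [c]⟩⟩ := by
  refine ⟨c, ?_⟩
  have h : raftVer hmac k ⟨⟨p, cs⟩, chainTag hmac k ⟨p, cs⟩⟩ = true := by simp [raftVer]
  simp only [raft, h, if_true, chainTag_append]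

theorem ancestor_chainTag (k p : List Bool) (cs us : List (List Bool)) :
    Relation.ReflTransGen ((raft hmac).IsParent k) ⟨⟨p, cs⟩, chainTag hmac k ⟨p, cs⟩⟩
      ⟨⟨p, cs ++ us⟩, chainTag hmac k ⟨p, cs ++ us⟩⟩ := by
  induction us using List.reverseRecOn with
  | nil => rw [List.append_nil]
  | append_singleton us c ih =>
    rw [← List.append_assoc]
    exact ih.tail (isParent_chainTag k p (cs ++ us) c)

variable {k : List Bool} {l N : ℕ}

/-- With the true root key the test computes the tag of the padded token in two ways, from the root
and from the given tag. For a valid token they agree. -/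
theorem last_of_forgery {st : Guess × Log} {r : Token} (h0 : st.1.level = 0)
    (hr : st.2.target = some r) (hl : r.msg.cmds.length ≤ st.1.depth)
    (hv : raftVer hmac k r = true) :
    (simulator hmac).last (keyOracle hmac) (st, k) = PMF.pure true := by
  have hq : (simulator hmac).lastQuery st = r.msg.root := by simp [simulator, hr, h0]
  rw [raftVer, decide_eq_true_eq] at hv
  simp only [Simulator.last, hq, keyOracle_ofBits, PMF.pure_bind]
  congr 1
  simp only [simulator, hr, h0, Log.length_padded hl]
  rw [List.take_zero, List.drop_zero, Log.padded, chainFrom_append_list, ← chainTag, hv]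
  simp

/-- Once a target is recorded, the state is frozen, so the remaining computation `U` is irrelevant.
-/
theorem accept_of_forgery {α : Type} {st : Guess × Log} {r : Token} (h0 : st.1.level = 0)
    (hr : st.2.target = some r) (hl : r.msg.cmds.length ≤ st.1.depth)
    (hv : raftVer hmac k r = true) (U : Tree α) :
    ((U.interp ((simulator hmac).respond (keyOracle hmac) l) (st, k)).bind fun z =>
      (simulator hmac).last (keyOracle hmac) z.2) = PMF.pure true := by
  have hinv := Tree.invariant (O := (simulator hmac).respond (keyOracle hmac) l)
    (I := fun x => x = (st, k)) (fun i d s hs r hr' => ?_) U rfl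
  · rw [pmf_bind_congr (g := fun _ => PMF.pure true) fun z hz => by
      rw [hinv z hz]; exact last_of_forgery h0 hr hl hv, pmf_bind_const]
  · subst hs
    rw [respond_of_not_new (fun h => by rw [h.1] at hr; cases hr), PMF.support_pure,
      Set.mem_singleton_iff] at hr'
    subst hr'
    simp [simulator, hr]

/-- What the simulators with all possible guesses have in common after `count` queries, if they
have not seen a forgery. -/
structure View : Type where
  count : ℕ
  star : ℕ → Option (List Bool)
  keys : ℕ → List (List Bool × List Bool)
  issued : List ((List Bool × List Bool) × List Bool)

namespace View

/-- The state of the simulator with the given guess. -/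
def state (V : View) (N i j : ℕ) : Guess × Log :=
  (⟨0, i, j, N⟩, ⟨V.count, V.star i, V.keys i, V.issued, none⟩)

/-- Marking does not depend on the depth or the attempt number, hence the zeros. -/
def mark (V : View) (p : List Bool) (i : ℕ) : Option (List Bool) :=
  (V.state 0 i 0).2.mark (V.state 0 i 0).1 p

/-- The field `root` ensures that a correct guess exists: either no simulator whose starting query
is still to come has fixed a key for `p`, so the next query can single it out, or an earlier
starting query has singled it out already. -/
structure Valid (V : View) (hmac : List Bool → List Bool → List Bool) (k : List Bool)
    (Φ : List Token) : Prop where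
  issued : ∀ p c t, ((p, c), t) ∈ V.issued →
    t = chainTag hmac k ⟨p, [c]⟩ ∧ (⟨⟨p, [c]⟩, t⟩ : Token) ∈ Φ
  star : ∀ i, V.count ≤ i → V.star i = none
  root : ∀ p, (∀ i, V.count ≤ i → look p (V.keys i) = none) ∨ ∃ i < V.count, V.star i = some p

variable {V : View} {Φ Φ' : List Token}

theorem mark_of_star {p q : List Bool} {i : ℕ} (h : V.star i = some q) :
    V.mark p i = some q := by
  simp [mark, Log.mark, state, h]

/-- The simulator that guesses the first query with the root payload `p` correctly. -/
theorem Valid.exists_mark (hV : V.Valid hmac k Φ) (p : List Bool) :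
    ∃ i ≤ V.count, V.mark p i = some p := by
  rcases hV.root p with h | ⟨i, h1, h2⟩
  · refine ⟨V.count, le_rfl, ?_⟩
    simp [mark, Log.mark, state, hV.star V.count le_rfl, h V.count le_rfl]
  · exact ⟨i, h1.le, mark_of_star h2⟩

theorem Valid.step (hV : V.Valid hmac k Φ) {p : List Bool}
    {K : ℕ → List (List Bool × List Bool)} {I : List ((List Bool × List Bool) × List Bool)}
    (hK : ∀ i q, q ≠ p → look q (K i) = look q (V.keys i))
    (hI : ∀ p c t, ((p, c), t) ∈ I →
      t = chainTag hmac k ⟨p, [c]⟩ ∧ (⟨⟨p, [c]⟩, t⟩ : Token) ∈ Φ') :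
    Valid ⟨V.count + 1, V.mark p, K, I⟩ hmac k Φ' := by
  refine ⟨hI, fun i hi => ?_, fun q => ?_⟩
  · simp only at hi ⊢
    have h1 := hV.star i (by omega)
    have h2 : V.count ≠ i := by omega
    simp [mark, Log.mark, state, h1, h2]
  · simp only
    by_cases hq : q = p
    · subst hq
      obtain ⟨i, h1, h2⟩ := hV.exists_mark q
      exact .inr ⟨i, by omega, h2⟩
    · rcases hV.root q with h | ⟨i, h1, h2⟩
      · refine .inl fun i hi => ?_
        rw [hK i q hq]
        exact h i (by omega)
      · exact .inr ⟨i, by omega, mark_of_star h2⟩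

/-- The step of all simulators except one that has seen a forgery. -/
def tick (V : View) (p : List Bool) : View := ⟨V.count + 1, V.mark p, V.keys, V.issued⟩

theorem Valid.tick (hV : V.Valid hmac k Φ) (p : List Bool) (h : ∀ r ∈ Φ, r ∈ Φ') :
    (V.tick p).Valid hmac k Φ' :=
  hV.step (fun _ _ _ => rfl) fun p c t ht => (hV.issued p c t ht).imp_right (h _)

/-- The logged tag is the true chain value after the first command, so the rest of the chain decides
validity. If the token is valid, the logged token is an ancestor, which excludes a win. -/
theorem Valid.validFrom (hV : V.Valid hmac k Φ) {r : Token} {t : List Bool} {i j : ℕ}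
    (h : (V.state N i j).2.cover r.msg = some t) :
    RAF.validFrom hmac t r = raftVer hmac k r ∧
      (raftVer hmac k r = true → ¬ (raft hmac).Wins k Φ r) := by
  obtain ⟨⟨p, cs⟩, t'⟩ := r
  rw [Log.cover] at h
  cases cs with
  | nil => simp at h
  | cons c cs =>
    obtain ⟨rfl, h2⟩ := hV.issued p c t (look_eq_some_mem h)
    refine ⟨rfl, fun hv hw => hw.2 _ ?_ h2⟩
    rw [raftVer, decide_eq_true_eq] at hv
    simp only at hv
    subst hv
    exact ancestor_chainTag k p [c] cs

end View

end forgery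


/-! ### Forged and answered queries -/

section forgery

variable {hmac : List Bool → List Bool → List Bool} {k : List Bool} {l N : ℕ} {V : View}
  {Φ : List Token}

theorem respond_check {σ : Type} {O : Oracle σ} {s : σ} {st : Guess × Log} {i : ℕ} {d : Data}
    (hi : (kind i).1 = false) (ht : st.2.target = none) :
    (simulator hmac).respond O l i d (st, s) = PMF.pure
      ((simCheck hmac st.1 st.2 (kind i).2 (queryToken (kind i) d) (queryCmd d)).2,
        (simCheck hmac st.1 st.2 (kind i).2 (queryToken (kind i) d) (queryCmd d)).1, s) := by
  rw [respond_of_not_new fun h => by rw [h.2.1] at hi; cases hi]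
  simp only [simulator, hi, ht, Option.isSome_none, Bool.false_and, Bool.or_false,
    Bool.false_eq_true, if_false]

theorem simCheck_of_none {g : Guess} {D : Log} {b : Bool} {r : Token} {c : List Bool}
    (h : D.cover r.msg = none) : simCheck hmac g D b r c =
      ((g, ⟨D.count + 1, D.mark g r.msg.root, D.keys, D.issued,
        if D.count = g.attempt ∧ D.mark g r.msg.root = some r.msg.root
        then some r else D.target⟩), if b = true then [] else [false]) := by
  simp [simCheck, h]

theorem simCheck_of_some {g : Guess} {D : Log} {b : Bool} {r : Token} {c t : List Bool}
    (h : D.cover r.msg = some t) : simCheck hmac g D b r c =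
      ((g, D.tick g r.msg.root),
        if b = true then
          if validFrom hmac t r = true then hmac r.tag (encode ⟨r.msg.root, r.msg.cmds ++ [c]⟩)
          else []
        else [validFrom hmac t r]) := by
  simp [simCheck, h]

namespace View

def cover (V : View) (m : Message) : Option (List Bool) := (V.state 0 0 0).2.cover m

/-- Some simulator recognizes the query as a forgery. -/
def Forged (V : View) (hmac : List Bool → List Bool → List Bool) (k : List Bool) (l N i : ℕ)
    (d : Data) : Prop :=
  ∃ i' ≤ V.count, ∃ a st' r, (simulator hmac).respond (keyOracle hmac) l i d
      (V.state N i' V.count, k) = PMF.pure (a, st', k) ∧ st'.1 = ⟨0, i', V.count, N⟩ ∧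
    st'.2.target = some r ∧ r.msg.cmds.length ≤ N ∧ raftVer hmac k r = true

/-- All simulators that have not yet made their guess answer the query by `a`. -/
def Answered (V V' : View) (hmac : List Bool → List Bool → List Bool) (k : List Bool)
    (l N i : ℕ) (d : Data) (a : List Bool) : Prop :=
  V.count ≤ V'.count ∧ V'.count ≤ V.count + 1 ∧ ∀ i' j, V'.count ≤ j →
    (simulator hmac).respond (keyOracle hmac) l i d (V.state N i' j, k)
      = PMF.pure (a, V'.state N i' j, k)

/-- The right guess of the root comes from `Valid.exists_mark`; the right attempt number is the
current `count`. -/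
theorem Valid.forged (hV : V.Valid hmac k Φ) {i : ℕ} {d : Data} (hi : (kind i).1 = false)
    (hd : d.size ≤ N) (hc : V.cover (queryToken (kind i) d).msg = none)
    (hv : raftVer hmac k (queryToken (kind i) d) = true) : V.Forged hmac k l N i d := by
  obtain ⟨i', h1, h2⟩ := hV.exists_mark (queryToken (kind i) d).msg.root
  refine ⟨i', h1, _, _, queryToken (kind i) d, respond_check hi rfl, ?_, ?_,
    (length_cmds_queryToken_le _ d).trans hd, hv⟩
  · rw [simCheck_of_none (D := (V.state N i' V.count).2) hc]
    rfl
  · rw [simCheck_of_none (D := (V.state N i' V.count).2) hc]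
    exact if_pos ⟨rfl, h2⟩

/-- Rejecting uncovered tokens unchecked is correct as long as they are invalid, which is `h`.
Simulators with attempt number `V.count` are excluded, since they may record a target here. -/
theorem Valid.answered_check (hV : V.Valid hmac k Φ) {i : ℕ} {d : Data}
    (hi : (kind i).1 = false) (h : V.cover (queryToken (kind i) d).msg = none →
      raftVer hmac k (queryToken (kind i) d) = false) :
    V.Answered (V.tick (queryToken (kind i) d).msg.root) hmac k l N i d
      (if (kind i).2 = true then
        if raftVer hmac k (queryToken (kind i) d) = true then
          hmac (queryToken (kind i) d).tag (encode ⟨(queryToken (kind i) d).msg.root,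
            (queryToken (kind i) d).msg.cmds ++ [queryCmd d]⟩)
        else []
      else [raftVer hmac k (queryToken (kind i) d)]) := by
  refine ⟨Nat.le_succ _, le_rfl, fun i' j hj => ?_⟩
  rw [respond_check hi rfl]
  cases hc : V.cover (queryToken (kind i) d).msg with
  | none =>
    have hj' : V.count ≠ j := by
      have : V.count + 1 ≤ j := hj
      omega
    rw [simCheck_of_none (D := (V.state N i' j).2) hc, h hc]
    simp only [Bool.false_eq_true, if_false]
    have hj'' : ¬ ((V.state N i' j).2.count = (V.state N i' j).1.attempt ∧
        (V.state N i' j).2.mark (V.state N i' j).1 (queryToken (kind i) d).msg.root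
          = some (queryToken (kind i) d).msg.root) := fun h => hj' h.1
    rw [if_neg hj'']
    rfl
  | some t =>
    rw [simCheck_of_some (D := (V.state N i' j).2) hc, (hV.validFrom (N := 0) (i := 0) (j := 0) hc).1]
    rfl

theorem Valid.answered_issue (hV : V.Valid hmac k Φ) {d : Data} :
    ∃ V', V.Answered V' hmac k l N 1 d
        (hmac (hmac k d.fst.toBits) (encode ⟨d.fst.toBits, [d.snd.toBits]⟩)) ∧
      V'.Valid hmac k (⟨⟨d.fst.toBits, [d.snd.toBits]⟩,
        hmac (hmac k d.fst.toBits) (encode ⟨d.fst.toBits, [d.snd.toBits]⟩)⟩ :: Φ) := by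
  set p := d.fst.toBits with hp
  set c := d.snd.toBits with hc
  cases hl : look (p, c) V.issued with
  | some t =>
    obtain ⟨ht, -⟩ := hV.issued p c t (look_eq_some_mem hl)
    refine ⟨V.tick p, ⟨Nat.le_succ _, le_rfl, fun i' j hj => ?_⟩,
      hV.tick p fun _ => List.mem_cons_of_mem _⟩
    have hnew : ¬ IsNew (V.state N i' j) (kind 1) d := fun h => by
      have : look (p, c) V.issued = none := h.2.2
      rw [hl] at this
      cases this
    have hpost : (simulator hmac).post (V.state N i' j, kind 1, d, [], [])
        = simIssue hmac (V.state N i' j).1 (V.state N i' j).2 p c [] [] := rfl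
    have hl' : look (p, c) (V.state N i' j).2.issued = some t := hl
    rw [respond_of_not_new hnew, hpost]
    simp only [simIssue, hl']
    rw [ht]
    rfl
  | none =>
    have ht : hmac (hmac k p) (encode ⟨p, [c]⟩) = chainTag hmac k ⟨p, [c]⟩ := rfl
    -- The stored keys depend on the guess `i`: a simulator that has singled out `p` keeps no key
    -- for it.
    refine ⟨⟨V.count + 1, V.mark p, fun i => (V.state N i 0).2.newKeys (V.state N i 0).1 p
        (hmac k p) (hmac k p), ((p, c), hmac (hmac k p) (encode ⟨p, [c]⟩)) :: V.issued⟩,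
      ⟨Nat.le_succ _, le_rfl, fun i' j hj => ?_⟩, hV.step (p := p) (fun i q hq => ?_) ?_⟩
    · have hnew : IsNew (V.state N i' j) (kind 1) d := ⟨rfl, rfl, hl⟩
      rw [respond_root hnew rfl, keyOracle_ofBits, PMF.pure_bind]
      rfl
    · rw [Log.newKeys]
      split_ifs
      · rfl
      · rw [look, if_neg (Ne.symm hq)]
        rfl
      · rw [look, if_neg (Ne.symm hq)]
        rfl
    · intro p' c' t' h
      rcases List.mem_cons.1 h with h | h
      · simp only [Prod.mk.injEq] at h
        obtain ⟨⟨rfl, rfl⟩, rfl⟩ := h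
        exact ⟨ht, List.mem_cons_self⟩
      · exact (hV.issued p' c' t' h).imp_right (List.mem_cons_of_mem _)

end View

/-- The oracles of the game are deterministic and have short answers. -/
theorem oracle_eq_pure (hl : ∀ k m, (hmac k m).length = k.length) (hk : k.length = l) (i : ℕ)
    (d : Data) (Φ : List Token) : ∃ a Φ', (raft hmac).oracle k i d Φ = PMF.pure (a, Φ') ∧
      a.length ≤ l + 1 := by
  match i with
  | 0 => exact ⟨_, _, rfl, by simp⟩
  | 1 => exact ⟨_, _, rfl, by simp [raft, hl, hk]⟩
  | 2 =>
    cases hv : raftVer hmac k (Token.ofData d.fst) with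
    | false => exact ⟨[], Φ, by simp [Scheme.oracle, raft, hv], by simp⟩
    | true =>
      refine ⟨_, _, by simp [Scheme.oracle, raft, hv]; rfl, ?_⟩
      rw [raftVer, decide_eq_true_eq] at hv
      rw [hl, ← hv, chainTag, length_chainFrom hl, hl, hk]
      omega
  | i + 3 => exact ⟨_, _, rfl, by simp⟩

/-- Tokens issued by `ServiceIssue` enlarge `Φ` but need no entry in the log: without a forgery they
extend covered tokens and are covered themselves. -/
theorem View.Valid.answered_or_forged (hV : V.Valid hmac k Φ) (i : ℕ) {d : Data}
    (hd : d.size ≤ N) : V.Forged hmac k l N i d ∨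
      ∃ a Φ' V', (raft hmac).oracle k i d Φ = PMF.pure (a, Φ') ∧
        V.Answered V' hmac k l N i d a ∧ V'.Valid hmac k Φ' := by
  have check : ∀ i, (kind i).1 = false →
      (V.cover (queryToken (kind i) d).msg = none ∧
        raftVer hmac k (queryToken (kind i) d) = true) ∨
      (V.cover (queryToken (kind i) d).msg = none →
        raftVer hmac k (queryToken (kind i) d) = false) := fun i _ => by
    cases raftVer hmac k (queryToken (kind i) d)
    · exact .inr fun _ => rfl
    · simpa using eq_or_ne _ _
  match i with
  | 0 =>
    rcases check 0 rfl with h | h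
    · exact .inl (hV.forged rfl hd h.1 h.2)
    · exact .inr ⟨_, _, _, rfl, hV.answered_check rfl h, hV.tick _ fun _ h => h⟩
  | 1 =>
    obtain ⟨V', h1, h2⟩ := hV.answered_issue (l := l) (N := N) (d := d)
    exact .inr ⟨_, _, V', rfl, h1, h2⟩
  | 2 =>
    rcases check 2 rfl with h | h
    · exact .inl (hV.forged rfl hd h.1 h.2)
    · refine .inr ?_
      have key := hV.answered_check (l := l) (N := N) rfl h
      have hq : queryToken (kind 2) d = Token.ofData d.fst := rfl
      rw [hq] at key
      cases hv : raftVer hmac k (Token.ofData d.fst) with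
      | false =>
        rw [hv] at key
        exact ⟨_, Φ, _, by simp [Scheme.oracle, raft, hv, kind], key, hV.tick _ fun _ h => h⟩
      | true =>
        rw [hv] at key
        exact ⟨_, _, _, by simp [Scheme.oracle, raft, hv]; rfl, key,
          hV.tick _ fun _ => List.mem_cons_of_mem _⟩
  | i + 3 =>
    refine .inr ⟨[], Φ, V, rfl, ⟨le_rfl, Nat.le_succ _, fun i' j _ => ?_⟩, hV⟩
    rw [respond_of_not_new fun h => by cases h.2.1]
    rfl

open scoped Classical in
/-- The probability of a forgery is at most the sum of the probabilities that the simulators for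
all possible guesses recognize one. -/
theorem forgery_le_sum (hl : ∀ k m, (hmac k m).length = k.length) (hk : k.length = l) {M : ℕ}
    (T : Tree Data) {n : ℕ} (hT : T.Within (l + 1) N n) (hV : V.Valid hmac k Φ)
    (hM : V.count + n < M) :
    ((T.interp ((raft hmac).oracle k) Φ).bind fun x =>
        PMF.pure (decide ((raft hmac).Wins k x.2 (Token.ofData x.1)))) true
      ≤ ∑ i ∈ Finset.range M, ∑ j ∈ Finset.Ico V.count M,
        (simulator hmac).game (keyOracle hmac) l T (V.state N i j, k) true := by
  -- When a forgery is presented, one summand equals `1`, which bounds any probability.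
  have forged : ∀ {α : Type} (V : View) (n i : ℕ) (d : Data) (U : List Bool → Tree α),
      V.count + n < M → V.Forged hmac k l N i d →
      1 ≤ ∑ i' ∈ Finset.range M, ∑ j ∈ Finset.Ico V.count M,
        (((Tree.call i d U).interp ((simulator hmac).respond (keyOracle hmac) l)
          (V.state N i' j, k)).bind fun z => (simulator hmac).last (keyOracle hmac) z.2) true := by
    rintro α V n i d U hM ⟨i', h1, a, st', r, h2, h3, h4, h5, h6⟩
    have h7 := accept_of_forgery (hmac := hmac) (k := k) (l := l) (by rw [h3]) h4
      (by rw [h3]; exact h5) h6 (U a)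
    have h8 : (((Tree.call i d U).interp ((simulator hmac).respond (keyOracle hmac) l)
          (V.state N i' V.count, k)).bind fun z =>
            (simulator hmac).last (keyOracle hmac) z.2) true = 1 := by
      rw [Tree.interp, h2, PMF.pure_bind, h7]
      simp
    calc (1 : ENNReal) = _ := h8.symm
      _ ≤ ∑ j ∈ Finset.Ico V.count M,
        (((Tree.call i d U).interp ((simulator hmac).respond (keyOracle hmac) l)
          (V.state N i' j, k)).bind fun z => (simulator hmac).last (keyOracle hmac) z.2) true :=
        Finset.single_le_sum (f := fun j => (((Tree.call i d U).interp
          ((simulator hmac).respond (keyOracle hmac) l)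
          (V.state N i' j, k)).bind fun z => (simulator hmac).last (keyOracle hmac) z.2) true)
          (fun _ _ => zero_le) (Finset.mem_Ico.2 ⟨le_rfl, by omega⟩)
      _ ≤ _ := Finset.single_le_sum (f := fun i' => ∑ j ∈ Finset.Ico V.count M,
        (((Tree.call i d U).interp ((simulator hmac).respond (keyOracle hmac) l)
          (V.state N i' j, k)).bind fun z => (simulator hmac).last (keyOracle hmac) z.2) true)
          (fun _ _ => zero_le) (Finset.mem_range.2 (by omega))
  induction T generalizing V Φ n with
  | ret d =>
    rw [Tree.interp, PMF.pure_bind]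
    by_cases hw : (raft hmac).Wins k Φ (Token.ofData d)
    · have hv : raftVer hmac k (queryToken (kind 0) d) = true := hw.1
      -- A winning output is not covered, so it is a forgery in the additional query made by
      -- `Tree.closed`.
      have hc : V.cover (queryToken (kind 0) d).msg = none := by
        cases hc : V.cover (queryToken (kind 0) d).msg with
        | none => rfl
        | some t => exact absurd hw ((hV.validFrom (N := 0) (i := 0) (j := 0) hc).2 hv)
      refine le_trans (PMF.coe_le_one _ _) ?_
      exact forged V n 0 d _ hM (hV.forged rfl hT hc hv)
    · simp [hw]
  | flip f ih =>
    have h := fun b => ih b (hT b) hV hM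
    simp only [Simulator.game, Tree.closed] at h ⊢
    simp only [Tree.bind, Tree.interp, PMF.bind_bind]
    simp only [PMF.bind_apply (PMF.uniformOfFintype Bool), tsum_fintype, PMF.uniformOfFintype_apply]
    calc _ ≤ ∑ b : Bool, ((Fintype.card Bool : ENNReal))⁻¹ * _ :=
          Finset.sum_le_sum fun b _ => mul_le_mul_right (h b) _
      _ = _ := by
        simp only [Finset.mul_sum]
        rw [Finset.sum_comm]
        refine Finset.sum_congr rfl fun i _ => ?_
        rw [Finset.sum_comm]
  | call i d f ih =>
    obtain ⟨hd, n', rfl, hf⟩ := hT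
    rcases hV.answered_or_forged (l := l) i hd with h | ⟨a, Φ', V', h1, ⟨h2, h3, h4⟩, h5⟩
    · exact (PMF.coe_le_one _ _).trans (forged V _ i d _ hM h)
    · have ha : a.length ≤ l + 1 := by
        obtain ⟨a', Φ'', g1, g2⟩ := oracle_eq_pure hl hk i d Φ
        have := congrArg PMF.support (h1.symm.trans g1)
        rw [PMF.support_pure, PMF.support_pure, Set.singleton_eq_singleton_iff, Prod.mk.injEq]
          at this
        rw [this.1]; exact g2
      rw [Tree.interp, h1, PMF.pure_bind]
      refine (ih a (hf a ha) h5 (by omega)).trans ?_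
      refine Finset.sum_le_sum fun i' _ => ?_
      -- Simulators whose attempt number has just passed are dropped from the sum.
      refine le_trans (Finset.sum_le_sum fun j hj => ?_)
        (Finset.sum_le_sum_of_subset (Finset.Ico_subset_Ico_left h2))
      have h6 := h4 i' j (Finset.mem_Ico.1 hj).1
      simp only [Simulator.game, Tree.closed, Tree.bind, Tree.interp, h6, PMF.pure_bind]
      exact le_rfl

end forgery


/-! ## The reduction -/

/-- A call costs at least one unit of time and at least the size of its query, so the time limits
both the number and the size of the queries. -/
theorem Tree.within_map {β : Type} {m B C : ℕ} {R : Config → β → Prop} {c : Config} {T : Tree β}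
    (h : RunsTo m R c T) (g : β → Data)
    (hR : ∀ c b, R c b → c.time ≤ B ∧ (g b).size ≤ C) (hBC : B ≤ C) {n : ℕ}
    (hn : B ≤ c.time + n) : (T.map g).Within m C n := by
  induction h generalizing n with
  | ret hr => exact (hR _ _ hr).2
  | silent hs _ ih =>
    have := Config.time_next_of_ne_nil false [] _ hs.ne_nil
    exact ih (by omega)
  | @flip c x K f hc _ ih =>
    intro b
    have := c.time_next_of_ne_nil b [] (by simp [hc])
    exact ih b (by omega)
  | @call c i e x K f hc hrun ih =>
    have h1 : ∀ a : List Bool, a.length ≤ m → c.time + 1 + e.cost c.store ≤ B ∧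
        c.time + 1 ≤ (c.next false a).time := fun a ha => by
      have h2 := (hrun a ha).time_le fun c b h => (hR c b h).1
      obtain ⟨todo, s, t⟩ := c
      simp only at hc
      subst hc
      simp only [Config.next] at h2 ⊢
      omega
    have h3 := (h1 [] (by simp)).1
    refine ⟨(e.size_eval_le c.store).trans (by omega), n - 1, by omega, fun a ha => ?_⟩
    have := (h1 a ha).2
    exact ih a ha (by omega)

theorem PPT.within_tree (A : PPT) (l : ℕ) {N : ℕ} (hN : A.bound.eval l + 4 * l + 3 ≤ N) :
    (A.tree l).Within (l + 1) N (A.bound.eval l) :=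
  Tree.within_map (A.runsTo l) (fun c => c.store 0) (B := A.bound.eval l)
    (fun c b h => ⟨h.2.2.1, by
      have h1 := h.2.2.2 0
      have h2 := h.2.2.1
      rw [h.1] at h1 h2
      exact h1.trans (by omega)⟩)
    (by omega) (by omega)

section reduction

variable {hmac : List Bool → List Bool → List Bool}

open scoped Classical in
theorem forgeUTT_eq (hl : ∀ k m, (hmac k m).length = k.length) (A : PPT) (l : ℕ) :
    (raft hmac).forgeUTT A l = (uniformBits l).bind fun k =>
      ((A.tree l).interp ((raft hmac).oracle k) []).bind fun x =>
        PMF.pure (decide ((raft hmac).Wins k x.2 (Token.ofData x.1))) := by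
  refine pmf_bind_congr fun k hk => ?_
  have hk := length_of_mem_uniformBits hk
  have h := (A.runsTo l).map_runWith (O := (raft hmac).oracle k) (W := fun _ => True)
    (fun i d s _ r hr => by
      obtain ⟨a, Φ, h1, h2⟩ := oracle_eq_pure hl hk i d s
      rw [h1, PMF.support_pure, Set.mem_singleton_iff] at hr
      subst hr
      exact ⟨h2, trivial⟩)
    (fun c => c.store 0) (fun c => c.store 0) (B := A.bound.eval l)
    (fun c b h => ⟨h.2.1, h.2.2.1, by rw [h.1]⟩) [] trivial (A.bound.eval l) (by omega)
  rw [PPT.run, h, PPT.tree, Tree.map, Tree.interp_bind]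
  simp only [PMF.map, Tree.interp, PMF.pure_bind, PMF.bind_bind, Function.comp_def]

/-- The binary value is uniform below `2 ^ k`; the induction splits off the last bit, that is, the
parity. -/
theorem uniformBits_bind_bitsValue (k : ℕ) (g : ℕ → PMF Bool) (b : Bool) :
    ((uniformBits k).bind fun r => g (bitsValue r)) b
      = (2 ^ k)⁻¹ * ∑ v ∈ Finset.range (2 ^ k), g v b := by
  induction k generalizing g with
  | zero => simp [uniformBits_zero, bitsValue]
  | succ k ih =>
    rw [uniformBits_succ, PMF.bind_bind]
    simp only [PMF.bind_map, Function.comp_def, bitsValue_append]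
    rw [PMF.bind_apply, tsum_fintype]
    simp only [ih fun v => g (2 * v + true.toNat), ih fun v => g (2 * v + false.toNat),
      PMF.uniformOfFintype_apply, Fintype.card_bool,
      Fintype.sum_bool]
    have h : ∑ v ∈ Finset.range (2 ^ (k + 1)), g v b
        = ∑ v ∈ Finset.range (2 ^ k), (g (2 * v + 1) b + g (2 * v) b) := by
      rw [pow_succ, mul_comm]
      generalize 2 ^ k = n
      induction n with
      | zero => simp
      | succ n ih =>
        rw [Finset.sum_range_succ, ← ih, show 2 * (n + 1) = 2 * n + 1 + 1 by ring,
          Finset.sum_range_succ, Finset.sum_range_succ, add_assoc, add_comm (g (2 * n) b)]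
    rw [h, Finset.sum_add_distrib, pow_succ, ENNReal.mul_inv (by simp) (by simp)]
    simp only [Bool.toNat_true, Bool.toNat_false, add_zero, Nat.cast_ofNat]
    ring

/-- The probability that the simulator with the given guess and with a random key recognizes a
forgery. -/
noncomputable def guessKeyed (hmac : List Bool → List Bool → List Bool) (l : ℕ) (T : Tree Data)
    (N e i j : ℕ) : PMF Bool :=
  (uniformBits l).bind fun k =>
    (simulator hmac).game (keyOracle hmac) l T ((⟨e, i, j, N⟩, Log.empty), k)

/-- The probability that the simulator with the given guess and with a random function recognizes
a forgery. -/
noncomputable def guessRandom (hmac : List Bool → List Bool → List Bool) (l : ℕ) (T : Tree Data)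
    (N e i j : ℕ) : PMF Bool :=
  (simulator hmac).game (randomOracle l) l T ((⟨e, i, j, N⟩, Log.empty), fun _ => none)

theorem guessRandom_eq_guessKeyed {l N e : ℕ} (T : Tree Data) (he : e < N) (i j : ℕ) :
    guessRandom hmac l T N e i j = guessKeyed hmac l T N (e + 1) i j := by
  rw [guessRandom, guessKeyed]
  cases e with
  | zero =>
    exact game_root (N := N) (by omega) T ⟨rfl, rfl, fun p _ => rfl, fun r hr => by cases hr⟩
  | succ e =>
    exact game_path (by omega) he T ⟨rfl, rfl, fun q v hq => (by cases hq), fun r hr => by cases hr⟩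

theorem guessRandom_le {l N : ℕ} (hN : 1 ≤ N) (T : Tree Data) (i j : ℕ) :
    guessRandom hmac l T N N i j true ≤ (2 ^ l)⁻¹ :=
  game_end_le hN T ⟨rfl, rfl, fun q v hq => (by cases hq), fun r hr => by cases hr⟩

/-- `forgery_le_sum` is averaged over the key, starting from the empty view. The strict inequality
`hM` leaves room for the output as one more query. -/
theorem forgeUTT_le (hl : ∀ k m, (hmac k m).length = k.length) (A : PPT) {l N M : ℕ}
    (hN : A.bound.eval l + 4 * l + 3 ≤ N) (hM : A.bound.eval l < M) :
    (raft hmac).forgeUTT A l true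
      ≤ ∑ i ∈ Finset.range M, ∑ j ∈ Finset.range M, guessKeyed hmac l (A.tree l) N 0 i j true := by
  rw [forgeUTT_eq hl, PMF.bind_apply]
  have key : ∀ k ∈ (uniformBits l).support, _ := fun k hk =>
    forgery_le_sum (hmac := hmac) hl (length_of_mem_uniformBits hk) (A.tree l)
      (A.within_tree l hN) (V := ⟨0, fun _ => none, fun _ => [], []⟩) (Φ := [])
      ⟨fun p c t h => by simp at h, fun _ _ => rfl, fun p => .inl fun _ _ => rfl⟩
      (M := M) (by simpa using hM)
  calc _ ≤ ∑' k, ∑ i ∈ Finset.range M, ∑ j ∈ Finset.range M, uniformBits l k *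
        (simulator hmac).game (keyOracle hmac) l (A.tree l) ((⟨0, i, j, N⟩, Log.empty), k) true := by
        refine ENNReal.tsum_le_tsum fun k => ?_
        by_cases hk : uniformBits l k = 0
        · simp [hk]
        · simp only [← Finset.mul_sum]
          refine mul_le_mul_right ((key k hk).trans (le_of_eq ?_)) _
          rw [Finset.range_eq_Ico]
          rfl
    _ = _ := by
      rw [Summable.tsum_finsetSum fun _ _ => ENNReal.summable]
      refine Finset.sum_congr rfl fun i _ => ?_
      rw [Summable.tsum_finsetSum fun _ _ => ENNReal.summable]
      rfl

end reduction


/-! ### The distinguisher and the telescoping sum -/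

section reduction

variable {hmac : List Bool → List Bool → List Bool}

/-- Three independent uniform guesses make the probability an average, which becomes a plain sum
after multiplication by the number of triples. -/
theorem toReal_average (k : ℕ) (G : ℕ → ℕ → ℕ → PMF Bool) (b : Bool) :
    ((2 ^ k : ℕ) : ℝ) ^ 3 * (((uniformBits k).bind fun r₁ => (uniformBits k).bind fun r₂ =>
        (uniformBits k).bind fun r₃ => G (bitsValue r₁) (bitsValue r₂) (bitsValue r₃)) b).toReal
      = ∑ e ∈ Finset.range (2 ^ k), ∑ i ∈ Finset.range (2 ^ k), ∑ j ∈ Finset.range (2 ^ k),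
        (G e i j b).toReal := by
  rw [uniformBits_bind_bitsValue k (fun e => (uniformBits k).bind fun r₂ =>
    (uniformBits k).bind fun r₃ => G e (bitsValue r₂) (bitsValue r₃)) b]
  have e2 : ∀ e, ((uniformBits k).bind fun r₂ => (uniformBits k).bind fun r₃ =>
      G e (bitsValue r₂) (bitsValue r₃)) b = (2 ^ k)⁻¹ * ∑ i ∈ Finset.range (2 ^ k),
        ((uniformBits k).bind fun r₃ => G e i (bitsValue r₃)) b := fun e =>
    uniformBits_bind_bitsValue k (fun i => (uniformBits k).bind fun r₃ => G e i (bitsValue r₃)) b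
  have e3 : ∀ e i, ((uniformBits k).bind fun r₃ => G e i (bitsValue r₃)) b
      = (2 ^ k)⁻¹ * ∑ j ∈ Finset.range (2 ^ k), G e i j b := fun e i =>
    uniformBits_bind_bitsValue k (G e i) b
  simp only [e2, e3]
  have h0 : ∀ e i j, G e i j b ≠ ⊤ := fun e i j => PMF.apply_ne_top _ _
  have h2 : ((2 ^ k)⁻¹ : ENNReal) ≠ ⊤ := by simp
  have h1 : ∀ e i, ∑ j ∈ Finset.range (2 ^ k), G e i j b ≠ ⊤ := fun e i =>
    ENNReal.sum_ne_top.2 fun j _ => h0 e i j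
  have h3 : ∀ e, ∑ i ∈ Finset.range (2 ^ k), (2 ^ k : ENNReal)⁻¹ * ∑ j ∈ Finset.range (2 ^ k),
      G e i j b ≠ ⊤ := fun e =>
    ENNReal.sum_ne_top.2 fun i _ => ENNReal.mul_ne_top h2 (h1 e i)
  rw [ENNReal.toReal_mul, ENNReal.toReal_sum fun e _ => ENNReal.mul_ne_top h2 (h3 e)]
  simp only [ENNReal.toReal_mul, ENNReal.toReal_inv, ENNReal.toReal_pow, ENNReal.toReal_ofNat,
    ← Finset.mul_sum]
  push_cast
  field_simp
  refine Finset.sum_congr rfl fun e _ => ?_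
  rw [ENNReal.toReal_sum fun i _ => h1 e i]
  exact Finset.sum_congr rfl fun i _ => ENNReal.toReal_sum fun j _ => h0 e i j

theorem length_randomOracle {l : ℕ} (i : ℕ) (d : Data) (tbl : List Bool → Option (List Bool))
    (h : ∀ q v, tbl q = some v → v.length = l) :
    ∀ r ∈ (randomOracle l i d tbl).support, r.1.length ≤ l + 1 ∧
      ∀ q v, r.2 q = some v → v.length = l := by
  intro r hr
  cases ht : tbl d.toBits with
  | some v =>
    simp only [randomOracle, ht, PMF.support_pure, Set.mem_singleton_iff] at hr
    subst hr
    exact ⟨by rw [h _ _ ht]; omega, h⟩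
  | none =>
    simp only [randomOracle, ht] at hr
    obtain ⟨y, hy, rfl⟩ := (PMF.mem_support_map_iff _ _ _).1 hr
    have hy := length_of_mem_uniformBits hy
    refine ⟨by simp only; omega, fun q v hq => ?_⟩
    simp only [Function.update_apply] at hq
    split_ifs at hq with h1
    · rw [← Option.some.inj hq]; exact hy
    · exact h q v hq

/-- The distinguisher that simulates the game with random guesses. -/
theorem exists_distinguisher (hl : ∀ k m, (hmac k m).length = k.length)
    (hm : PT fun x : List Bool × List Bool => hmac x.1 x.2) (A : PPT) (a : ℕ) :
    ∃ D : PPT, ∀ l,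
      (((2 ^ guessBits a l : ℕ) : ℝ) ^ 3 * prKeyed hmac D l
        = ∑ e ∈ Finset.range (2 ^ guessBits a l), ∑ i ∈ Finset.range (2 ^ guessBits a l),
          ∑ j ∈ Finset.range (2 ^ guessBits a l),
          (guessKeyed hmac l (A.tree l) (2 ^ guessBits a l - 1) e i j true).toReal) ∧
      (((2 ^ guessBits a l : ℕ) : ℝ) ^ 3 * prRandom D l
        = ∑ e ∈ Finset.range (2 ^ guessBits a l), ∑ i ∈ Finset.range (2 ^ guessBits a l),
          ∑ j ∈ Finset.range (2 ^ guessBits a l),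
          (guessRandom hmac l (A.tree l) (2 ^ guessBits a l - 1) e i j true).toReal) := by
  obtain ⟨G, hG⟩ := simulator_growth hl
  obtain ⟨D, hD⟩ := Simulator.exists_ppt A (simulator hmac) PT.simulator_pre
    (PT.simulator_post hl hm) PT.simulator_lastQuery (PT.simulator_outcome hl hm)
    (PT.guessBits a) (setup := fun l => simSetup (guessBits a l)) (PT.simSetup a)
    (fun l st => st.2.Short (l + 1))
    (fun l r₁ r₂ r₃ _ _ _ => ⟨fun x hx => (by cases hx), fun x hx => by cases hx⟩) G hG
  refine ⟨D, fun l => ⟨?_, ?_⟩⟩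
  · have key : ∀ k ∈ (uniformBits l).support,
        (D.run (keyedOracle hmac k) l ()).map (fun r => r.1.toBool)
          = (uniformBits (guessBits a l)).bind fun r₁ => (uniformBits (guessBits a l)).bind fun r₂ =>
            (uniformBits (guessBits a l)).bind fun r₃ =>
            (simulator hmac).game (keyOracle hmac) l (A.tree l)
              (simSetup (guessBits a l) r₁ r₂ r₃, k) := by
      intro k hk
      have hk := length_of_mem_uniformBits hk
      rw [hD l Unit (keyedOracle hmac k) (fun _ => True) (fun i d s _ r hr => by
        rw [keyedOracle, PMF.support_pure, Set.mem_singleton_iff] at hr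
        subst hr
        simp only [hl, hk]
        exact ⟨by omega, trivial⟩) () trivial, ← Simulator.interp_tree,
        Tree.interp_map (O₁ := keyedOracle hmac k) (O₂ := keyOracle hmac) (fun _ => k)
          (fun i d s => by simp only [keyOracle, keyedOracle, PMF.pure_bind]) _ (),
        PMF.map_bind]
      simp only [PMF.pure_map]
      rfl
    rw [prKeyed, pmf_bind_congr key]
    rw [← toReal_average]
    simp only [guessKeyed]
    -- The key is drawn after the guesses on one side and before them on the other; independent
    -- draws commute.
    rw [PMF.bind_comm]
    congr 4
    funext r₁
    rw [PMF.bind_comm]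
    congr 1
    funext r₂
    rw [PMF.bind_comm]
    congr 1
    funext r₃
    simp only [simSetup, bitsValue_replicate]
  · rw [prRandom, hD l _ (randomOracle l) (fun tbl => ∀ q v, tbl q = some v → v.length = l)
      length_randomOracle _ (fun q v hq => by cases hq), Simulator.interp_tree, ← toReal_average]
    simp only [guessRandom, simSetup, bitsValue_replicate]

theorem sum_telescope (N : ℕ) (A B : ℕ → ℝ) (h : ∀ e < N, B e = A (e + 1)) :
    ∑ e ∈ Finset.range (N + 1), A e - ∑ e ∈ Finset.range (N + 1), B e = A 0 - B N := by
  rw [Finset.sum_range_succ', Finset.sum_range_succ,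
    Finset.sum_congr rfl fun e he => h e (Finset.mem_range.1 he)]
  ring

theorem forgeProb_le (hl : ∀ k m, (hmac k m).length = k.length)
    (hm : PT fun x : List Bool × List Bool => hmac x.1 x.2) (A : PPT) :
    ∃ (D : PPT) (p : Polynomial ℕ), ∀ l : ℕ, (raft hmac).forgeProb A l
        ≤ ((p.eval l : ℕ) : ℝ) * (prfAdvantage hmac D l + 1 / 2 ^ l) := by
  -- With this exponent `M = 2 ^ guessBits a l` exceeds the number of queries, and `N = M - 1` is at
  -- least the size bound required by `forgeUTT_le`.
  obtain ⟨a, ha⟩ := polyEval_le_pow (A.bound + 4 * .X + 5)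
  obtain ⟨D, hD⟩ := exists_distinguisher hl hm A a
  -- `(2 * l + 5) ^ a` bounds `M`, and there are `M ^ 3` triples of guesses.
  refine ⟨D, (2 * .X + 5) ^ (a * 3), fun l => ?_⟩
  obtain ⟨h1, h2⟩ := hD l
  have hM := (ha l).trans (pow_le_two_pow_guessBits a l)
  have hM' := two_pow_guessBits_le a l
  simp only [Polynomial.eval_add, Polynomial.eval_mul, Polynomial.eval_X,
    Polynomial.eval_ofNat] at hM
  generalize 2 ^ guessBits a l = M at h1 h2 hM hM'
  obtain ⟨N, rfl⟩ : ∃ N, M = N + 1 := ⟨M - 1, by omega⟩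
  rw [Nat.add_sub_cancel] at h1 h2
  have hforge : (raft hmac).forgeProb A l ≤ ∑ i ∈ Finset.range (N + 1),
      ∑ j ∈ Finset.range (N + 1), (guessKeyed hmac l (A.tree l) N 0 i j true).toReal := by
    have h := forgeUTT_le hl A (l := l) (N := N) (M := N + 1) (by omega) (by omega)
    have ht : ∀ i j, guessKeyed hmac l (A.tree l) N 0 i j true ≠ ⊤ := fun _ _ =>
      PMF.apply_ne_top _ _
    have ht' : ∀ i, ∑ j ∈ Finset.range (N + 1), guessKeyed hmac l (A.tree l) N 0 i j true ≠ ⊤ :=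
      fun i => ENNReal.sum_ne_top.2 fun j _ => ht i j
    have h3 := ENNReal.toReal_mono (ENNReal.sum_ne_top.2 fun i _ => ht' i) h
    rw [ENNReal.toReal_sum fun i _ => ht' i] at h3
    simp only [ENNReal.toReal_sum fun j _ => ht _ j] at h3
    exact h3
  have htel : ((N + 1 : ℕ) : ℝ) ^ 3 * (prKeyed hmac D l - prRandom D l)
      = ∑ i ∈ Finset.range (N + 1), ∑ j ∈ Finset.range (N + 1),
        ((guessKeyed hmac l (A.tree l) N 0 i j true).toReal
          - (guessRandom hmac l (A.tree l) N N i j true).toReal) := by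
    -- The sum over the levels is moved to the innermost place, where it telescopes.
    rw [mul_sub, h1, h2, Finset.sum_comm, Finset.sum_comm (f := fun e i => ∑ j ∈ _,
      (guessRandom hmac l (A.tree l) N e i j true).toReal), ← Finset.sum_sub_distrib]
    refine Finset.sum_congr rfl fun i _ => ?_
    rw [Finset.sum_comm, Finset.sum_comm (f := fun e j =>
      (guessRandom hmac l (A.tree l) N e i j true).toReal), ← Finset.sum_sub_distrib]
    refine Finset.sum_congr rfl fun j _ => ?_
    exact sum_telescope N (fun e => (guessKeyed hmac l (A.tree l) N e i j true).toReal)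
      (fun e => (guessRandom hmac l (A.tree l) N e i j true).toReal)
      fun e he => by rw [guessRandom_eq_guessKeyed _ he]
  have hend : ∑ i ∈ Finset.range (N + 1), ∑ j ∈ Finset.range (N + 1),
      (guessRandom hmac l (A.tree l) N N i j true).toReal
      ≤ ((N + 1 : ℕ) : ℝ) ^ 2 * (1 / 2 ^ l) := by
    have h3 : ∀ i j, (guessRandom hmac l (A.tree l) N N i j true).toReal ≤ 1 / 2 ^ l := fun i j => by
      have := ENNReal.toReal_mono (by simp) (guessRandom_le (hmac := hmac) (l := l) (N := N)
        (by omega) (A.tree l) i j)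
      simpa using this
    calc _ ≤ ∑ i ∈ Finset.range (N + 1), ∑ j ∈ Finset.range (N + 1), (1 / 2 ^ l : ℝ) :=
          Finset.sum_le_sum fun i _ => Finset.sum_le_sum fun j _ => h3 i j
      _ = _ := by
        simp only [Finset.sum_const, Finset.card_range, nsmul_eq_mul]
        ring
  simp only [Finset.sum_sub_distrib] at htel
  have hadv : prKeyed hmac D l - prRandom D l ≤ prfAdvantage hmac D l := le_abs_self _
  have hadv0 : 0 ≤ prfAdvantage hmac D l := abs_nonneg _
  have hpow0 : (0 : ℝ) ≤ 1 / 2 ^ l := by positivity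
  have hM1 : (1 : ℝ) ≤ ((N + 1 : ℕ) : ℝ) := by push_cast; linarith [Nat.cast_nonneg (α := ℝ) N]
  have hq : ((N + 1 : ℕ) : ℝ) ^ 3
      ≤ (((((2 * .X + 5) ^ (a * 3) : Polynomial ℕ)).eval l : ℕ) : ℝ) := by
    rw [← Nat.cast_pow, Nat.cast_le, Polynomial.eval_pow, pow_mul]
    refine Nat.pow_le_pow_left (hM'.trans_eq ?_) 3
    simp
  calc (raft hmac).forgeProb A l
      ≤ ((N + 1 : ℕ) : ℝ) ^ 3 * (prKeyed hmac D l - prRandom D l)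
        + ((N + 1 : ℕ) : ℝ) ^ 2 * (1 / 2 ^ l) := by linarith
    -- The factor of `2 ^ (-l)` is only a square; it is enlarged to a cube to match the factor of
    -- the advantage.
    _ ≤ ((N + 1 : ℕ) : ℝ) ^ 3 * prfAdvantage hmac D l
        + ((N + 1 : ℕ) : ℝ) ^ 3 * (1 / 2 ^ l) := by
      gcongr
      norm_num
    _ = ((N + 1 : ℕ) : ℝ) ^ 3 * (prfAdvantage hmac D l + 1 / 2 ^ l) := by ring
    _ ≤ _ := by gcongr

theorem Negligible.polynomial_mul {f : ℕ → ℝ} (hf : Negligible f) (p : Polynomial ℕ) :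
    Negligible fun l => ((p.eval l : ℕ) : ℝ) * f l := by
  have := Asymptotics.SuperpolynomialDecay.polynomial_mul hf (p.map (Nat.castRingHom ℝ))
  simp only [Polynomial.eval_natCast_map, Nat.coe_castRingHom, Nat.cast_id] at this
  exact this

theorem negligible_two_pow : Negligible fun l => 1 / 2 ^ l := by
  intro n
  have := tendsto_pow_const_mul_const_pow_of_abs_lt_one n (r := (1 / 2 : ℝ)) (by norm_num [abs_lt])
  simpa only [one_div, inv_pow] using this

end reduction

end RAF

theorem mainTheorem1
    (hmac : List Bool → List Bool → List Bool)
    (hmac_length : ∀ k m, (hmac k m).length = k.length)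
    (hmac_polyTime : RAF.PolyTime
      (fun a : List Bool × List Bool => .pair (.ofBits a.1) (.ofBits a.2))
      (fun a => .ofBits (hmac a.1 a.2)))
    (hmac_prf : RAF.IsPRF hmac) :
    (RAF.raft hmac).IsUserTiedToken ∧
    (RAF.raft hmac).IsUnforgeable ∧
    ∀ A : RAF.PPT, ∃ (D : RAF.PPT) (p : Polynomial ℕ), ∀ l : ℕ,
      (RAF.raft hmac).forgeProb A l
        ≤ ((p.eval l : ℕ) : ℝ) * (RAF.prfAdvantage hmac D l + 1 / 2 ^ l) := by
  have hm := RAF.PT.of_polyTime (f := fun x : List Bool × List Bool => hmac x.1 x.2) hmac_polyTime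
  refine ⟨RAF.raft_isUserTiedToken hmac_length hm, fun A => ?_,
    RAF.forgeProb_le hmac_length hm⟩
  -- Unforgeability is the quantitative bound for a distinguisher whose advantage is negligible by
  -- assumption; polynomial factors preserve negligibility.
  obtain ⟨D, p, h⟩ := RAF.forgeProb_le hmac_length hm A
  obtain ⟨α, hα, hD⟩ := hmac_prf D
  refine ⟨fun l => ((p.eval l : ℕ) : ℝ) * (α l + 1 / 2 ^ l),
    RAF.Negligible.polynomial_mul (hα.add RAF.negligible_two_pow) p, fun l => (h l).trans ?_⟩
  exact mul_le_mul_of_nonneg_left (by gcongr; exact hD l) (Nat.cast_nonneg _)
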